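/- **Improperly self-dual chiral 4-polytopes of types $\{3,6,3\}$ and $\{3,18,3\}$.** Conventions. An abstract $n$-polytope is a partially ordered set with a strictly monotone rank function onto $\{-1,0,\dots,n\}$, with a least and a greatest face, all of whose flags (maximal chains) have $n+2$ faces, and which is strongly flag-connected and satisfies the diamond condition. $\Gamma(\mathcal P)$ is the group of (order- and rank-preserving) automorphisms of $\mathcal P$, acting on the right, and $\Phi^i$ is the flag that differs from the flag $\Phi$ exactly in its $i$-face. $\mathcal P$ is of type $\{p_1,\dots,p_{n-1}\}$ if every section between an $(i-2)$-face and an incident $(i+1)$-face is a $p_i$-gon. $\mathcal P$ is chiral if $\Gamma(\mathcal P)$ has exactly two orbits on flags and adjacent flags always lie in different orbits. A duality of $\mathcal P$ is an order-reversing bijection $\mathcal P\to\mathcal P$, preserving incidence in both directions; a polarity is a duality of order $2$. $\mathcal P$ is self-dual if it has a duality; it is then properly self-dual if some duality preserves the $\Gamma(\mathcal P)$-orbit of every flag, and improperly self-dual otherwise. (1) There is a finite chiral, improperly self-dual $4$-polytope $\mathcal P$ of type $\{3,6,3\}$ such that $|\Gamma(\mathcal P)|=18522$ and, for some base flag $\Phi$,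 $\Gamma(\mathcal P)$ is generated by automorphisms $\sigma_1,\sigma_2,\sigma_3$ with $\sigma_i$ taking $\Phi$ to $(\Phi^i)^{i-1}$ (so that it coincides with the rotation group of $\mathcal P$), and has in these generators the presentation with defining relations $$\sigma_1^3=\sigma_2^6=\sigma_3^3=(\sigma_1\sigma_2)^2=(\sigma_2\sigma_3)^2=(\sigma_1\sigma_2\sigma_3)^2=1,$$ $$(\sigma_1^{-1}\sigma_2^{2})^4\sigma_1\sigma_2^{-2}=(\sigma_2^{2}\sigma_3^{-1})^3\sigma_2^{2}\sigma_3\sigma_2^{-2}\sigma_3^{-1}=(\sigma_2^{-1}\sigma_3\sigma_1\sigma_2^{-1}\sigma_3\sigma_2\sigma_1)^2=1.$$ It has $147$ vertices, $3087$ edges, $3087$ $2$-faces and $147$ $3$-faces. Every duality of $\mathcal P$ takes every flag to (the reverse of) a flag in the other $\Gamma(\mathcal P)$-orbit, and $\mathcal P$ admits no polarity at all: it has exactly $18522$ dualities, of which $6174$ have order $4$ and $12348$ have order $12$. (2) There is a finite chiral, improperly self-dual $4$-polytope $\mathcal P$ of type $\{3,18,3\}$ such that $|\Gamma(\mathcal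 P)|=39366$ and, for some base flag $\Phi$, $\Gamma(\mathcal P)$ is generated by automorphisms $\sigma_1,\sigma_2,\sigma_3$ with $\sigma_i$ taking $\Phi$ to $(\Phi^i)^{i-1}$ (so that it coincides with the rotation group of $\mathcal P$), and has in these generators the presentation with defining relations $$\sigma_1^3=\sigma_2^{18}=\sigma_3^3=(\sigma_1\sigma_2)^2=(\sigma_2\sigma_3)^2=(\sigma_1\sigma_2\sigma_3)^2=1,$$ $$\sigma_2^{5}\sigma_1\sigma_2^{-2}\sigma_1\sigma_2^{-1}\sigma_1\sigma_2^{-4}\sigma_1=(\sigma_2^{-1}\sigma_3\sigma_1\sigma_2^{-1}\sigma_3^{-1}\sigma_1\sigma_2^{-1}\sigma_1)^2=1,$$ $$\sigma_2^{2}\sigma_1^{-1}\sigma_3\sigma_2\sigma_1\sigma_2^{-1}\sigma_3\sigma_2^{2}\sigma_1^{-1}\sigma_3\sigma_2\sigma_1^{-1}\sigma_2\sigma_1^{-1}=1.$$ It has $81$ vertices, $6561$ edges, $6561$ $2$-faces and $81$ $3$-faces. Every duality of $\mathcal P$ takes every flag to (the reverse of) a flag in the other $\Gamma(\mathcal P)$-orbit,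 and $\mathcal P$ admits no polarity at all: it has exactly $39366$ dualities, of which $4374$ have order $4$, $8748$ have order $12$, and $26244$ have order $36$. -/

import Mathlib

/-- An abstract polytope of rank `n`: a partially ordered set of faces with a strictly monotone
rank function onto `{-1, 0, …, n}`, a least and a greatest face, all flags (maximal chains) of size
`n + 2`, strong flag connectedness, and the diamond condition. -/
structure AbstractPolytope (n : ℕ) where
  /-- The faces. -/
  Face : Type
  [order : PartialOrder Face]
  /-- The rank (dimension) of a face. -/
  rank : Face → ℤ
  strictMono_rank : StrictMono rank
  range_rank : Set.range rank = Set.Icc (-1) (n : ℤ)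
  exists_least : ∃ F : Face, ∀ G, F ≤ G
  exists_greatest : ∃ F : Face, ∀ G, G ≤ F
  ncard_flag : ∀ Φ : Flag Face, (Φ : Set Face).ncard = n + 2
  /-- Any two flags are joined by a sequence of flags, all containing the intersection of the two,
  in which successive flags agree in all faces except those of one rank. -/
  strongly_flag_connected : ∀ Φ Ψ : Flag Face,
    Relation.ReflTransGen
      (fun X Y : Flag Face =>
        ((Φ : Set Face) ∩ Ψ ⊆ Y) ∧
          ∃ i : ℤ, X ≠ Y ∧ ∀ F, rank F ≠ i → (F ∈ X ↔ F ∈ Y)) Φ Ψ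
  diamond : ∀ (j : ℤ) (F G : Face), F ≤ G → rank F = j - 1 → rank G = j + 1 →
    {H : Face | rank H = j ∧ F ≤ H ∧ H ≤ G}.ncard = 2

namespace AbstractPolytope

attribute [instance] AbstractPolytope.order

variable {n m : ℕ}

/-- The automorphism group `Γ(P)`, acting on faces and on flags.  An order automorphism of a
polytope automatically preserves ranks.  Products are compositions, `(f * g) F = f (g F)`. -/
abbrev Aut (P : AbstractPolytope n) : Type := P.Face ≃o P.Face

/-- `Φ` and `Ψ` are `i`-adjacent: they are distinct, and differ only in their `i`-faces. -/
def AdjacentAt (P : AbstractPolytope n) (i : ℤ) (Φ Ψ : Flag P.Face) : Prop :=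
  Φ ≠ Ψ ∧ ∀ F, P.rank F ≠ i → (F ∈ Φ ↔ F ∈ Ψ)

/-- `P` is equivelar of Schläfli type `{p₁, …, pₘ}` (rank `m + 1`): each section `G / F` between a
face `F` of rank `i - 2` and an incident face `G` of rank `i + 1` is a polygon with `pᵢ` sides,
the sides being the faces of rank `i` in it.  With `i : Fin m` counted from zero, `i` is replaced
by `i + 1`. -/
def HasSchlafliType (P : AbstractPolytope (m + 1)) (p : Fin m → ℕ) : Prop :=
  ∀ (i : Fin m) (F G : P.Face), F ≤ G → P.rank F = (i : ℤ) - 1 → P.rank G = (i : ℤ) + 2 →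
    {H : P.Face | P.rank H = (i : ℤ) + 1 ∧ F ≤ H ∧ H ≤ G}.ncard = p i

/-- The number of `i`-faces. -/
noncomputable def numFaces (P : AbstractPolytope n) (i : ℤ) : ℕ :=
  {F : P.Face | P.rank F = i}.ncard

/-- `P` is chiral: its automorphism group has exactly two orbits on flags, and adjacent flags
always lie in different orbits. -/
def IsChiral (P : AbstractPolytope n) : Prop :=
  Nat.card (MulAction.orbitRel.Quotient P.Aut (Flag P.Face)) = 2 ∧
    ∀ (i : ℤ) (Φ Ψ : Flag P.Face), P.AdjacentAt i Φ Ψ → Ψ ∉ MulAction.orbit P.Aut Φ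

/-- A duality of `P` with itself: an incidence-preserving, order-reversing bijection. -/
def IsDuality (P : AbstractPolytope n) (δ : Equiv.Perm P.Face) : Prop :=
  ∀ F G, δ F ≤ δ G ↔ G ≤ F

/-- A polarity: a duality of order two. -/
def IsPolarity (P : AbstractPolytope n) (δ : Equiv.Perm P.Face) : Prop :=
  P.IsDuality δ ∧ orderOf δ = 2

/-- `P` is self-dual: it is isomorphic to its dual. -/
def IsSelfDual (P : AbstractPolytope n) : Prop :=
  ∃ δ : Equiv.Perm P.Face, P.IsDuality δ

/-- The image of the flag `Φ` under `δ`, as a set of faces, is a flag in the `Γ(P)`-orbit of `Φ`. -/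
def KeepsOrbit (P : AbstractPolytope n) (δ : Equiv.Perm P.Face) (Φ : Flag P.Face) : Prop :=
  ∃ Ψ ∈ MulAction.orbit P.Aut Φ, δ '' (Φ : Set P.Face) = (Ψ : Set P.Face)

/-- `P` is properly self-dual: some duality preserves the `Γ(P)`-orbit of every flag. -/
def IsProperlySelfDual (P : AbstractPolytope n) : Prop :=
  ∃ δ : Equiv.Perm P.Face, P.IsDuality δ ∧ ∀ Φ : Flag P.Face, P.KeepsOrbit δ Φ

/-- `P` is improperly self-dual: it is self-dual, but not properly. -/
def IsImproperlySelfDual (P : AbstractPolytope n) : Prop :=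
  P.IsSelfDual ∧ ¬ P.IsProperlySelfDual

/-- The number of dualities of `P` of order `k` in the symmetric group on the faces. -/
noncomputable def numDualities (P : AbstractPolytope n) (k : ℕ) : ℕ :=
  {δ : Equiv.Perm P.Face | P.IsDuality δ ∧ orderOf δ = k}.ncard

/-- `σ₁, …, σₘ` are the distinguished rotations of `P` for the base flag `Φ`: the automorphism
`σᵢ` takes `Φ` to `(Φ^i)^(i-1)`.  With `i : Fin m` counted from zero, `i` is replaced by `i + 1`. -/
def IsDistinguished (P : AbstractPolytope (m + 1)) (Φ : Flag P.Face) (σ : Fin m → P.Aut) : Prop :=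
  ∀ i : Fin m, ∃ Ψ : Flag P.Face, P.AdjacentAt ((i : ℤ) + 1) Φ Ψ ∧ P.AdjacentAt (i : ℤ) Ψ (σ i • Φ)

/-- For some base flag, the whole group `Γ(P)` is generated by the distinguished rotations (so that
it is equal to the rotation group), and the given relators form a presentation of it in these
generators.  Automorphisms act on the right in this convention: a word `σᵢσⱼ` means first `σᵢ`, then
`σⱼ`, hence the opposite group. -/
def HasRotationPresentation (P : AbstractPolytope (m + 1))
    (rels : Set (FreeGroup (Fin m))) : Prop :=
  ∃ (Φ : Flag P.Face) (σ : Fin m → P.Aut), P.IsDistinguished Φ σ ∧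
    ∃ e : PresentedGroup rels ≃* P.Autᵐᵒᵖ,
      ∀ i : Fin m, e (PresentedGroup.of i) = MulOpposite.op (σ i)

end AbstractPolytope

/-- The defining relators `σ₁ᵖ, σ₂^q, σ₃ʳ, (σ₁σ₂)², (σ₂σ₃)², (σ₁σ₂σ₃)²` of the rotation subgroup of
the string Coxeter group `[p, q, r]`, evaluated at three elements of a group. -/
def coxeterRotationRelators {G : Type*} [Group G] (p q r : ℕ) (s₁ s₂ s₃ : G) : Set G :=
  {s₁ ^ p, s₂ ^ q, s₃ ^ r, (s₁ * s₂) ^ 2, (s₂ * s₃) ^ 2, (s₁ * s₂ * s₃) ^ 2}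

/-- The three extra relators for type `{3, 6, 3}`. -/
def extraRelators363 {G : Type*} [Group G] (s₁ s₂ s₃ : G) : Set G :=
  {(s₁⁻¹ * s₂ ^ 2) ^ 4 * s₁ * (s₂ ^ 2)⁻¹,
   (s₂ ^ 2 * s₃⁻¹) ^ 3 * s₂ ^ 2 * s₃ * (s₂ ^ 2)⁻¹ * s₃⁻¹,
   (s₂⁻¹ * s₃ * s₁ * s₂⁻¹ * s₃ * s₂ * s₁) ^ 2}

/-- The three extra relators for type `{3, 18, 3}`. -/
def extraRelators3183 {G : Type*} [Group G] (s₁ s₂ s₃ : G) : Set G :=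
  {s₂ ^ 5 * s₁ * (s₂ ^ 2)⁻¹ * s₁ * s₂⁻¹ * s₁ * (s₂ ^ 4)⁻¹ * s₁,
   (s₂⁻¹ * s₃ * s₁ * s₂⁻¹ * s₃⁻¹ * s₁ * s₂⁻¹ * s₁) ^ 2,
   s₂ ^ 2 * s₁⁻¹ * s₃ * s₂ * s₁ * s₂⁻¹ * s₃ * s₂ ^ 2 * s₁⁻¹ * s₃ * s₂ * s₁⁻¹ * s₂ * s₁⁻¹}

/-- The relators of the group `A`, in the free group on `σ₁, σ₂, σ₃`. -/
def relators363 : Set (FreeGroup (Fin 3)) :=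
  coxeterRotationRelators 3 6 3 (FreeGroup.of 0) (FreeGroup.of 1) (FreeGroup.of 2) ∪
    extraRelators363 (FreeGroup.of 0) (FreeGroup.of 1) (FreeGroup.of 2)

/-- The relators of the group `B`, in the free group on `σ₁, σ₂, σ₃`. -/
def relators3183 : Set (FreeGroup (Fin 3)) :=
  coxeterRotationRelators 3 18 3 (FreeGroup.of 0) (FreeGroup.of 1) (FreeGroup.of 2) ∪
    extraRelators3183 (FreeGroup.of 0) (FreeGroup.of 1) (FreeGroup.of 2)

/-!
Both polytopes are coset geometries of the presented groups themselves, and everything except the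
two finite computations is done for a general group `G` with generators `s₁, s₂, s₃`.

*The polytope.* In a `RotationSystem` the generators satisfy the standard relations of type
`{3, q, 3}` and the intersection property. The faces are the cosets of the subgroups
`⟨s₂, s₃⟩`, `⟨s₁ s₂, s₃⟩`, `⟨s₁, s₂ s₃⟩`, `⟨s₁, s₂⟩`, the stabilizers of the base faces of ranks `0`
to `3`, and two improper faces; incidence is nonempty intersection. The flags are the images, under
`G`, of the base flag and of the flag that differs from it in the vertex
(`RotationSystem.exists_eq_flag`), and `G` acts freely on them. The diamond condition and the type
come from the intersections of the stabilizers, and strong flag connectedness from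
`RotationSystem.mem_rotationSubgroup`. If a relation of `s₁, s₂, s₃` fails for their mirror images
`s₁⁻¹, s₁ s₂⁻¹ s₁⁻¹, s₃` (`RotationSystem.Irreflexible`), no automorphism interchanges the two orbits
of flags, so that `G` is the full automorphism group and the polytope is chiral.

*The dualities.* A `RotationSystem.Twist` is an endomorphism `e` of `G` with `s₁ ↦ s₂ s₃ s₂⁻¹`,
`s₂ ↦ s₂`, `s₃ ↦ s₁`. It induces a duality `T` that interchanges the two orbits of flags, with
`T ^ 2 = s₂`, so that `T` has order `2 q`. All dualities are products of `T` with automorphisms, and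
hence interchange the two orbits as well. Let `q = 2 (2 r + 1)`. The odd powers of `T` are dualities,
and among them `T ^ (2 r + 1)` has order four. If it interchanges just one pair of a vertex and an
incident facet, the conjugates of the odd powers of `T` by representatives of the cosets of `⟨s₂⟩`
are distinct, and by counting they are all dualities. Their orders are `2 q / gcd (2 q, 2 k + 1)`; all
are divisible by four, and there is no polarity (`RotationSystem.Twist.numDualities_eq`).

*The groups.* What remains is a computation in each of the two presented groups. A table of the
action on the cosets of `⟨σ₁, σ₂⟩`, together with the same table twisted by `e`, gives lower bounds for
the orders of the group and of `⟨σ₁, σ₂⟩`. Upper bounds come from coset enumeration: starting from a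
spanning tree of the coset graph, a relator that closes up with a single unknown edge shows that this
edge is correct, and a list of such deductions reaches all edges
(`CosetEnumeration.exists_interpretation`). The bounds agree. Hence the stabilizers in the two
actions are known, which gives the intersection property, and the two actions are jointly faithful,
which shows that `e` is well defined. A `CosetCertificate` collects the decidable conditions on the
table that this needs, and `CosetCertificate.exists_polytope` draws the conclusion. The conditions are
checked by kernel evaluation for the tables of `147` and `81` cosets.
-/

/-! ### Rotation systems -/

/-- In a dihedral group, generated by `b` and `a` with `b` and `b * a` of order dividing two, every
element is a power of `a`, or such a power times `b`. -/
theorem mem_closure_dihedral {G : Type*} [Group G] {a b : G} (hb : b * b = 1)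
    (hba : b * a * (b * a) = 1) {x : G} (hx : x ∈ Subgroup.closure {b, a}) :
    ∃ n : ℤ, x = a ^ n ∨ x = a ^ n * b := by
  have hb' : b⁻¹ = b := inv_eq_of_mul_eq_one_left hb
  have h1 : b * a * b⁻¹ = a⁻¹ := by
    rw [hb', eq_inv_iff_mul_eq_one]; simpa [mul_assoc] using hba
  have hc : ∀ n : ℤ, b * a ^ n = a ^ (-n) * b := by
    intro n
    have : (b * a * b⁻¹) ^ n = b * a ^ n * b⁻¹ := by rw [conj_zpow]
    rw [h1, inv_zpow, ← zpow_neg] at this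
    rw [this, inv_mul_cancel_right]
  induction hx using Subgroup.closure_induction with
  | mem y hy =>
    rcases hy with rfl | hy
    · exact ⟨0, Or.inr (by simp)⟩
    · rw [Set.mem_singleton_iff] at hy; exact ⟨1, Or.inl (by simp [hy])⟩
  | one => exact ⟨0, Or.inl (by simp)⟩
  | mul y z _ _ ihy ihz =>
    obtain ⟨m, rfl | rfl⟩ := ihy <;> obtain ⟨n, rfl | rfl⟩ := ihz
    · exact ⟨m + n, Or.inl (zpow_add _ _ _).symm⟩
    · exact ⟨m + n, Or.inr (by rw [zpow_add, mul_assoc])⟩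
    · exact ⟨m + -n, Or.inr (by rw [mul_assoc, hc, zpow_add, mul_assoc])⟩
    · exact ⟨m + -n, Or.inl (by rw [mul_assoc, ← mul_assoc b, hc, zpow_add, mul_assoc, hb, mul_one])⟩
  | inv y _ ih =>
    obtain ⟨m, rfl | rfl⟩ := ih
    · exact ⟨-m, Or.inl (zpow_neg _ _).symm⟩
    · exact ⟨m, Or.inr (by rw [mul_inv_rev, hb', ← zpow_neg, hc, neg_neg])⟩

theorem zpow_mem_of_cube {G : Type*} [Group G] {a : G} (ha : a ^ 3 = 1) {H : Subgroup G}
    (hH : a ∉ H) (n : ℤ) : a ^ n ∈ H ↔ (3 : ℤ) ∣ n := by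
  constructor
  · intro h
    by_contra h3
    have hz : a ^ (3 : ℤ) = 1 := by exact_mod_cast ha
    apply hH
    have : n % 3 = 1 ∨ n % 3 = 2 := by omega
    have hn : n = n % 3 + 3 * (n / 3) := by omega
    rcases this with h1 | h1
    · rw [hn, h1, zpow_add, zpow_mul, hz] at h
      simpa using h
    · rw [hn, h1, zpow_add, zpow_mul, hz] at h
      have h2 := H.inv_mem h
      have : (a ^ (2 : ℤ) * 1 ^ (n / 3))⁻¹ = a := by
        rw [one_zpow, mul_one, inv_eq_iff_mul_eq_one, ← hz]; group
      rwa [this] at h2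
  · rintro ⟨k, rfl⟩
    have hz : a ^ (3 : ℤ) = 1 := by exact_mod_cast ha
    rw [zpow_mul, hz, one_zpow]; exact H.one_mem

theorem zpow_mem_of_involution {G : Type*} [Group G] {a : G} (ha : a * a = 1) {H : Subgroup G}
    (hH : a ∉ H) (n : ℤ) : a ^ n ∈ H ↔ (2 : ℤ) ∣ n := by
  have hz : a ^ (2 : ℤ) = 1 := by rw [zpow_two]; exact ha
  constructor
  · intro h
    by_contra h3
    apply hH
    have hn : n = 1 + 2 * (n / 2) := by omega
    rw [hn, zpow_add, zpow_mul, hz] at h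
    simpa using h
  · rintro ⟨k, rfl⟩
    rw [zpow_mul, hz, one_zpow]; exact H.one_mem

/-- Generators `s₁, s₂, s₃` of a group that behave as the distinguished rotations of a chiral or
directly regular `4`-polytope of type `{3, q, 3}`: the standard relations, and as much of the
intersection property as does not follow from the rest. -/
structure RotationSystem (G : Type) [Group G] (q : ℕ) where
  /-- The rotation of a base `2`-face. -/
  s₁ : G
  /-- The rotation about the base vertex in the base facet. -/
  s₂ : G
  /-- The rotation about a base edge. -/
  s₃ : G
  cube₁ : s₁ ^ 3 = 1
  cube₃ : s₃ ^ 3 = 1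
  sq₁₂ : s₁ * s₂ * (s₁ * s₂) = 1
  sq₂₃ : s₂ * s₃ * (s₂ * s₃) = 1
  sq₁₂₃ : s₁ * s₂ * s₃ * (s₁ * s₂ * s₃) = 1
  order₂ : orderOf s₂ = q
  three_lt : 3 < q
  closure_eq_top : Subgroup.closure {s₁, s₂, s₃} = ⊤
  inter : ∀ x ∈ Subgroup.closure {s₂, s₃}, x ∈ Subgroup.closure {s₁, s₂} →
    x ∈ Subgroup.zpowers s₂
  not_mem₁ : s₁ ∉ Subgroup.closure {s₂, s₃}
  not_mem₃ : s₃ ∉ Subgroup.closure {s₁, s₂}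

namespace RotationSystem

variable {G : Type} [Group G] {q : ℕ} (S : RotationSystem G q)

/-- The half-turn `s₁ s₂`. -/
def u : G := S.s₁ * S.s₂

/-- The half-turn `s₂ s₃`. -/
def w : G := S.s₂ * S.s₃

/-- The half-turn `s₁ s₂ s₃`. -/
def t : G := S.s₁ * S.s₂ * S.s₃

/-- The stabilizers of the base faces, the face of rank `i - 1` having index `i`. -/
def K : Fin 6 → Subgroup G :=
  ![⊤, Subgroup.closure {S.s₂, S.s₃}, Subgroup.closure {S.u, S.s₃}, Subgroup.closure {S.w, S.s₁},
    Subgroup.closure {S.s₁, S.s₂}, ⊤]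

theorem mem_K_zero (x : G) : x ∈ S.K 0 := Subgroup.mem_top x
theorem mem_K_five (x : G) : x ∈ S.K 5 := Subgroup.mem_top x

theorem s₂_mem_K₁ : S.s₂ ∈ S.K 1 := Subgroup.subset_closure (by simp)
theorem s₃_mem_K₁ : S.s₃ ∈ S.K 1 := Subgroup.subset_closure (by simp)
theorem w_mem_K₁ : S.w ∈ S.K 1 := mul_mem S.s₂_mem_K₁ S.s₃_mem_K₁
theorem u_mem_K₂ : S.u ∈ S.K 2 := Subgroup.subset_closure (by simp)
theorem s₃_mem_K₂ : S.s₃ ∈ S.K 2 := Subgroup.subset_closure (by simp)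
theorem t_mem_K₂ : S.t ∈ S.K 2 := mul_mem S.u_mem_K₂ S.s₃_mem_K₂
theorem w_mem_K₃ : S.w ∈ S.K 3 := Subgroup.subset_closure (by simp)
theorem s₁_mem_K₃ : S.s₁ ∈ S.K 3 := Subgroup.subset_closure (by simp)
theorem t_eq_s₁_mul_w : S.t = S.s₁ * S.w := mul_assoc _ _ _
theorem t_eq_u_mul_s₃ : S.t = S.u * S.s₃ := rfl
theorem t_mem_K₃ : S.t ∈ S.K 3 := S.t_eq_s₁_mul_w ▸ mul_mem S.s₁_mem_K₃ S.w_mem_K₃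
theorem s₁_mem_K₄ : S.s₁ ∈ S.K 4 := Subgroup.subset_closure (by simp)
theorem s₂_mem_K₄ : S.s₂ ∈ S.K 4 := Subgroup.subset_closure (by simp)
theorem u_mem_K₄ : S.u ∈ S.K 4 := mul_mem S.s₁_mem_K₄ S.s₂_mem_K₄

theorem u_mul_u : S.u * S.u = 1 := S.sq₁₂
theorem w_mul_w : S.w * S.w = 1 := S.sq₂₃
theorem t_mul_t : S.t * S.t = 1 := S.sq₁₂₃
theorem u_inv : S.u⁻¹ = S.u := inv_eq_of_mul_eq_one_left S.u_mul_u
theorem w_inv : S.w⁻¹ = S.w := inv_eq_of_mul_eq_one_left S.w_mul_w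
theorem t_inv : S.t⁻¹ = S.t := inv_eq_of_mul_eq_one_left S.t_mul_t

theorem u_mul_zpow (n : ℤ) : S.u * S.s₃ ^ n = S.s₃ ^ (-n) * S.u := by
  have h1 : S.u * S.s₃ * S.u⁻¹ = S.s₃⁻¹ := by
    rw [u_inv, eq_inv_iff_mul_eq_one]; simpa [mul_assoc, u] using S.sq₁₂₃
  have : (S.u * S.s₃ * S.u⁻¹) ^ n = S.u * S.s₃ ^ n * S.u⁻¹ := by rw [conj_zpow]
  rw [h1, inv_zpow, ← zpow_neg] at this
  rw [this, inv_mul_cancel_right]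

theorem w_mul_s₁_mul : S.w * S.s₁ * (S.w * S.s₁) = 1 := by
  have h := S.t_mul_t
  rw [t_eq_s₁_mul_w] at h
  have := congrArg (fun x => S.s₁⁻¹ * x * S.s₁) h
  simpa [mul_assoc] using this

theorem w_mul_zpow (n : ℤ) : S.w * S.s₁ ^ n = S.s₁ ^ (-n) * S.w := by
  have h1 : S.w * S.s₁ * S.w⁻¹ = S.s₁⁻¹ := by
    rw [w_inv, eq_inv_iff_mul_eq_one]; simpa [mul_assoc] using S.w_mul_s₁_mul
  have : (S.w * S.s₁ * S.w⁻¹) ^ n = S.w * S.s₁ ^ n * S.w⁻¹ := by rw [conj_zpow]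
  rw [h1, inv_zpow, ← zpow_neg] at this
  rw [this, inv_mul_cancel_right]

theorem mem_K₂ {x : G} (hx : x ∈ S.K 2) : ∃ n : ℤ, x = S.s₃ ^ n ∨ x = S.s₃ ^ n * S.u :=
  mem_closure_dihedral S.u_mul_u S.t_mul_t hx

theorem mem_K₃ {x : G} (hx : x ∈ S.K 3) : ∃ n : ℤ, x = S.s₁ ^ n ∨ x = S.s₁ ^ n * S.w :=
  mem_closure_dihedral S.w_mul_w S.w_mul_s₁_mul hx

theorem not_mem_K₁ : S.s₁ ∉ S.K 1 := S.not_mem₁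
theorem not_mem_K₄ : S.s₃ ∉ S.K 4 := S.not_mem₃
theorem u_not_mem_K₁ : S.u ∉ S.K 1 := fun h =>
  S.not_mem_K₁ ((Subgroup.mul_mem_cancel_right _ S.s₂_mem_K₁).1 h)
theorem w_not_mem_K₄ : S.w ∉ S.K 4 := fun h =>
  S.not_mem_K₄ ((Subgroup.mul_mem_cancel_left _ S.s₂_mem_K₄).1 h)
theorem t_not_mem_K₄ : S.t ∉ S.K 4 := fun h =>
  S.not_mem_K₄ ((Subgroup.mul_mem_cancel_left _ S.u_mem_K₄).1 h)

theorem s₁_zpow_eq_one {n : ℤ} (h : S.s₁ ^ n ∈ S.K 1) : S.s₁ ^ n = 1 := by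
  obtain ⟨k, rfl⟩ := (zpow_mem_of_cube S.cube₁ S.not_mem_K₁ n).1 h
  have : S.s₁ ^ (3 : ℤ) = 1 := by exact_mod_cast S.cube₁
  rw [zpow_mul, this, one_zpow]

theorem s₃_zpow_eq_one {n : ℤ} (h : S.s₃ ^ n ∈ S.K 4) : S.s₃ ^ n = 1 := by
  obtain ⟨k, rfl⟩ := (zpow_mem_of_cube S.cube₃ S.not_mem_K₄ n).1 h
  have : S.s₃ ^ (3 : ℤ) = 1 := by exact_mod_cast S.cube₃
  rw [zpow_mul, this, one_zpow]

theorem mem_K₁_K₂ {x : G} (h1 : x ∈ S.K 1) (h2 : x ∈ S.K 2) : ∃ n : ℤ, x = S.s₃ ^ n := by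
  obtain ⟨n, rfl | rfl⟩ := S.mem_K₂ h2
  · exact ⟨n, rfl⟩
  · exact absurd ((Subgroup.mul_mem_cancel_left _ (zpow_mem S.s₃_mem_K₁ n)).1 h1) S.u_not_mem_K₁

theorem mem_K₂_K₄ {x : G} (h2 : x ∈ S.K 2) (h4 : x ∈ S.K 4) : x = 1 ∨ x = S.u := by
  obtain ⟨n, rfl | rfl⟩ := S.mem_K₂ h2
  · exact Or.inl (S.s₃_zpow_eq_one h4)
  · right
    rw [S.s₃_zpow_eq_one ((Subgroup.mul_mem_cancel_right _ S.u_mem_K₄).1 h4), one_mul]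

theorem mem_K₁_K₃ {x : G} (h1 : x ∈ S.K 1) (h3 : x ∈ S.K 3) : x = 1 ∨ x = S.w := by
  obtain ⟨n, rfl | rfl⟩ := S.mem_K₃ h3
  · exact Or.inl (S.s₁_zpow_eq_one h1)
  · right
    rw [S.s₁_zpow_eq_one ((Subgroup.mul_mem_cancel_right _ S.w_mem_K₁).1 h1), one_mul]

theorem mem_K₃_K₄ {x : G} (h3 : x ∈ S.K 3) (h4 : x ∈ S.K 4) : ∃ n : ℤ, x = S.s₁ ^ n := by
  obtain ⟨n, rfl | rfl⟩ := S.mem_K₃ h3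
  · exact ⟨n, rfl⟩
  · exact absurd ((Subgroup.mul_mem_cancel_left _ (zpow_mem S.s₁_mem_K₄ n)).1 h4) S.w_not_mem_K₄

theorem mem_K₁_K₄ {x : G} (h1 : x ∈ S.K 1) (h4 : x ∈ S.K 4) : ∃ n : ℤ, S.s₂ ^ n = x :=
  Subgroup.mem_zpowers_iff.1 (S.inter x h1 h4)

theorem s₂_not_mem_K₂ : S.s₂ ∉ S.K 2 := by
  intro h
  have h3 := S.three_lt
  rcases S.mem_K₂_K₄ h S.s₂_mem_K₄ with h | h
  · have := S.order₂; rw [h, orderOf_one] at this; omega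
  · exact S.u_not_mem_K₁ (h ▸ S.s₂_mem_K₁)

theorem s₂_not_mem_K₃ : S.s₂ ∉ S.K 3 := by
  intro h
  have h3 := S.three_lt
  rcases S.mem_K₁_K₃ S.s₂_mem_K₁ h with h | h
  · have := S.order₂; rw [h, orderOf_one] at this; omega
  · exact S.w_not_mem_K₄ (h ▸ S.s₂_mem_K₄)

theorem w_not_mem_K₂ : S.w ∉ S.K 2 := fun h =>
  S.s₂_not_mem_K₂ ((Subgroup.mul_mem_cancel_right _ S.s₃_mem_K₂).1 h)

theorem u_not_mem_K₃ : S.u ∉ S.K 3 := fun h =>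
  S.s₂_not_mem_K₃ ((Subgroup.mul_mem_cancel_left _ S.s₁_mem_K₃).1 h)

theorem s₁_not_mem_K₂ : S.s₁ ∉ S.K 2 := fun h => by
  rcases S.mem_K₂_K₄ h S.s₁_mem_K₄ with h | h
  · exact S.not_mem_K₁ (h ▸ one_mem _)
  · exact S.u_not_mem_K₃ (h ▸ S.s₁_mem_K₃)

theorem mem_K₂_K₃ {x : G} (h2 : x ∈ S.K 2) (h3 : x ∈ S.K 3) : x = 1 ∨ x = S.t := by
  obtain ⟨n, hn⟩ := S.mem_K₃ h3
  have key : ∀ m : ℤ, S.s₁ ^ m ∈ S.K 2 → S.s₁ ^ m = 1 := by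
    intro m hm
    obtain ⟨k, rfl⟩ := (zpow_mem_of_cube S.cube₁ S.s₁_not_mem_K₂ m).1 hm
    have : S.s₁ ^ (3 : ℤ) = 1 := by exact_mod_cast S.cube₁
    rw [zpow_mul, this, one_zpow]
  rcases hn with rfl | rfl
  · exact Or.inl (key n h2)
  · right
    have hw : S.s₁ ^ n * S.w = S.s₁ ^ (n - 1) * S.t := by
      rw [t_eq_s₁_mul_w, ← mul_assoc, ← zpow_add_one, sub_add_cancel]
    rw [hw] at h2 ⊢
    rw [key _ ((Subgroup.mul_mem_cancel_right _ S.t_mem_K₂).1 h2), one_mul]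

/-- The factorization `K j = (K i ∩ K j) (K j ∩ K k)`, which makes incidence transitive. -/
theorem exists_factor {i j k : Fin 6} (hij : i ≤ j) (hjk : j ≤ k) {x : G} (hx : x ∈ S.K j) :
    ∃ y, y ∈ S.K i ∧ y ∈ S.K j ∧ y⁻¹ * x ∈ S.K k := by
  rcases eq_or_lt_of_le hij with rfl | hij
  · exact ⟨x, hx, hx, by simp⟩
  rcases eq_or_lt_of_le hjk with rfl | hjk
  · exact ⟨1, one_mem _, one_mem _, by simpa using hx⟩
  have h0 : i = 0 → ∃ y, y ∈ S.K i ∧ y ∈ S.K j ∧ y⁻¹ * x ∈ S.K k := by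
    rintro rfl; exact ⟨x, S.mem_K_zero x, hx, by simp⟩
  have h5 : k = 5 → ∃ y, y ∈ S.K i ∧ y ∈ S.K j ∧ y⁻¹ * x ∈ S.K k := by
    rintro rfl; exact ⟨1, one_mem _, one_mem _, S.mem_K_five _⟩
  by_cases hi : i = 0
  · exact h0 hi
  by_cases hk : k = 5
  · exact h5 hk
  obtain rfl | rfl : j = 2 ∨ j = 3 := by omega
  · obtain rfl : i = 1 := by omega
    obtain rfl | rfl : k = 3 ∨ k = 4 := by omega
    · obtain ⟨n, rfl | rfl⟩ := S.mem_K₂ hx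
      · exact ⟨S.s₃ ^ n, zpow_mem S.s₃_mem_K₁ n, hx, by simp⟩
      · refine ⟨S.s₃ ^ (n + 1), zpow_mem S.s₃_mem_K₁ _, zpow_mem S.s₃_mem_K₂ _, ?_⟩
        have : (S.s₃ ^ (n + 1))⁻¹ * (S.s₃ ^ n * S.u) = S.t := by
          have := S.u_mul_zpow 1
          rw [zpow_one] at this
          rw [t_eq_u_mul_s₃, this, zpow_add, zpow_neg, mul_inv_rev]; group
        rw [this]; exact S.t_mem_K₃
    · obtain ⟨n, rfl | rfl⟩ := S.mem_K₂ hx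
      · exact ⟨S.s₃ ^ n, zpow_mem S.s₃_mem_K₁ n, hx, by simp⟩
      · exact ⟨S.s₃ ^ n, zpow_mem S.s₃_mem_K₁ n, zpow_mem S.s₃_mem_K₂ _, by simpa using S.u_mem_K₄⟩
  · obtain rfl : k = 4 := by omega
    obtain ⟨n, rfl | rfl⟩ := S.mem_K₃ hx
    · exact ⟨1, one_mem _, one_mem _, by simpa using zpow_mem S.s₁_mem_K₄ n⟩
    · obtain rfl | rfl : i = 1 ∨ i = 2 := by omega
      · refine ⟨S.w, S.w_mem_K₁, S.w_mem_K₃, ?_⟩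
        have := S.w_mul_zpow (-n)
        rw [neg_neg] at this
        rw [← this, inv_mul_cancel_left]
        exact zpow_mem S.s₁_mem_K₄ _
      · refine ⟨S.t, S.t_mem_K₂, S.t_mem_K₃, ?_⟩
        have := S.w_mul_zpow (-n)
        rw [neg_neg] at this
        rw [← this, t_eq_s₁_mul_w, mul_inv_rev, mul_assoc, ← mul_assoc S.s₁⁻¹]
        have h3 : S.w⁻¹ * (S.s₁⁻¹ * S.w * S.s₁ ^ (-n)) = S.s₁ * S.s₁ ^ (-n) := by
          have h4 : S.w⁻¹ * S.s₁⁻¹ * S.w = S.s₁ := by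
            rw [w_inv]
            have := S.w_mul_zpow (-1)
            rw [zpow_neg_one, neg_neg, zpow_one] at this
            rw [this, mul_assoc, w_mul_w, mul_one]
          rw [← mul_assoc, ← mul_assoc, h4]
        rw [h3]
        exact mul_mem S.s₁_mem_K₄ (zpow_mem S.s₁_mem_K₄ _)

end RotationSystem

/-! ### The coset geometry -/

namespace RotationSystem

variable {G : Type} [Group G] {q : ℕ} (S : RotationSystem G q)

/-- The faces of the coset geometry: the left cosets of the stabilizers of the base faces. -/
def Face : Type := Σ i : Fin 6, G ⧸ S.K i

/-- The image under `g` of the base face of index `i`. -/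
def face (i : Fin 6) (g : G) : S.Face := ⟨i, (g : G ⧸ S.K i)⟩

theorem face_eq_iff {i : Fin 6} {g h : G} : S.face i g = S.face i h ↔ g⁻¹ * h ∈ S.K i := by
  rw [← QuotientGroup.eq]
  constructor
  · intro e
    exact eq_of_heq (Sigma.mk.inj e).2
  · intro e
    exact congrArg (Sigma.mk i) e

theorem face_mul {i : Fin 6} (g : G) {x : G} (hx : x ∈ S.K i) : S.face i (g * x) = S.face i g :=
  (S.face_eq_iff.2 (by simpa using hx)).symm

theorem face_fst (i : Fin 6) (g : G) : (S.face i g).1 = i := rfl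

variable {S} in
theorem Face.exists_rep (x : S.Face) : ∃ g, x = S.face x.1 g := by
  obtain ⟨i, c⟩ := x
  obtain ⟨g, rfl⟩ := QuotientGroup.mk_surjective c
  exact ⟨g, rfl⟩

/-- Incidence: two cosets are incident when they have an element in common. -/
instance : LE S.Face :=
  ⟨fun x y => x.1 ≤ y.1 ∧ ∃ g, x = S.face x.1 g ∧ y = S.face y.1 g⟩

theorem face_le_face {i j : Fin 6} (h : i ≤ j) (g : G) : S.face i g ≤ S.face j g :=
  ⟨h, g, rfl, rfl⟩

/-- Three successively incident cosets have an element in common. -/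
theorem exists_common_rep {x y z : S.Face} (hxy : x ≤ y) (hyz : y ≤ z) :
    ∃ g, x = S.face x.1 g ∧ y = S.face y.1 g ∧ z = S.face z.1 g := by
  obtain ⟨hij, g, hx, hy⟩ := hxy
  obtain ⟨hjk, h, hy', hz⟩ := hyz
  obtain ⟨a, ha1, ha2, ha3⟩ := S.exists_factor hij hjk (S.face_eq_iff.1 (hy.symm.trans hy'))
  refine ⟨g * a, ?_, ?_, ?_⟩
  · rw [S.face_mul _ ha1]; exact hx
  · rw [S.face_mul _ ha2]; exact hy
  · rw [hz, face_fst, face_eq_iff]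
    have := inv_mem ha3
    simpa [mul_assoc] using this

variable {S} in
theorem Face.eq_of_le {x y : S.Face} (h : x ≤ y) (hi : x.1 = y.1) : x = y := by
  obtain ⟨-, g, hx, hy⟩ := h
  rw [hx, hy, hi]

instance : PartialOrder S.Face where
  le_refl x := by
    obtain ⟨g, hg⟩ := x.exists_rep
    exact ⟨le_rfl, g, hg, hg⟩
  le_trans x y z hxy hyz := by
    obtain ⟨g, hx, -, hz⟩ := S.exists_common_rep hxy hyz
    exact ⟨hxy.1.trans hyz.1, g, hx, hz⟩
  le_antisymm x y hxy hyx := Face.eq_of_le hxy (le_antisymm hxy.1 hyx.1)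

instance [Finite G] : Finite S.Face := by unfold Face; infer_instance

theorem face_zero (g h : G) : S.face 0 g = S.face 0 h := S.face_eq_iff.2 (S.mem_K_zero _)
theorem face_five (g h : G) : S.face 5 g = S.face 5 h := S.face_eq_iff.2 (S.mem_K_five _)

theorem face_zero_le (x : S.Face) : S.face 0 1 ≤ x := by
  obtain ⟨g, hg⟩ := x.exists_rep
  rw [hg, S.face_zero 1 g]
  exact S.face_le_face (Fin.zero_le _) g

theorem le_face_five (x : S.Face) : x ≤ S.face 5 1 := by
  obtain ⟨g, hg⟩ := x.exists_rep
  rw [hg, S.face_five 1 g]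
  exact S.face_le_face (Fin.le_last _) g

/-! ### Flags of the coset geometry -/

/-- The representative of the face of index `i` in the base flag (`b = false`), or in the flag
that differs from it in the vertex (`b = true`). -/
def rep (b : Bool) (i : Fin 6) : G := if b = true ∧ i = 1 then S.u else 1

theorem rep_false (i : Fin 6) : S.rep false i = 1 := by simp [rep]
theorem rep_of_ne {i : Fin 6} (b : Bool) (h : i ≠ 1) : S.rep b i = 1 := by simp [rep, h]
theorem rep_true_one : S.rep true 1 = S.u := by simp [rep]

/-- The faces of the image of one of the two base flags under `g`. -/
def fl (g : G) (b : Bool) (i : Fin 6) : S.Face := S.face i (g * S.rep b i)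

theorem fl_fst (g : G) (b : Bool) (i : Fin 6) : (S.fl g b i).1 = i := rfl

theorem fl_of_ne (g : G) (b : Bool) {i : Fin 6} (h : i ≠ 1) : S.fl g b i = S.face i g := by
  rw [fl, S.rep_of_ne b h, mul_one]

theorem fl_false (g : G) (i : Fin 6) : S.fl g false i = S.face i g := by
  rw [fl, rep_false, mul_one]

theorem fl_true_one (g : G) : S.fl g true 1 = S.face 1 (g * S.u) := by rw [fl, rep_true_one]

theorem face_one_t (g : G) : S.face 1 (g * S.t) = S.face 1 (g * S.u) := by
  rw [t_eq_u_mul_s₃, ← mul_assoc]; exact S.face_mul _ S.s₃_mem_K₁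

theorem face_one_t_u (g : G) : S.face 1 (g * S.t * S.u) = S.face 1 g := by
  have : S.t * S.u ∈ S.K 1 := by
    have := S.u_mul_zpow 1
    rw [zpow_one] at this
    rw [t_eq_u_mul_s₃, this, mul_assoc, u_mul_u, mul_one]
    exact zpow_mem S.s₃_mem_K₁ _
  rw [mul_assoc]; exact S.face_mul _ this

theorem face_four_t (g : G) : S.face 4 (g * S.t) = S.face 4 (g * S.w) := by
  have h := S.w_mul_zpow (-1)
  rw [neg_neg, zpow_one] at h
  rw [t_eq_s₁_mul_w, ← h, ← mul_assoc]
  exact S.face_mul _ (zpow_mem S.s₁_mem_K₄ _)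

theorem fl_mono (g : G) (b : Bool) : Monotone (S.fl g b) := by
  intro i j hij
  rcases eq_or_lt_of_le hij with rfl | hlt
  · exact le_rfl
  cases b
  · rw [fl_false, fl_false]; exact S.face_le_face hij g
  by_cases hi : i = 1
  · subst hi
    rw [fl_true_one, S.fl_of_ne _ _ hlt.ne']
    obtain rfl | rfl | rfl | rfl : j = 2 ∨ j = 3 ∨ j = 4 ∨ j = 5 := by omega
    · rw [← S.face_mul g S.u_mem_K₂]; exact S.face_le_face hij _
    · rw [← face_one_t, ← S.face_mul g S.t_mem_K₃]; exact S.face_le_face hij _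
    · rw [← S.face_mul g S.u_mem_K₄]; exact S.face_le_face hij _
    · rw [← S.face_mul g (S.mem_K_five S.u)]; exact S.face_le_face hij _
  · by_cases hj : j = 1
    · subst hj
      obtain rfl : i = 0 := by omega
      rw [fl_true_one, S.fl_of_ne _ _ hi, ← S.face_mul g (S.mem_K_zero S.u)]
      exact S.face_le_face hij _
    · rw [S.fl_of_ne _ _ hi, S.fl_of_ne _ _ hj]; exact S.face_le_face hij _

theorem fl_injective (g : G) (b : Bool) : Function.Injective (S.fl g b) := fun i j h => by
  have := congrArg Sigma.fst h; exact this

theorem fl_eq_fl_iff {g h : G} {b c : Bool} :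
    S.fl g b = S.fl h c ↔ g = h ∧ b = c := by
  constructor
  · intro e
    have h2 := congrFun e 2
    have h3 := congrFun e 3
    have h4 := congrFun e 4
    have h1 := congrFun e 1
    rw [S.fl_of_ne _ _ (by decide), S.fl_of_ne _ _ (by decide), face_eq_iff] at h2 h3 h4
    have hgh : g = h := by
      rcases S.mem_K₂_K₃ h2 h3 with h | h
      · exact inv_mul_eq_one.1 h
      · rw [h] at h4; exact absurd h4 S.t_not_mem_K₄
    subst hgh
    refine ⟨rfl, ?_⟩
    cases b <;> cases c
    · rfl
    · rw [fl_false, fl_true_one, face_eq_iff, inv_mul_cancel_left] at h1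
      exact absurd h1 S.u_not_mem_K₁
    · rw [fl_false, fl_true_one, eq_comm, face_eq_iff, inv_mul_cancel_left] at h1
      exact absurd h1 S.u_not_mem_K₁
    · rfl
  · rintro ⟨rfl, rfl⟩; rfl

/-- Every choice of one face of each rank that forms a chain is in the orbit of one of the two base
flags. -/
theorem exists_eq_fl (f : Fin 6 → S.Face) (hf : ∀ i, (f i).1 = i) (hm : Monotone f) :
    ∃ g b, f = S.fl g b := by
  obtain ⟨g, h2, h3⟩ := (hm (show (2 : Fin 6) ≤ 3 by decide)).2
  obtain ⟨h, h1, h2'⟩ := (hm (show (1 : Fin 6) ≤ 2 by decide)).2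
  obtain ⟨k, h3', h4⟩ := (hm (show (3 : Fin 6) ≤ 4 by decide)).2
  obtain ⟨l0, h0⟩ := (f 0).exists_rep
  obtain ⟨l5, h5⟩ := (f 5).exists_rep
  rw [hf] at h0 h1 h2 h3 h4 h5 h2' h3'
  have e1 : f 1 = S.face 1 g ∨ f 1 = S.face 1 (g * S.u) := by
    have := S.face_eq_iff.1 (h2.symm.trans h2')
    obtain ⟨n, hn⟩ := S.mem_K₂ this
    rcases hn with hn | hn
    · left; rw [h1, show h = g * S.s₃ ^ n by rw [← hn]; group]
      exact S.face_mul _ (zpow_mem S.s₃_mem_K₁ _)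
    · right
      have e : h = g * S.u * S.s₃ ^ (-n) := by
        have := S.u_mul_zpow (-n); rw [neg_neg] at this
        rw [mul_assoc, this, ← hn]; group
      rw [h1, e]
      exact S.face_mul _ (zpow_mem S.s₃_mem_K₁ _)
  have e4 : f 4 = S.face 4 g ∨ f 4 = S.face 4 (g * S.w) := by
    have := S.face_eq_iff.1 (h3.symm.trans h3')
    obtain ⟨n, hn⟩ := S.mem_K₃ this
    rcases hn with hn | hn
    · left; rw [h4, show k = g * S.s₁ ^ n by rw [← hn]; group]
      exact S.face_mul _ (zpow_mem S.s₁_mem_K₄ _)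
    · right
      have e : k = g * S.w * S.s₁ ^ (-n) := by
        have := S.w_mul_zpow (-n); rw [neg_neg] at this
        rw [mul_assoc, this, ← hn]; group
      rw [h4, e]
      exact S.face_mul _ (zpow_mem S.s₁_mem_K₄ _)
  have build : ∀ (a : G) (b : Bool), f 1 = S.fl a b 1 → f 2 = S.face 2 a → f 3 = S.face 3 a →
      f 4 = S.face 4 a → f = S.fl a b := by
    intro a b i1 i2 i3 i4
    funext i
    obtain rfl | rfl | rfl | rfl | rfl | rfl : i = 0 ∨ i = 1 ∨ i = 2 ∨ i = 3 ∨ i = 4 ∨ i = 5 := by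
      omega
    · rw [h0]; exact S.face_zero _ _
    · exact i1
    · rw [i2, S.fl_of_ne _ _ (by decide)]
    · rw [i3, S.fl_of_ne _ _ (by decide)]
    · rw [i4, S.fl_of_ne _ _ (by decide)]
    · rw [h5]; exact S.face_five _ _
  rcases e1 with e1 | e1 <;> rcases e4 with e4 | e4
  · exact ⟨g, false, build g false (by rw [fl_false, e1]) h2 h3 e4⟩
  · refine ⟨g * S.t, true, build _ true ?_ ?_ ?_ ?_⟩
    · rw [fl_true_one, face_one_t_u, e1]
    · rw [S.face_mul _ S.t_mem_K₂, h2]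
    · rw [S.face_mul _ S.t_mem_K₃, h3]
    · rw [face_four_t, e4]
  · exact ⟨g, true, build g true (by rw [fl_true_one, e1]) h2 h3 e4⟩
  · refine ⟨g * S.t, false, build _ false ?_ ?_ ?_ ?_⟩
    · rw [fl_false, face_one_t, e1]
    · rw [S.face_mul _ S.t_mem_K₂, h2]
    · rw [S.face_mul _ S.t_mem_K₃, h3]
    · rw [face_four_t, e4]

/-- The flag with faces `fl g b`. -/
def flag (g : G) (b : Bool) : Flag S.Face where
  carrier := Set.range (S.fl g b)
  Chain' := by
    rintro _ ⟨i, rfl⟩ _ ⟨j, rfl⟩ -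
    exact (le_total i j).imp (fun h => S.fl_mono g b h) (fun h => S.fl_mono g b h)
  max_chain' := by
    intro s hs hsub
    refine subset_antisymm hsub fun x hx => ?_
    refine ⟨x.1, ?_⟩
    rcases hs.total (hsub ⟨x.1, rfl⟩) hx with h | h
    · exact Face.eq_of_le h rfl
    · exact (Face.eq_of_le h rfl).symm

theorem coe_flag (g : G) (b : Bool) : (S.flag g b : Set S.Face) = Set.range (S.fl g b) := rfl

theorem mem_flag {g : G} {b : Bool} {x : S.Face} : x ∈ S.flag g b ↔ x = S.fl g b x.1 :=
  ⟨by rintro ⟨i, rfl⟩; rfl, fun h => ⟨x.1, h.symm⟩⟩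

theorem fl_mem_flag (g : G) (b : Bool) (i : Fin 6) : S.fl g b i ∈ S.flag g b := ⟨i, rfl⟩

theorem fl_mem_flag_iff {g h : G} {b c : Bool} {i : Fin 6} :
    S.fl g b i ∈ S.flag h c ↔ S.fl g b i = S.fl h c i := S.mem_flag

theorem flag_eq_flag_iff {g h : G} {b c : Bool} : S.flag g b = S.flag h c ↔ g = h ∧ b = c := by
  rw [← fl_eq_fl_iff]
  constructor
  · intro e
    funext i
    exact S.fl_mem_flag_iff.1 (e ▸ S.fl_mem_flag g b i)
  · intro e
    exact Flag.ext (by rw [coe_flag, coe_flag, e])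

/-- A flag has a face of each rank. -/
theorem exists_mem_flag (Φ : Flag S.Face) (i : Fin 6) : ∃ x ∈ Φ, x.1 = i := by
  have h0 : S.face 0 1 ∈ Φ := Flag.mem_iff_forall_le_or_ge.2 fun x _ => Or.inl (S.face_zero_le x)
  have h5 : S.face 5 1 ∈ Φ := Flag.mem_iff_forall_le_or_ge.2 fun x _ => Or.inr (S.le_face_five x)
  have key : ∀ x ∈ Φ, ∀ y ∈ Φ, x.1 ≤ y.1 → x ≤ y := by
    intro x hx y hy h
    rcases Φ.le_or_le hx hy with h' | h'
    · exact h'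
    · exact (Face.eq_of_le h' (le_antisymm h'.1 h)).ge
  -- the faces `a` and `b` of the flag that are closest to rank `i` from below and from above
  obtain ⟨a, ⟨ha, hai⟩, hamax⟩ := Set.Finite.exists_maximalFor' (fun x : S.Face => x.1)
    {x | x ∈ Φ ∧ x.1 ≤ i} (Set.toFinite _) ⟨_, h0, Fin.zero_le i⟩
  obtain ⟨b, ⟨hb, hbi⟩, hbmin⟩ := Set.Finite.exists_minimalFor' (fun x : S.Face => x.1)
    {x | x ∈ Φ ∧ i ≤ x.1} (Set.toFinite _) ⟨_, h5, Fin.le_last i⟩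
  obtain ⟨g, hg1, hg2⟩ := (key a ha b hb (hai.trans hbi)).2
  refine ⟨S.face i g, Flag.mem_iff_forall_le_or_ge.2 fun x hx => ?_, rfl⟩
  rcases le_total x.1 i with h | h
  · right
    have hxa : x.1 ≤ a.1 := (le_total x.1 a.1).elim id fun h' => hamax ⟨hx, h⟩ h'
    refine (key x hx a ha hxa).trans ?_
    rw [hg1]; exact S.face_le_face hai g
  · left
    have hbx : b.1 ≤ x.1 := (le_total b.1 x.1).elim id fun h' => hbmin ⟨hx, h⟩ h'
    refine le_trans ?_ (key b hb x hx hbx)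
    rw [hg2]; exact S.face_le_face hbi g

theorem exists_eq_flag (Φ : Flag S.Face) : ∃ g b, Φ = S.flag g b := by
  choose f hf hfi using S.exists_mem_flag Φ
  obtain ⟨g, b, hgb⟩ := S.exists_eq_fl f hfi (by
    intro i j hij
    rcases Φ.le_or_le (hf i) (hf j) with h | h
    · exact h
    · have h1 := h.1
      rw [hfi, hfi] at h1
      rw [le_antisymm hij h1])
  refine ⟨g, b, (Flag.ext ?_).symm⟩
  refine (S.flag g b).max_chain' Φ.chain_le ?_
  rintro _ ⟨i, rfl⟩
  exact hgb ▸ hf i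

end RotationSystem

/-! ### Sections and adjacency -/

namespace RotationSystem

variable {G : Type} [Group G] {q : ℕ} (S : RotationSystem G q)

/-- If the faces of index `j` between the base faces of indices `i` and `k` are the images of the
base face under the powers of `a`, and the powers `a ^ n` that fix it are those with `p ∣ n`, then
there are `p` faces of index `j` between any two incident faces of indices `i` and `k`. -/
theorem ncard_between {i j k : Fin 6} (hij : i ≤ j) (hjk : j ≤ k) {p : ℕ} (hp : 0 < p) {a : G}
    (hai : a ∈ S.K i) (hak : a ∈ S.K k)
    (hgen : ∀ x, x ∈ S.K i → x ∈ S.K k → ∃ n : ℤ, (a ^ n)⁻¹ * x ∈ S.K j)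
    (hord : ∀ n : ℤ, a ^ n ∈ S.K j ↔ (p : ℤ) ∣ n)
    {X Y : S.Face} (hXY : X ≤ Y) (hX : X.1 = i) (hY : Y.1 = k) :
    {H : S.Face | H.1 = j ∧ X ≤ H ∧ H ≤ Y}.ncard = p := by
  obtain ⟨-, g, hXg, hYg⟩ := hXY
  rw [hX] at hXg
  rw [hY] at hYg
  have himg : {H : S.Face | H.1 = j ∧ X ≤ H ∧ H ≤ Y} =
      (fun n : ℕ => S.face j (g * a ^ n)) '' (Finset.range p : Set ℕ) := by
    ext H
    constructor
    · rintro ⟨hH, hXH, hHY⟩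
      obtain ⟨h, h1, h2, h3⟩ := S.exists_common_rep hXH hHY
      rw [hX] at h1
      rw [hH] at h2
      rw [hY] at h3
      obtain ⟨n, hn⟩ := hgen _ (S.face_eq_iff.1 (hXg.symm.trans h1))
        (S.face_eq_iff.1 (hYg.symm.trans h3))
      have hp' : (0 : ℤ) < p := by exact_mod_cast hp
      refine ⟨(n % p).toNat, ?_, ?_⟩
      · have := Int.emod_lt_of_pos n hp'
        have := Int.emod_nonneg n hp'.ne'
        simp only [Finset.coe_range, Set.mem_Iio]
        omega
      · rw [h2, face_eq_iff]
        have e : a ^ (n % p).toNat = a ^ n * a ^ (-(p * (n / p)) : ℤ) := by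
          rw [← zpow_natCast, Int.toNat_of_nonneg (Int.emod_nonneg n hp'.ne'), ← zpow_add,
            Int.emod_def]
          rfl
        have := mul_mem ((hord (p * (n / p))).2 ⟨_, rfl⟩) hn
        rw [e]
        convert this using 1
        simp [mul_assoc]
    · rintro ⟨n, -, rfl⟩
      refine ⟨rfl, ?_, ?_⟩
      · rw [hXg, ← S.face_mul g (pow_mem hai n)]
        exact S.face_le_face hij _
      · rw [hYg, ← S.face_mul g (pow_mem hak n)]
        exact S.face_le_face hjk _
  rw [himg, Set.InjOn.ncard_image, Set.ncard_coe_finset, Finset.card_range]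
  intro m hm n hn h
  simp only [Finset.coe_range, Set.mem_Iio] at hm hn
  have := S.face_eq_iff.1 h
  have e : (g * a ^ m)⁻¹ * (g * a ^ n) = a ^ ((n : ℤ) - m) := by
    rw [zpow_sub, zpow_natCast, zpow_natCast, ← (Commute.refl a).pow_pow n m |>.inv_right.eq.symm]
    simp [mul_assoc]
  rw [e, hord] at this
  obtain ⟨c, hc⟩ := this
  have h1 : (n : ℤ) - m < p := by omega
  have h2 : -(p : ℤ) < (n : ℤ) - m := by omega
  have hc0 : c = 0 := by
    by_contra hne
    rcases lt_or_gt_of_ne hne with h | h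
    · nlinarith
    · nlinarith
  subst hc0
  omega

theorem exists_zpow_u {x : G} (hx : x = 1 ∨ x = S.u) (H : Subgroup G) :
    ∃ n : ℤ, (S.u ^ n)⁻¹ * x ∈ H := by
  rcases hx with rfl | rfl
  · exact ⟨0, by simp⟩
  · exact ⟨1, by simp⟩

theorem exists_zpow_w {x : G} (hx : x = 1 ∨ x = S.w) (H : Subgroup G) :
    ∃ n : ℤ, (S.w ^ n)⁻¹ * x ∈ H := by
  rcases hx with rfl | rfl
  · exact ⟨0, by simp⟩
  · exact ⟨1, by simp⟩

/-- The diamond condition. -/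
theorem ncard_diamond {i j k : Fin 6} (hij : (i : ℕ) + 1 = j) (hjk : (j : ℕ) + 1 = k)
    {X Y : S.Face} (hXY : X ≤ Y) (hX : X.1 = i) (hY : Y.1 = k) :
    {H : S.Face | H.1 = j ∧ X ≤ H ∧ H ≤ Y}.ncard = 2 := by
  have hu := fun (H : Subgroup G) (h : S.u ∉ H) => zpow_mem_of_involution S.u_mul_u h
  have hw := fun (H : Subgroup G) (h : S.w ∉ H) => zpow_mem_of_involution S.w_mul_w h
  obtain ⟨rfl, rfl, rfl⟩ | ⟨rfl, rfl, rfl⟩ | ⟨rfl, rfl, rfl⟩ | ⟨rfl, rfl, rfl⟩ :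
      (i = 0 ∧ j = 1 ∧ k = 2) ∨ (i = 1 ∧ j = 2 ∧ k = 3) ∨ (i = 2 ∧ j = 3 ∧ k = 4) ∨
      (i = 3 ∧ j = 4 ∧ k = 5) := by omega
  · refine S.ncard_between (by decide) (by decide) two_pos (S.mem_K_zero _) S.u_mem_K₂ ?_
      (hu _ S.u_not_mem_K₁) hXY hX hY
    intro x _ hx
    obtain ⟨n, rfl | rfl⟩ := S.mem_K₂ hx
    · exact ⟨0, by simpa using zpow_mem S.s₃_mem_K₁ n⟩
    · refine ⟨1, ?_⟩
      have := S.u_mul_zpow (-n)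
      rw [neg_neg] at this
      rw [← this, zpow_one, inv_mul_cancel_left]
      exact zpow_mem S.s₃_mem_K₁ _
  · exact S.ncard_between (by decide) (by decide) two_pos S.w_mem_K₁ S.w_mem_K₃
      (fun x h1 h3 => S.exists_zpow_w (S.mem_K₁_K₃ h1 h3) _) (hw _ S.w_not_mem_K₂) hXY hX hY
  · exact S.ncard_between (by decide) (by decide) two_pos S.u_mem_K₂ S.u_mem_K₄
      (fun x h1 h3 => S.exists_zpow_u (S.mem_K₂_K₄ h1 h3) _) (hu _ S.u_not_mem_K₃) hXY hX hY
  · refine S.ncard_between (by decide) (by decide) two_pos S.w_mem_K₃ (S.mem_K_five _) ?_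
      (hw _ S.w_not_mem_K₄) hXY hX hY
    intro x hx _
    obtain ⟨n, rfl | rfl⟩ := S.mem_K₃ hx
    · exact ⟨0, by simpa using zpow_mem S.s₁_mem_K₄ n⟩
    · refine ⟨1, ?_⟩
      have := S.w_mul_zpow (-n)
      rw [neg_neg] at this
      rw [← this, zpow_one, inv_mul_cancel_left]
      exact zpow_mem S.s₁_mem_K₄ _

/-- The rank-two sections have `3`, `q` and `3` sides. -/
theorem ncard_polygon {i j k : Fin 6} (hij : (i : ℕ) + 2 = j) (hjk : (j : ℕ) + 1 = k)
    {X Y : S.Face} (hXY : X ≤ Y) (hX : X.1 = i) (hY : Y.1 = k) :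
    {H : S.Face | H.1 = j ∧ X ≤ H ∧ H ≤ Y}.ncard = if i = 1 then q else 3 := by
  obtain ⟨rfl, rfl, rfl⟩ | ⟨rfl, rfl, rfl⟩ | ⟨rfl, rfl, rfl⟩ :
      (i = 0 ∧ j = 2 ∧ k = 3) ∨ (i = 1 ∧ j = 3 ∧ k = 4) ∨ (i = 2 ∧ j = 4 ∧ k = 5) := by omega
  · rw [if_neg (by decide)]
    refine S.ncard_between (by decide) (by decide) three_pos (S.mem_K_zero _) S.s₁_mem_K₃ ?_
      (zpow_mem_of_cube S.cube₁ S.s₁_not_mem_K₂) hXY hX hY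
    intro x _ hx
    obtain ⟨n, rfl | rfl⟩ := S.mem_K₃ hx
    · exact ⟨n, by simp⟩
    · refine ⟨n - 1, ?_⟩
      have : (S.s₁ ^ (n - 1))⁻¹ * (S.s₁ ^ n * S.w) = S.t := by
        rw [t_eq_s₁_mul_w, ← zpow_neg, ← mul_assoc, ← zpow_add]
        simp
      rw [this]; exact S.t_mem_K₂
  · rw [if_pos rfl]
    have hq := S.three_lt
    refine S.ncard_between (by decide) (by decide) (by omega) S.s₂_mem_K₁ S.s₂_mem_K₄ ?_ ?_
      hXY hX hY
    · intro x h1 h4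
      obtain ⟨n, rfl⟩ := S.mem_K₁_K₄ h1 h4
      exact ⟨n, by simp⟩
    · intro n
      have hd := orderOf_dvd_iff_zpow_eq_one (x := S.s₂) (i := n)
      rw [S.order₂] at hd
      rw [hd]
      constructor
      · intro h
        rcases S.mem_K₁_K₃ (zpow_mem S.s₂_mem_K₁ n) h with h | h
        · exact h
        · exact absurd (h ▸ zpow_mem S.s₂_mem_K₄ n) S.w_not_mem_K₄
      · intro h; rw [h]; exact one_mem _
  · rw [if_neg (by decide)]
    refine S.ncard_between (by decide) (by decide) three_pos S.s₃_mem_K₂ (S.mem_K_five _) ?_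
      (zpow_mem_of_cube S.cube₃ S.not_mem_K₄) hXY hX hY
    intro x hx _
    obtain ⟨n, rfl | rfl⟩ := S.mem_K₂ hx
    · exact ⟨n, by simp⟩
    · exact ⟨n, by simpa using S.u_mem_K₄⟩

/-- The element by which the representative of a flag changes on passage to the flag that differs
from it in the face of index `l`; the Boolean tells in which of the two orbits the flag lies. -/
def step (l : Fin 6) (b : Bool) : G :=
  if l = 2 then (if b = true then S.s₁ else S.s₁⁻¹) else if l = 3 then S.u else
    if l = 4 then S.t else 1

theorem step_one (b : Bool) : S.step 1 b = 1 := rfl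
theorem step_two_false : S.step 2 false = S.s₁⁻¹ := rfl
theorem step_two_true : S.step 2 true = S.s₁ := rfl
theorem step_three (b : Bool) : S.step 3 b = S.u := rfl
theorem step_four (b : Bool) : S.step 4 b = S.t := rfl

theorem step_inv (l : Fin 6) (b : Bool) : (S.step l b)⁻¹ = S.step l (!b) := by
  unfold step
  split_ifs <;> simp_all [u_inv, t_inv]

theorem fl_step {l i : Fin 6} (hl : l ≠ 0) (hl' : l ≠ 5) (hi : i ≠ l) (g : G) (b : Bool) :
    S.fl (g * S.step l b) (!b) i = S.fl g b i := by
  by_cases hi0 : i = 0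
  · subst hi0
    exact S.face_zero _ _
  by_cases hi5 : i = 5
  · subst hi5
    exact S.face_five _ _
  by_cases hi1 : i = 1
  · subst hi1
    obtain rfl | rfl | rfl : l = 2 ∨ l = 3 ∨ l = 4 := by omega
    · cases b
      · rw [Bool.not_false, fl_true_one, fl_false, step_two_false, mul_assoc, u,
          inv_mul_cancel_left]
        exact S.face_mul _ S.s₂_mem_K₁
      · rw [Bool.not_true, fl_true_one, fl_false, step_two_true, u, ← mul_assoc]
        exact (S.face_mul _ S.s₂_mem_K₁).symm
    · cases b
      · rw [Bool.not_false, fl_true_one, fl_false, step_three, mul_assoc, u_mul_u, mul_one]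
      · rw [Bool.not_true, fl_true_one, fl_false, step_three]
    · cases b
      · rw [Bool.not_false, fl_true_one, fl_false, step_four, face_one_t_u]
      · rw [Bool.not_true, fl_true_one, fl_false, step_four, face_one_t]
  · rw [S.fl_of_ne _ _ hi1, S.fl_of_ne _ _ hi1]
    apply S.face_mul
    have hs : ∀ b, S.s₁ ∈ S.K i → S.step 2 b ∈ S.K i := by
      intro b h; cases b
      · exact inv_mem h
      · exact h
    obtain rfl | rfl | rfl | rfl : l = 1 ∨ l = 2 ∨ l = 3 ∨ l = 4 := by omega
    · exact one_mem _
    · obtain rfl | rfl : i = 3 ∨ i = 4 := by omega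
      · exact hs b S.s₁_mem_K₃
      · exact hs b S.s₁_mem_K₄
    · obtain rfl | rfl : i = 2 ∨ i = 4 := by omega
      · exact S.u_mem_K₂
      · exact S.u_mem_K₄
    · obtain rfl | rfl : i = 2 ∨ i = 3 := by omega
      · exact S.t_mem_K₂
      · exact S.t_mem_K₃

/-! ### Strong flag connectedness -/

/-- Two flags contain the set `s` of faces, and differ in their faces of one rank only. -/
def StepRel (s : Set S.Face) (X Y : Flag S.Face) : Prop :=
  s ⊆ X ∧ s ⊆ Y ∧ ∃ l : Fin 6, l ≠ 0 ∧ l ≠ 5 ∧ X ≠ Y ∧ ∀ x : S.Face, x.1 ≠ l → (x ∈ X ↔ x ∈ Y)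

theorem mem_flag_step {l : Fin 6} (hl : l ≠ 0) (hl' : l ≠ 5) (g : G) (b : Bool) {x : S.Face}
    (hx : x.1 ≠ l) : x ∈ S.flag g b ↔ x ∈ S.flag (g * S.step l b) (!b) := by
  rw [mem_flag, mem_flag, S.fl_step hl hl' hx]

theorem flag_ne_flag_not (g h : G) (b : Bool) : S.flag g b ≠ S.flag h (!b) := by
  intro h
  have := (S.flag_eq_flag_iff.1 h).2
  cases b <;> simp at this

theorem stepRel_step {s : Set S.Face} {l : Fin 6} (hl : l ≠ 0) (hl' : l ≠ 5) {g : G} {b : Bool}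
    (hs : s ⊆ S.flag g b) (hsl : ∀ x ∈ s, x.1 ≠ l) :
    S.StepRel s (S.flag g b) (S.flag (g * S.step l b) (!b)) :=
  ⟨hs, fun _ hx => (S.mem_flag_step hl hl' g b (hsl _ hx)).1 (hs hx), l, hl, hl',
    S.flag_ne_flag_not _ _ _, fun _ hx => S.mem_flag_step hl hl' g b hx⟩

theorem stepRel_symm {s : Set S.Face} : Std.Symm (S.StepRel s) :=
  ⟨fun _ _ ⟨h1, h2, l, h3, h4, h5, h6⟩ => ⟨h2, h1, l, h3, h4, h5.symm, fun x hx => (h6 x hx).symm⟩⟩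

/-- The subgroup generated by the products of two adjacency steps that change no face with an
index in `J`. -/
def rotationSubgroup (J : Fin 6 → Prop) : Subgroup G :=
  Subgroup.closure {x | ∃ l m : Fin 6, l ≠ 0 ∧ l ≠ 5 ∧ m ≠ 0 ∧ m ≠ 5 ∧ ¬ J l ∧ ¬ J m ∧
    x = S.step l false * S.step m true}

theorem reflTransGen_of_mem_rotationSubgroup {s : Set S.Face} {g : G}
    (hs : s ⊆ S.flag g false) {x : G}
    (hx : x ∈ S.rotationSubgroup fun i => ∃ y ∈ s, y.1 = i) :
    s ⊆ S.flag (g * x) false ∧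
      Relation.ReflTransGen (S.StepRel s) (S.flag g false) (S.flag (g * x) false) := by
  have key : ∀ (l m : Fin 6) (h : G), l ≠ 0 → l ≠ 5 → m ≠ 0 → m ≠ 5 → (¬ ∃ y ∈ s, y.1 = l) →
      (¬ ∃ y ∈ s, y.1 = m) → s ⊆ S.flag h false →
      s ⊆ S.flag (h * (S.step l false * S.step m true)) false ∧
      Relation.ReflTransGen (S.StepRel s) (S.flag h false)
        (S.flag (h * (S.step l false * S.step m true)) false) := by
    intro l m h l0 l5 m0 m5 hl hm hh
    have h1 := S.stepRel_step l0 l5 hh (fun x hx e => hl ⟨x, hx, e⟩)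
    have h2 := S.stepRel_step m0 m5 h1.2.1 (fun x hx e => hm ⟨x, hx, e⟩)
    rw [Bool.not_false, Bool.not_true, mul_assoc] at h2
    exact ⟨h2.2.1, (Relation.ReflTransGen.single h1).tail h2⟩
  induction hx using Subgroup.closure_induction_right with
  | one => rw [mul_one]; exact ⟨hs, Relation.ReflTransGen.refl⟩
  | mul_right y _ z hz ih =>
    obtain ⟨l, m, l0, l5, m0, m5, hl, hm, rfl⟩ := hz
    have := key l m (g * y) l0 l5 m0 m5 hl hm ih.1
    rw [mul_assoc] at this
    exact ⟨this.1, ih.2.trans this.2⟩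
  | mul_inv_cancel y _ z hz ih =>
    obtain ⟨l, m, l0, l5, m0, m5, hl, hm, rfl⟩ := hz
    have := key m l (g * y) m0 m5 l0 l5 hm hl ih.1
    rw [mul_assoc] at this
    rw [mul_inv_rev, step_inv, step_inv]
    exact ⟨this.1, ih.2.trans this.2⟩

/-- The intersection property: for a proper set `J` of ranks, the common stabilizer of the base
faces with an index in `J` is generated by rotations that change no face with an index in `J`. -/
theorem mem_rotationSubgroup (J : Fin 6 → Prop) (hJ : ∃ l, l ≠ 0 ∧ l ≠ 5 ∧ ¬ J l) {x : G}
    (hx : ∀ i, J i → x ∈ S.K i) : x ∈ S.rotationSubgroup J := by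
  have gen : ∀ l m : Fin 6, l ≠ 0 → l ≠ 5 → m ≠ 0 → m ≠ 5 → ¬ J l → ¬ J m →
      S.step l false * S.step m true ∈ S.rotationSubgroup J :=
    fun l m l0 l5 m0 m5 hl hm => Subgroup.subset_closure ⟨l, m, l0, l5, m0, m5, hl, hm, rfl⟩
  have g1 : ¬ J 1 → ¬ J 2 → S.s₁ ∈ S.rotationSubgroup J := by
    intro h1 h2
    have := inv_mem (gen 2 1 (by decide) (by decide) (by decide) (by decide) h2 h1)
    simpa [step_one, step_two_false] using this
  have g2 : ¬ J 2 → ¬ J 3 → S.s₂ ∈ S.rotationSubgroup J := by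
    intro h1 h2
    have := gen 2 3 (by decide) (by decide) (by decide) (by decide) h1 h2
    simpa [step_three, step_two_false, u] using this
  have g3 : ¬ J 3 → ¬ J 4 → S.s₃ ∈ S.rotationSubgroup J := by
    intro h1 h2
    have := gen 3 4 (by decide) (by decide) (by decide) (by decide) h1 h2
    rwa [step_three, step_four, t_eq_u_mul_s₃, ← mul_assoc, u_mul_u, one_mul] at this
  have gu : ¬ J 1 → ¬ J 3 → S.u ∈ S.rotationSubgroup J := by
    intro h1 h2
    have := gen 1 3 (by decide) (by decide) (by decide) (by decide) h1 h2
    simpa [step_three, step_one] using this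
  have gw : ¬ J 2 → ¬ J 4 → S.w ∈ S.rotationSubgroup J := by
    intro h1 h2
    have := gen 2 4 (by decide) (by decide) (by decide) (by decide) h1 h2
    simpa [step_four, step_two_false, t_eq_s₁_mul_w] using this
  have gt : ¬ J 1 → ¬ J 4 → S.t ∈ S.rotationSubgroup J := by
    intro h1 h2
    have := gen 1 4 (by decide) (by decide) (by decide) (by decide) h1 h2
    simpa [step_four, step_one] using this
  by_cases h1 : J 1 <;> by_cases h2 : J 2 <;> by_cases h3 : J 3 <;> by_cases h4 : J 4
  · obtain ⟨l, hl0, hl5, hl⟩ := hJ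
    obtain rfl | rfl | rfl | rfl : l = 1 ∨ l = 2 ∨ l = 3 ∨ l = 4 := by omega
    all_goals contradiction
  · rcases S.mem_K₁_K₃ (hx 1 h1) (hx 3 h3) with rfl | rfl
    · exact one_mem _
    · exact absurd (hx 2 h2) S.w_not_mem_K₂
  · rcases S.mem_K₂_K₄ (hx 2 h2) (hx 4 h4) with rfl | rfl
    · exact one_mem _
    · exact absurd (hx 1 h1) S.u_not_mem_K₁
  · obtain ⟨n, rfl⟩ := S.mem_K₁_K₂ (hx 1 h1) (hx 2 h2)
    exact zpow_mem (g3 h3 h4) n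
  · rcases S.mem_K₁_K₃ (hx 1 h1) (hx 3 h3) with rfl | rfl
    · exact one_mem _
    · exact absurd (hx 4 h4) S.w_not_mem_K₄
  · rcases S.mem_K₁_K₃ (hx 1 h1) (hx 3 h3) with rfl | rfl
    · exact one_mem _
    · exact gw h2 h4
  · obtain ⟨n, rfl⟩ := S.mem_K₁_K₄ (hx 1 h1) (hx 4 h4)
    exact zpow_mem (g2 h2 h3) n
  · exact (Subgroup.closure_le _).2 (by
      rintro y (rfl | rfl)
      exacts [g2 h2 h3, g3 h3 h4]) (hx 1 h1)
  · rcases S.mem_K₂_K₃ (hx 2 h2) (hx 3 h3) with rfl | rfl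
    · exact one_mem _
    · exact absurd (hx 4 h4) S.t_not_mem_K₄
  · rcases S.mem_K₂_K₃ (hx 2 h2) (hx 3 h3) with rfl | rfl
    · exact one_mem _
    · exact gt h1 h4
  · rcases S.mem_K₂_K₄ (hx 2 h2) (hx 4 h4) with rfl | rfl
    · exact one_mem _
    · exact gu h1 h3
  · exact (Subgroup.closure_le _).2 (by
      rintro y (rfl | rfl)
      exacts [gu h1 h3, g3 h3 h4]) (hx 2 h2)
  · obtain ⟨n, rfl⟩ := S.mem_K₃_K₄ (hx 3 h3) (hx 4 h4)
    exact zpow_mem (g1 h1 h2) n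
  · exact (Subgroup.closure_le _).2 (by
      rintro y (rfl | rfl)
      exacts [gw h2 h4, g1 h1 h2]) (hx 3 h3)
  · exact (Subgroup.closure_le _).2 (by
      rintro y (rfl | rfl)
      exacts [g1 h1 h2, g2 h2 h3]) (hx 4 h4)
  · have : x ∈ Subgroup.closure {S.s₁, S.s₂, S.s₃} := by rw [S.closure_eq_top]; trivial
    exact (Subgroup.closure_le _).2 (by
      rintro y (rfl | rfl | rfl)
      exacts [g1 h1 h2, g2 h2 h3, g3 h3 h4]) this

theorem reflTransGen_flag (Φ Ψ : Flag S.Face) :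
    Relation.ReflTransGen (S.StepRel ((Φ : Set S.Face) ∩ Ψ)) Φ Ψ := by
  obtain ⟨g, b, rfl⟩ := S.exists_eq_flag Φ
  obtain ⟨h, c, rfl⟩ := S.exists_eq_flag Ψ
  by_cases hJ : ∃ l : Fin 6, l ≠ 0 ∧ l ≠ 5 ∧ S.fl g b l ≠ S.fl h c l
  swap
  · have : S.flag g b = S.flag h c := by
      rw [flag_eq_flag_iff, ← fl_eq_fl_iff]
      funext i
      by_contra hne
      refine hJ ⟨i, ?_, ?_, hne⟩
      · rintro rfl; exact hne (S.face_zero _ _)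
      · rintro rfl; exact hne (S.face_five _ _)
    rw [this]
  obtain ⟨l, hl0, hl5, hl⟩ := hJ
  set s : Set S.Face := (S.flag g b : Set S.Face) ∩ S.flag h c
  have hsl : ∀ x ∈ s, x.1 ≠ l := by
    rintro x ⟨hx1, hx2⟩ rfl
    exact hl ((S.mem_flag.1 hx1).symm.trans (S.mem_flag.1 hx2))
  -- both flags are at most one step away from a flag in the orbit of the base flag
  have white : ∀ (g : G) (b : Bool), s ⊆ S.flag g b → ∃ g', s ⊆ S.flag g' false ∧
      Relation.ReflTransGen (S.StepRel s) (S.flag g b) (S.flag g' false) := by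
    intro g b hg
    cases b
    · exact ⟨g, hg, Relation.ReflTransGen.refl⟩
    · have := S.stepRel_step hl0 hl5 hg hsl
      exact ⟨_, this.2.1, Relation.ReflTransGen.single this⟩
  obtain ⟨g', hg', p1⟩ := white g b Set.inter_subset_left
  obtain ⟨h', hh', p2⟩ := white h c Set.inter_subset_right
  have hmem : g'⁻¹ * h' ∈ S.rotationSubgroup fun i => ∃ y ∈ s, y.1 = i := by
    refine S.mem_rotationSubgroup _ ⟨l, hl0, hl5, fun ⟨y, hy, e⟩ => hsl y hy e⟩ ?_
    rintro i ⟨y, hy, rfl⟩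
    have e1 := S.mem_flag.1 (hg' hy)
    have e2 := S.mem_flag.1 (hh' hy)
    rw [fl_false] at e1 e2
    exact S.face_eq_iff.1 (e1.symm.trans e2)
  have p3 := (S.reflTransGen_of_mem_rotationSubgroup hg' hmem).2
  rw [mul_inv_cancel_left] at p3
  have : Std.Symm (S.StepRel s) := S.stepRel_symm
  exact (p1.trans p3).trans (Std.Symm.symm _ _ p2)

/-- The polytope of a rotation system. -/
abbrev polytope : AbstractPolytope 4 where
  Face := S.Face
  rank x := ((x.1 : ℕ) : ℤ) - 1
  strictMono_rank := by
    intro x y h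
    have h1 : (x.1 : ℕ) ≤ y.1 := h.le.1
    have h2 : (x.1 : ℕ) ≠ y.1 := fun e => h.ne (Face.eq_of_le h.le (Fin.ext e))
    have : (x.1 : ℕ) < y.1 := lt_of_le_of_ne h1 h2
    simp only
    omega
  range_rank := by
    ext k
    simp only [Set.mem_range, Set.mem_Icc]
    constructor
    · rintro ⟨x, rfl⟩
      have := x.1.2
      push_cast
      omega
    · rintro ⟨h1, h2⟩
      push_cast at h2
      refine ⟨S.face ⟨(k + 1).toNat, by omega⟩ 1, ?_⟩
      rw [face_fst]
      simp only
      omega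
  exists_least := ⟨_, S.face_zero_le⟩
  exists_greatest := ⟨_, S.le_face_five⟩
  ncard_flag Φ := by
    obtain ⟨g, b, rfl⟩ := S.exists_eq_flag Φ
    rw [coe_flag, ← Set.image_univ, Set.ncard_image_of_injective _ (S.fl_injective g b),
      Set.ncard_univ, Nat.card_eq_fintype_card, Fintype.card_fin]
  strongly_flag_connected Φ Ψ := by
    refine Relation.ReflTransGen.mono ?_ _ _ (S.reflTransGen_flag Φ Ψ)
    rintro X Y ⟨-, hY, l, -, -, hne, hXY⟩
    exact ⟨hY, ((l : ℕ) : ℤ) - 1, hne, fun F hF => hXY F fun e => hF (by rw [e])⟩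
  diamond j X Y hXY hX hY := by
    have hY2 := Y.1.2
    have h0 : 0 ≤ j := by omega
    have h1 : (j + 1).toNat < 6 := by omega
    rw [← S.ncard_diamond (i := X.1) (j := ⟨(j + 1).toNat, h1⟩) (k := Y.1) (by simp only; omega)
      (by simp only; omega) hXY rfl rfl]
    congr 1
    ext H
    simp only [Set.mem_ofPred_eq, Fin.ext_iff]
    constructor
    · rintro ⟨h, h'⟩; exact ⟨by omega, h'⟩
    · rintro ⟨h, h'⟩; exact ⟨by omega, h'⟩

end RotationSystem

/-! ### Automorphisms and chirality -/

namespace RotationSystem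

open scoped Pointwise

variable {G : Type} [Group G] {q : ℕ} (S : RotationSystem G q)

theorem index_lt_of_lt {x y : S.Face} (h : x < y) : x.1 < y.1 :=
  lt_of_le_of_ne h.le.1 fun e => h.ne (Face.eq_of_le h.le e)

theorem face_lt_face {i j : Fin 6} (h : i < j) (g : G) : S.face i g < S.face j g :=
  lt_of_le_of_ne (S.face_le_face h.le g) fun e => h.ne (congrArg Sigma.fst e)

/-- The rank function is the only strictly monotone function to its range. -/
theorem eq_index_of_strictMono {ψ : S.Face → Fin 6} (h : StrictMono ψ) (x : S.Face) :
    ψ x = x.1 := by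
  obtain ⟨g, hg⟩ := x.exists_rep
  have key : ∀ i j : Fin 6, i < j → ψ (S.face i g) < ψ (S.face j g) :=
    fun i j hij => h (S.face_lt_face hij g)
  have h01 := key 0 1 (by decide)
  have h12 := key 1 2 (by decide)
  have h23 := key 2 3 (by decide)
  have h34 := key 3 4 (by decide)
  have h45 := key 4 5 (by decide)
  rw [hg, face_fst]
  generalize x.1 = i
  obtain rfl | rfl | rfl | rfl | rfl | rfl : i = 0 ∨ i = 1 ∨ i = 2 ∨ i = 3 ∨ i = 4 ∨ i = 5 := by
    omega
  all_goals omega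

theorem index_apply (γ : S.Face ≃o S.Face) (x : S.Face) : (γ x).1 = x.1 :=
  S.eq_index_of_strictMono (ψ := fun x => (γ x).1)
    (fun _ _ h => S.index_lt_of_lt (γ.strictMono h)) x

/-- Left multiplication on cosets. -/
def mulLeft (g : G) (x : S.Face) : S.Face := ⟨x.1, g • x.2⟩

theorem mulLeft_face (g h : G) (i : Fin 6) : S.mulLeft g (S.face i h) = S.face i (g * h) := rfl

theorem mulLeft_mul (g h : G) (x : S.Face) : S.mulLeft (g * h) x = S.mulLeft g (S.mulLeft h x) := by
  obtain ⟨k, hk⟩ := x.exists_rep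
  rw [hk, mulLeft_face, mulLeft_face, mulLeft_face, mul_assoc]

theorem mulLeft_one (x : S.Face) : S.mulLeft 1 x = x := by
  obtain ⟨k, hk⟩ := x.exists_rep
  rw [hk, mulLeft_face, one_mul]

theorem mulLeft_mono (g : G) : Monotone (S.mulLeft g) := by
  rintro x y ⟨hi, h, hx, hy⟩
  rw [hx, hy, mulLeft_face, mulLeft_face]
  exact S.face_le_face hi _

/-- The action of the group on the coset geometry. -/
def aut : G →* (S.Face ≃o S.Face) where
  toFun g :=
    { toFun := S.mulLeft g
      invFun := S.mulLeft g⁻¹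
      left_inv := fun x => by rw [← mulLeft_mul, inv_mul_cancel, mulLeft_one]
      right_inv := fun x => by rw [← mulLeft_mul, mul_inv_cancel, mulLeft_one]
      map_rel_iff' := by
        intro x y
        refine ⟨fun h => ?_, fun h => S.mulLeft_mono g h⟩
        have := S.mulLeft_mono g⁻¹ h
        simpa only [Equiv.coe_fn_mk, ← mulLeft_mul, inv_mul_cancel, mulLeft_one] using this }
  map_one' := by ext x; exact S.mulLeft_one x
  map_mul' g h := by ext x; exact S.mulLeft_mul g h x

theorem aut_face (g h : G) (i : Fin 6) : S.aut g (S.face i h) = S.face i (g * h) := rfl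

theorem mem_smul_flag (γ : S.Face ≃o S.Face) (Φ : Flag S.Face) (x : S.Face) :
    x ∈ γ • Φ ↔ γ⁻¹ x ∈ Φ := by
  rw [← Flag.mem_coe_iff, Flag.coe_smul, Set.mem_smul_set_iff_inv_smul_mem]
  rfl

theorem aut_smul_flag (g h : G) (b : Bool) : S.aut g • S.flag h b = S.flag (g * h) b := by
  refine Flag.ext ?_
  rw [Flag.coe_smul, coe_flag, coe_flag, ← Set.image_smul, ← Set.range_comp]
  congr 1
  funext i
  change S.aut g (S.face i _) = S.face i _
  rw [aut_face, mul_assoc]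

/-- The flags `X` and `Y` differ exactly in their faces of index `l`. -/
def Adj (l : Fin 6) (X Y : Flag S.Face) : Prop := X ≠ Y ∧ ∀ x : S.Face, x.1 ≠ l → (x ∈ X ↔ x ∈ Y)

variable {S} in
theorem Adj.smul {l : Fin 6} {X Y : Flag S.Face} (h : S.Adj l X Y) (γ : S.Face ≃o S.Face) :
    S.Adj l (γ • X) (γ • Y) := by
  refine ⟨fun e => h.1 (smul_left_cancel γ e), fun x hx => ?_⟩
  rw [mem_smul_flag, mem_smul_flag]
  exact h.2 _ (by rwa [index_apply])

theorem adj_step {l : Fin 6} (hl : l ≠ 0) (hl' : l ≠ 5) (g : G) (b : Bool) :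
    S.Adj l (S.flag g b) (S.flag (g * S.step l b) (!b)) :=
  ⟨S.flag_ne_flag_not _ _ _, fun _ hx => S.mem_flag_step hl hl' g b hx⟩

/-- The flag adjacent to a given one is unique. -/
theorem Adj.eq_step {l : Fin 6} {g : G} {b : Bool} {Y : Flag S.Face}
    (h : S.Adj l (S.flag g b) Y) : l ≠ 0 ∧ l ≠ 5 ∧ Y = S.flag (g * S.step l b) (!b) := by
  obtain ⟨k, c, rfl⟩ := S.exists_eq_flag Y
  have hoff : ∀ i, i ≠ l → S.fl g b i = S.fl k c i := fun i hi =>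
    S.fl_mem_flag_iff.1 ((h.2 _ (by rwa [fl_fst])).1 (S.fl_mem_flag g b i))
  have hon : S.fl k c l ≠ S.fl g b l := by
    intro e
    refine h.1 (S.flag_eq_flag_iff.2 (S.fl_eq_fl_iff.1 (funext fun i => ?_)))
    by_cases hi : i = l
    · rw [hi, e]
    · exact hoff i hi
  have hl0 : l ≠ 0 := by rintro rfl; exact hon (S.face_zero _ _)
  have hl5 : l ≠ 5 := by rintro rfl; exact hon (S.face_five _ _)
  refine ⟨hl0, hl5, ?_⟩
  have hl0' : (l : ℕ) ≠ 0 := fun e => hl0 (Fin.ext e)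
  have hl5' : (l : ℕ) ≠ 5 := fun e => hl5 (Fin.ext e)
  obtain ⟨i, hi⟩ : ∃ i : Fin 6, (i : ℕ) + 1 = l := ⟨⟨l - 1, by omega⟩, by simp only; omega⟩
  obtain ⟨m, hm⟩ : ∃ m : Fin 6, (l : ℕ) + 1 = m := ⟨⟨l + 1, by omega⟩, rfl⟩
  have hil : i < l := by omega
  have hlm : l < m := by omega
  -- the section between the neighbouring faces has only two faces of index `l`
  have h2 := S.ncard_diamond hi hm (S.fl_mono g b (hil.trans hlm).le) rfl rfl
  set B := {H : S.Face | H.1 = l ∧ S.fl g b i ≤ H ∧ H ≤ S.fl g b m}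
  have hmem : ∀ (k : G) (c : Bool), (∀ i, i ≠ l → S.fl g b i = S.fl k c i) → S.fl k c l ∈ B := by
    intro k c hk
    refine ⟨rfl, ?_, ?_⟩
    · rw [hk i hil.ne]; exact S.fl_mono k c hil.le
    · rw [hk m hlm.ne']; exact S.fl_mono k c hlm.le
  have m1 : S.fl g b l ∈ B := hmem g b fun _ _ => rfl
  have m2 := hmem k c hoff
  have hoff' : ∀ i, i ≠ l → S.fl g b i = S.fl (g * S.step l b) (!b) i :=
    fun i hi => (S.fl_step hl0 hl5 hi g b).symm
  have m3 := hmem (g * S.step l b) (!b) hoff'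
  have hne : S.fl (g * S.step l b) (!b) l ≠ S.fl g b l := by
    intro e
    refine S.flag_ne_flag_not g (g * S.step l b) b
      (S.flag_eq_flag_iff.2 (S.fl_eq_fl_iff.1 (funext fun i => ?_)))
    by_cases hi : i = l
    · rw [hi, e]
    · exact hoff' i hi
  obtain ⟨x, y, hxy, hBxy⟩ := Set.ncard_eq_two.1 h2
  rw [hBxy] at m1 m2 m3
  have heq : S.fl k c l = S.fl (g * S.step l b) (!b) l := by
    simp only [Set.mem_insert_iff, Set.mem_singleton_iff] at m1 m2 m3
    rcases m1 with m1 | m1 <;> rcases m2 with m2 | m2 <;> rcases m3 with m3 | m3 <;>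
      simp_all
  refine S.flag_eq_flag_iff.2 (S.fl_eq_fl_iff.1 (funext fun i => ?_))
  by_cases hi : i = l
  · rw [hi, heq]
  · rw [← hoff i hi, hoff' i hi]

theorem Adj.unique {l : Fin 6} {X Y Z : Flag S.Face} (h : S.Adj l X Y) (h' : S.Adj l X Z) :
    Y = Z := by
  obtain ⟨g, b, rfl⟩ := S.exists_eq_flag X
  rw [(Adj.eq_step S h).2.2, (Adj.eq_step S h').2.2]

/-- An automorphism commutes with the passage to adjacent flags. -/
theorem smul_flag_step (γ : S.Face ≃o S.Face) {l : Fin 6} (hl : l ≠ 0) (hl' : l ≠ 5) {g h : G}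
    {b c : Bool} (e : γ • S.flag g b = S.flag h c) :
    γ • S.flag (g * S.step l b) (!b) = S.flag (h * S.step l c) (!c) := by
  have := (S.adj_step hl hl' g b).smul γ
  rw [e] at this
  exact (Adj.eq_step S this).2.2

/-- The automorphism group acts freely on flags. -/
theorem eq_one_of_smul_flag {γ : S.Face ≃o S.Face} {X : Flag S.Face} (h : γ • X = X) : γ = 1 := by
  have path : ∀ (s : Set S.Face) (Y : Flag S.Face),
      Relation.ReflTransGen (S.StepRel s) X Y → γ • Y = Y := by
    intro s Y hY
    induction hY with
    | refl => exact h
    | tail _ hYZ ih =>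
      obtain ⟨-, -, l, -, -, hne, hl⟩ := hYZ
      have h1 : S.Adj l _ _ := ⟨hne, hl⟩
      have h2 := h1.smul γ
      rw [ih] at h2
      exact Adj.unique S h2 h1
  have all : ∀ Y : Flag S.Face, γ • Y = Y := fun Y => path _ Y (S.reflTransGen_flag X Y)
  ext x
  obtain ⟨g, hg⟩ := x.exists_rep
  have hx : x ∈ S.flag g false := by rw [mem_flag, fl_false]; exact hg
  have hγ : γ x ∈ γ • S.flag g false := by
    rw [mem_smul_flag]
    change γ.symm (γ x) ∈ _
    rwa [γ.symm_apply_apply]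
  rw [all, mem_flag, index_apply] at hγ
  rw [hγ]
  exact (S.mem_flag.1 hx).symm

theorem eq_of_smul_flag {γ γ' : S.Face ≃o S.Face} {X : Flag S.Face} (h : γ • X = γ' • X) :
    γ = γ' := by
  have : (γ'⁻¹ * γ) • X = X := by rw [mul_smul, h, inv_smul_smul]
  exact (inv_mul_eq_one.1 (S.eq_one_of_smul_flag this)).symm

theorem aut_injective : Function.Injective S.aut := by
  intro g h e
  have : S.aut g • S.flag 1 false = S.aut h • S.flag 1 false := by rw [e]
  rw [aut_smul_flag, aut_smul_flag, flag_eq_flag_iff, mul_one, mul_one] at this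
  exact this.1

theorem t_mul_u : S.t * S.u = S.s₃⁻¹ := by
  have := S.u_mul_zpow 1
  rw [zpow_one, zpow_neg_one] at this
  rw [t_eq_u_mul_s₃, this, mul_assoc, u_mul_u, mul_one]

theorem u_mul_s₁ : S.u * S.s₁ = S.s₂⁻¹ := by
  rw [eq_inv_iff_mul_eq_one, mul_assoc]; exact S.u_mul_u

/-- The generators do not satisfy the same relations as the generators for the flag that differs
from the base flag in the vertex. -/
def Irreflexible : Prop :=
  ∃ w : FreeGroup (Fin 3), FreeGroup.lift ![S.s₁, S.s₂, S.s₃] w = 1 ∧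
    FreeGroup.lift ![S.s₁⁻¹, S.s₁ * S.s₂⁻¹ * S.s₁⁻¹, S.s₃] w ≠ 1

/-- An automorphism that took the base flag to an adjacent flag would conjugate the distinguished
generators to those of the adjacent flag. -/
theorem Irreflexible.smul_flag_ne (hS : S.Irreflexible) (γ : S.Face ≃o S.Face) :
    γ • S.flag 1 false ≠ S.flag 1 true := by
  intro h
  have conj : ∀ {a b : G}, γ • S.flag a⁻¹ false = S.flag b⁻¹ true →
      γ * S.aut a * γ⁻¹ = S.aut b := by
    intro a b hab
    have e : γ * S.aut a⁻¹ = S.aut b⁻¹ * γ := by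
      apply S.eq_of_smul_flag (X := S.flag 1 false)
      rw [mul_smul, mul_smul, h, aut_smul_flag, aut_smul_flag, mul_one, mul_one, hab]
    rw [map_inv, map_inv] at e
    rw [mul_inv_eq_iff_eq_mul]
    have := congrArg (fun x => S.aut b * x * S.aut a) e
    simpa [mul_assoc] using this.symm
  have c1 : γ * S.aut S.s₁ * γ⁻¹ = S.aut S.s₁⁻¹ := by
    apply conj
    have h1 := S.smul_flag_step γ (l := 2) (by decide) (by decide) h
    have h2 := S.smul_flag_step γ (l := 1) (by decide) (by decide) h1
    simpa [step_one, step_two_false, step_two_true] using h2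
  have c2 : γ * S.aut S.s₂ * γ⁻¹ = S.aut (S.s₁ * S.s₂⁻¹ * S.s₁⁻¹) := by
    apply conj
    have h1 := S.smul_flag_step γ (l := 3) (by decide) (by decide) h
    have h2 := S.smul_flag_step γ (l := 2) (by decide) (by decide) h1
    simp only [Bool.not_true, Bool.not_false, step_three, step_two_true, step_two_false, one_mul,
      u_mul_s₁] at h2
    rw [h2, u]
    simp [mul_assoc]
  have c3 : γ * S.aut S.s₃ * γ⁻¹ = S.aut S.s₃ := by
    apply conj
    have h1 := S.smul_flag_step γ (l := 4) (by decide) (by decide) h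
    have h2 := S.smul_flag_step γ (l := 3) (by decide) (by decide) h1
    simpa [step_three, step_four, t_mul_u] using h2
  obtain ⟨w, hw1, hw2⟩ := hS
  apply hw2
  apply S.aut_injective
  have hom : ((MulAut.conj γ).toMonoidHom.comp S.aut).comp
      (FreeGroup.lift ![S.s₁, S.s₂, S.s₃]) =
      S.aut.comp (FreeGroup.lift ![S.s₁⁻¹, S.s₁ * S.s₂⁻¹ * S.s₁⁻¹, S.s₃]) := by
    ext1 i
    fin_cases i
    · simpa using c1
    · simpa using c2
    · simpa using c3
  have := DFunLike.congr_fun hom w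
  simp only [MonoidHom.comp_apply, hw1, map_one] at this
  rw [map_one, ← this]

theorem Irreflexible.exists_eq_aut (hS : S.Irreflexible) (γ : S.Face ≃o S.Face) :
    ∃ g, γ = S.aut g := by
  obtain ⟨g, b, hg⟩ := S.exists_eq_flag (γ • S.flag 1 false)
  have e : (S.aut g⁻¹ * γ) • S.flag 1 false = S.flag 1 b := by
    rw [mul_smul, hg, aut_smul_flag, inv_mul_cancel]
  cases b
  · have := S.eq_one_of_smul_flag e
    rw [map_inv, inv_mul_eq_one] at this
    exact ⟨g, this.symm⟩
  · exact absurd e (Irreflexible.smul_flag_ne S hS _)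

/-- The group of a rotation system that is not reflexible is the automorphism group. -/
noncomputable def Irreflexible.autEquiv (hS : S.Irreflexible) : G ≃* (S.Face ≃o S.Face) :=
  MulEquiv.ofBijective S.aut
    ⟨S.aut_injective, fun γ => (Irreflexible.exists_eq_aut S hS γ).imp fun _ h => h.symm⟩

theorem flag_mem_orbit_iff (hS : S.Irreflexible) {g h : G} {b c : Bool} :
    S.flag g b ∈ MulAction.orbit (S.Face ≃o S.Face) (S.flag h c) ↔ b = c := by
  constructor
  · rintro ⟨γ, hγ⟩
    obtain ⟨k, rfl⟩ := Irreflexible.exists_eq_aut S hS γ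
    have : S.flag (k * h) c = S.flag g b := (S.aut_smul_flag k h c).symm.trans hγ
    exact (S.flag_eq_flag_iff.1 this).2.symm
  · rintro rfl
    exact ⟨S.aut (g * h⁻¹), by
      change S.aut (g * h⁻¹) • S.flag h b = _
      rw [aut_smul_flag, inv_mul_cancel_right]⟩

theorem adj_of_adjacentAt {i : ℤ} {X Y : Flag S.Face} (h : S.polytope.AdjacentAt i X Y) :
    ∃ l : Fin 6, i = ((l : ℕ) : ℤ) - 1 ∧ S.Adj l X Y := by
  obtain ⟨hne, hXY⟩ := h
  obtain ⟨x, hx, hxY⟩ : ∃ x ∈ X, x ∉ Y := by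
    by_contra! hsub
    exact hne (Flag.ext (X.max_chain' Y.chain_le hsub))
  have hi : ((x.1 : ℕ) : ℤ) - 1 = i := by
    by_contra hxi
    exact hxY ((hXY x hxi).1 hx)
  exact ⟨x.1, hi.symm, hne, fun y hy => hXY y fun e => hy (Fin.ext (by
    have : ((y.1 : ℕ) : ℤ) - 1 = i := e
    omega))⟩

theorem adjacentAt_of_adj {l : Fin 6} {i : ℤ} (hi : i = ((l : ℕ) : ℤ) - 1) {X Y : Flag S.Face}
    (h : S.Adj l X Y) : S.polytope.AdjacentAt i X Y :=
  ⟨h.1, fun x hx => h.2 x fun e => hx (by rw [hi, ← e])⟩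

theorem isChiral (hS : S.Irreflexible) : S.polytope.IsChiral := by
  constructor
  · rw [Nat.card_eq_two_iff]
    refine ⟨Quotient.mk'' (S.flag 1 false), Quotient.mk'' (S.flag 1 true), ?_, ?_⟩
    · intro e
      have := (S.flag_mem_orbit_iff hS).1 (Quotient.exact e)
      simp at this
    · refine Set.eq_univ_of_forall fun x => ?_
      induction x using Quotient.inductionOn' with
      | h Φ =>
        obtain ⟨g, b, rfl⟩ := S.exists_eq_flag Φ
        have hor : ∀ b, (Quotient.mk'' (S.flag g b) :
            MulAction.orbitRel.Quotient (S.Face ≃o S.Face) (Flag S.Face)) =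
            Quotient.mk'' (S.flag 1 b) :=
          fun b => Quotient.sound ((S.flag_mem_orbit_iff hS).2 rfl)
        cases b
        · exact Or.inl (hor _)
        · exact Or.inr (hor _)
  · intro i Φ Ψ h hmem
    obtain ⟨l, -, hadj⟩ := S.adj_of_adjacentAt h
    obtain ⟨g, b, rfl⟩ := S.exists_eq_flag Φ
    rw [(Adj.eq_step S hadj).2.2] at hmem
    have := (S.flag_mem_orbit_iff hS).1 hmem
    cases b <;> simp at this

theorem card_aut (hS : S.Irreflexible) : Nat.card S.polytope.Aut = Nat.card G :=
  (Nat.card_congr (Irreflexible.autEquiv S hS).toEquiv).symm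

theorem hasSchlafliType : S.polytope.HasSchlafliType ![3, q, 3] := by
  intro i X Y hXY hX hY
  have hX' : ((X.1 : ℕ) : ℤ) - 1 = (i : ℤ) - 1 := hX
  have hY' : ((Y.1 : ℕ) : ℤ) - 1 = (i : ℤ) + 2 := hY
  have hlt : (i : ℕ) + 2 < 6 := by have := i.2; omega
  have h := S.ncard_polygon (i := X.1) (j := ⟨(i : ℕ) + 2, hlt⟩) (k := Y.1)
    (by simp only; omega) (by simp only; omega) hXY rfl rfl
  have e : {H : S.polytope.Face | S.polytope.rank H = (i : ℤ) + 1 ∧ X ≤ H ∧ H ≤ Y} =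
      {H : S.Face | H.1 = ⟨(i : ℕ) + 2, hlt⟩ ∧ X ≤ H ∧ H ≤ Y} := by
    ext H
    simp only [Set.mem_ofPred_eq, Fin.ext_iff]
    constructor
    · rintro ⟨h, h'⟩; exact ⟨by omega, h'⟩
    · rintro ⟨h, h'⟩; exact ⟨by omega, h'⟩
  rw [e, h]
  obtain rfl | rfl | rfl : i = 0 ∨ i = 1 ∨ i = 2 := by omega
  · have : X.1 ≠ 1 := fun h => by rw [h] at hX'; simp at hX'
    simp [this]
  · have : X.1 = 1 := Fin.ext (by simp at hX'; omega)
    simp [this]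
  · have : X.1 ≠ 1 := fun h => by rw [h] at hX'; simp at hX'
    simp [this]

theorem numFaces_eq (i : Fin 6) (k : ℤ) (hk : k = ((i : ℕ) : ℤ) - 1) :
    S.polytope.numFaces k = (S.K i).index := by
  have e : {F : S.polytope.Face | S.polytope.rank F = k} =
      Set.range (fun c : G ⧸ S.K i => (⟨i, c⟩ : S.Face)) := by
    ext x
    constructor
    · intro hx
      have hx' : ((x.1 : ℕ) : ℤ) - 1 = k := hx
      obtain rfl : x.1 = i := Fin.ext (by omega)
      exact ⟨x.2, rfl⟩
    · rintro ⟨c, rfl⟩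
      exact hk.symm
  have hinj : Function.Injective (fun c : G ⧸ S.K i => (⟨i, c⟩ : S.Face)) := fun c d h =>
    eq_of_heq (Sigma.mk.inj h).2
  rw [AbstractPolytope.numFaces, e]
  exact (Nat.card_coe_set_eq _).symm.trans (Nat.card_range_of_injective hinj)

/-- A dihedral group of order six. -/
theorem card_closure_dihedral {a b : G} (ha : a ^ 3 = 1) (hb : b * b = 1)
    (hba : b * a * (b * a) = 1) (hb1 : b ≠ 1) {H : Subgroup G} (hbH : b ∈ H) (haH : a ∉ H) :
    Nat.card (Subgroup.closure {b, a}) = 6 := by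
  have ha' : a ∈ Subgroup.closure {b, a} := Subgroup.subset_closure (by simp)
  have hb' : b ∈ Subgroup.closure {b, a} := Subgroup.subset_closure (by simp)
  let f : Fin 3 × Bool → Subgroup.closure {b, a} :=
    fun p => ⟨a ^ (p.1 : ℕ) * if p.2 then b else 1, by
      split_ifs
      · exact mul_mem (pow_mem ha' _) hb'
      · exact mul_mem (pow_mem ha' _) (one_mem _)⟩
  have hf : Function.Bijective f := by
    constructor
    · rintro ⟨i, x⟩ ⟨j, y⟩ h
      have h' : a ^ (i : ℕ) * (if x then b else 1) = a ^ (j : ℕ) * if y then b else 1 :=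
        congrArg Subtype.val h
      have hc : ∀ x : Bool, (if x then b else 1) ∈ H := by
        intro x; split_ifs
        · exact hbH
        · exact one_mem _
      have e : a ^ ((i : ℤ) - j) = (a ^ (j : ℕ))⁻¹ * a ^ (i : ℕ) := by
        rw [sub_eq_neg_add, zpow_add, zpow_neg, zpow_natCast, zpow_natCast]
      have hm : a ^ ((i : ℤ) - j) ∈ H := by
        have : a ^ ((i : ℤ) - j) = (if y then b else 1) * (if x then b else 1)⁻¹ := by
          rw [e, eq_mul_inv_iff_mul_eq, mul_assoc, h', inv_mul_cancel_left]
        rw [this]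
        exact mul_mem (hc y) (inv_mem (hc x))
      obtain rfl : i = j := by
        have := (zpow_mem_of_cube ha haH _).1 hm
        omega
      have := mul_left_cancel h'
      cases x <;> cases y <;> simp_all
    · rintro ⟨x, hx⟩
      have hz : a ^ (3 : ℤ) = 1 := by exact_mod_cast ha
      have red : ∀ n : ℤ, ∃ i : Fin 3, a ^ n = a ^ (i : ℕ) := by
        intro n
        refine ⟨⟨(n % 3).toNat, by omega⟩, ?_⟩
        rw [← zpow_natCast]
        conv_lhs => rw [show n = n % 3 + 3 * (n / 3) by omega, zpow_add, zpow_mul, hz, one_zpow,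
          mul_one]
        congr 1
        simp only
        omega
      obtain ⟨n, h | h⟩ := mem_closure_dihedral hb hba hx
      · obtain ⟨i, hi⟩ := red n
        exact ⟨(i, false), Subtype.ext (by simp [f, h, hi])⟩
      · obtain ⟨i, hi⟩ := red n
        exact ⟨(i, true), Subtype.ext (by simp [f, h, hi])⟩
  rw [← Nat.card_eq_of_bijective f hf]
  simp

theorem card_K₂ : Nat.card (S.K 2) = 6 :=
  card_closure_dihedral S.cube₃ S.u_mul_u S.t_mul_t
    (fun h => S.u_not_mem_K₁ (h ▸ one_mem _)) S.u_mem_K₄ S.not_mem_K₄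

theorem card_K₃ : Nat.card (S.K 3) = 6 :=
  card_closure_dihedral S.cube₁ S.w_mul_w S.w_mul_s₁_mul
    (fun h => S.w_not_mem_K₄ (h ▸ one_mem _)) S.w_mem_K₁ S.not_mem_K₁

theorem isDistinguished : S.polytope.IsDistinguished (S.flag 1 false)
    (fun i => S.aut (![S.s₁, S.s₂, S.s₃] i)⁻¹) := by
  intro i
  obtain rfl | rfl | rfl : i = 0 ∨ i = 1 ∨ i = 2 := by omega
  · have h1 := S.adj_step (l := 2) (by decide) (by decide) 1 false
    have h2 := S.adj_step (l := 1) (by decide) (by decide) (1 * S.step 2 false) (!false)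
    refine ⟨_, S.adjacentAt_of_adj (l := 2) (by simp) h1,
      S.adjacentAt_of_adj (l := 1) (by simp) ?_⟩
    have e : S.aut (![S.s₁, S.s₂, S.s₃] 0)⁻¹ • S.flag 1 false =
        S.flag (1 * S.step 2 false * S.step 1 true) false := by
      rw [aut_smul_flag]; simp [step_one, step_two_false]
    exact e.symm ▸ h2
  · have h1 := S.adj_step (l := 3) (by decide) (by decide) 1 false
    have h2 := S.adj_step (l := 2) (by decide) (by decide) (1 * S.step 3 false) (!false)
    refine ⟨_, S.adjacentAt_of_adj (l := 3) (by simp) h1,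
      S.adjacentAt_of_adj (l := 2) (by simp) ?_⟩
    have e : S.aut (![S.s₁, S.s₂, S.s₃] 1)⁻¹ • S.flag 1 false =
        S.flag (1 * S.step 3 false * S.step 2 true) false := by
      rw [aut_smul_flag]; simp [step_three, step_two_true, u_mul_s₁]
    exact e.symm ▸ h2
  · have h1 := S.adj_step (l := 4) (by decide) (by decide) 1 false
    have h2 := S.adj_step (l := 3) (by decide) (by decide) (1 * S.step 4 false) (!false)
    refine ⟨_, S.adjacentAt_of_adj (l := 4) (by simp) h1,
      S.adjacentAt_of_adj (l := 3) (by simp) ?_⟩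
    have e : S.aut (![S.s₁, S.s₂, S.s₃] 2)⁻¹ • S.flag 1 false =
        S.flag (1 * S.step 4 false * S.step 3 true) false := by
      rw [aut_smul_flag]; simp [step_three, step_four, t_mul_u]
    exact e.symm ▸ h2

theorem hasRotationPresentation (hS : S.Irreflexible) {rels : Set (FreeGroup (Fin 3))}
    (e : PresentedGroup rels ≃* G) (he : ∀ i, e (PresentedGroup.of i) = ![S.s₁, S.s₂, S.s₃] i) :
    S.polytope.HasRotationPresentation rels := by
  refine ⟨S.flag 1 false, _, S.isDistinguished,
    (e.trans (MulEquiv.inv' G)).trans (Irreflexible.autEquiv S hS).op, fun i => ?_⟩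
  rw [MulEquiv.trans_apply, MulEquiv.trans_apply, he]
  rfl

end RotationSystem

/-! ### Dualities -/

namespace RotationSystem

open scoped Pointwise

variable {G : Type} [Group G] {q : ℕ} (S : RotationSystem G q)

/-- The endomorphism of the group that is induced by conjugation with a duality which interchanges
the base vertex and the base facet and commutes with `s₂`. -/
structure Twist where
  /-- The endomorphism. -/
  e : G →* G
  map₁ : e S.s₁ = S.s₂ * S.s₃ * S.s₂⁻¹
  map₂ : e S.s₂ = S.s₂
  map₃ : e S.s₃ = S.s₁

namespace Twist

variable {S} (T : S.Twist)

theorem map_map (g : G) : T.e (T.e g) = S.s₂ * g * S.s₂⁻¹ := by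
  have : T.e.comp T.e = (MulAut.conj S.s₂).toMonoidHom := by
    refine MonoidHom.eq_of_eqOn_dense S.closure_eq_top ?_
    rintro x (rfl | rfl | rfl)
    · simp [T.map₁, T.map₂, T.map₃]
    · simp [T.map₂]
    · simp [T.map₁, T.map₃]
  exact DFunLike.congr_fun this g

theorem map_u : T.e S.u = S.w := by
  rw [u, map_mul, T.map₁, T.map₂, inv_mul_cancel_right]; rfl

theorem map_w : T.e S.w = S.s₂ * S.s₁ := by rw [w, map_mul, T.map₂, T.map₃]

variable (S) in
/-- The representatives of the cosets that correspond to the base faces under the duality. -/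
def shift (i : Fin 6) : G := if i = 3 then S.s₂ else 1

theorem shift_three : shift S 3 = S.s₂ := rfl
theorem shift_of_ne {i : Fin 6} (h : i ≠ 3) : shift S i = 1 := if_neg h

theorem map_mem (i : Fin 6) {x : G} (hx : x ∈ S.K i) :
    (shift S i)⁻¹ * T.e x * shift S i ∈ S.K i.rev := by
  suffices h : S.K i ≤ (S.K i.rev).comap
      ((MulAut.conj (shift S i)⁻¹).toMonoidHom.comp T.e) by
    have := h hx
    simpa using this
  obtain rfl | rfl | rfl | rfl | rfl | rfl : i = 0 ∨ i = 1 ∨ i = 2 ∨ i = 3 ∨ i = 4 ∨ i = 5 := by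
    omega
  · exact fun x _ => S.mem_K_five _
  · refine (Subgroup.closure_le _).2 ?_
    rintro x (rfl | rfl)
    · simpa [shift_of_ne, T.map₂] using S.s₂_mem_K₄
    · simpa [shift_of_ne, T.map₃] using S.s₁_mem_K₄
  · refine (Subgroup.closure_le _).2 ?_
    rintro x (rfl | rfl)
    · simpa [shift_of_ne, T.map_u] using S.w_mem_K₃
    · simpa [shift_of_ne, T.map₃] using S.s₁_mem_K₃
  · refine (Subgroup.closure_le _).2 ?_
    rintro x (rfl | rfl)
    · simpa [shift_three, T.map_w, u] using S.u_mem_K₂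
    · simpa [shift_three, T.map₁, mul_assoc] using S.s₃_mem_K₂
  · refine (Subgroup.closure_le _).2 ?_
    rintro x (rfl | rfl)
    · simpa [shift_of_ne, T.map₁] using
        mul_mem (mul_mem S.s₂_mem_K₁ S.s₃_mem_K₁) (inv_mem S.s₂_mem_K₁)
    · simpa [shift_of_ne, T.map₂] using S.s₂_mem_K₁
  · exact fun x _ => S.mem_K_zero _

/-- The duality that induces the endomorphism `T.e`. -/
def dual (x : S.Face) : S.Face :=
  ⟨x.1.rev, Quotient.map' (fun g => T.e g * shift S x.1) (fun g h hgh => by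
    rw [QuotientGroup.leftRel_apply] at hgh ⊢
    have := T.map_mem x.1 hgh
    simpa [mul_assoc] using this) x.2⟩

theorem dual_face (i : Fin 6) (g : G) :
    T.dual (S.face i g) = S.face i.rev (T.e g * shift S i) := rfl

theorem dual_mulLeft (g : G) (x : S.Face) :
    T.dual (S.mulLeft g x) = S.mulLeft (T.e g) (T.dual x) := by
  obtain ⟨h, hh⟩ := x.exists_rep
  rw [hh, mulLeft_face, dual_face, dual_face, mulLeft_face, map_mul, mul_assoc]

theorem dual_dual (x : S.Face) : T.dual (T.dual x) = S.mulLeft S.s₂ x := by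
  obtain ⟨g, hg⟩ := x.exists_rep
  rw [hg, dual_face, dual_face, mulLeft_face, map_mul, map_map, Fin.rev_rev]
  generalize x.1 = i
  obtain rfl | rfl | rfl | rfl | rfl | rfl : i = 0 ∨ i = 1 ∨ i = 2 ∨ i = 3 ∨ i = 4 ∨ i = 5 := by
    omega
  · exact S.face_zero _ _
  · rw [shift_of_ne (by decide), shift_of_ne (by decide), map_one, mul_one, mul_one]
    exact S.face_mul _ (inv_mem S.s₂_mem_K₁)
  · rw [shift_of_ne (by decide), map_one, mul_one]
    change S.face 2 (S.s₂ * g * S.s₂⁻¹ * S.s₂) = _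
    rw [inv_mul_cancel_right]
  · rw [shift_three, T.map₂, inv_mul_cancel_right]
    change S.face 3 (S.s₂ * g * 1) = _
    rw [mul_one]
  · rw [shift_of_ne (by decide), shift_of_ne (by decide), map_one, mul_one, mul_one]
    exact S.face_mul _ (inv_mem S.s₂_mem_K₄)
  · exact S.face_five _ _

theorem dual_antitone : Antitone T.dual := by
  rintro x y ⟨hij, g, hx, hy⟩
  rw [hx, hy, dual_face, dual_face]
  generalize x.1 = i at hij ⊢
  generalize y.1 = j at hij ⊢
  have hji : j.rev ≤ i.rev := Fin.rev_le_rev.2 hij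
  by_cases hi : i = 3
  · by_cases hj : j = 3
    · rw [hi, hj]
    · subst hi
      have : S.face j.rev (T.e g * shift S j) = S.face j.rev (T.e g * S.s₂) := by
        rw [shift_of_ne hj, mul_one]
        refine (S.face_mul _ ?_).symm
        obtain rfl | rfl : j = 4 ∨ j = 5 := by omega
        · exact S.s₂_mem_K₁
        · exact S.mem_K_zero _
      rw [this]
      exact S.face_le_face hji _
  · rw [shift_of_ne hi, mul_one]
    by_cases hj : j = 3
    · subst hj
      rw [shift_three]
      obtain rfl | rfl | rfl : i = 0 ∨ i = 1 ∨ i = 2 := by omega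
      · rw [show S.face (Fin.rev 0) (T.e g) = S.face (Fin.rev 0) (T.e g * S.s₂) from
          S.face_five _ _]
        exact S.face_le_face hji _
      · rw [← S.face_mul (T.e g) (show S.s₂ ∈ S.K (Fin.rev 1) from S.s₂_mem_K₄)]
        exact S.face_le_face hji _
      · rw [← S.face_mul (T.e g) (show S.w ∈ S.K (Fin.rev 2) from S.w_mem_K₃),
          ← S.face_mul (T.e g * S.s₂) (show S.s₃ ∈ S.K (Fin.rev 3) from S.s₃_mem_K₂), w, mul_assoc]
        exact S.face_le_face hji _
    · rw [shift_of_ne hj, mul_one]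
      exact S.face_le_face hji _

/-- The duality as a permutation of the faces. -/
def perm : Equiv.Perm S.Face where
  toFun := T.dual
  invFun x := S.mulLeft S.s₂⁻¹ (T.dual x)
  left_inv x := by
    change S.mulLeft S.s₂⁻¹ (T.dual (T.dual x)) = x
    rw [dual_dual, ← mulLeft_mul, inv_mul_cancel, mulLeft_one]
  right_inv x := by
    change T.dual (S.mulLeft S.s₂⁻¹ (T.dual x)) = x
    rw [dual_mulLeft, dual_dual, map_inv, T.map₂, ← mulLeft_mul, inv_mul_cancel, mulLeft_one]

variable (S) in
/-- The action of the group by permutations of the faces. -/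
def autPerm : G →* Equiv.Perm S.Face where
  toFun g := (S.aut g).toEquiv
  map_one' := by rw [map_one]; rfl
  map_mul' g h := by rw [map_mul]; rfl

theorem autPerm_injective : Function.Injective (autPerm S) := by
  intro g h e
  apply S.aut_injective
  ext x
  exact Equiv.congr_fun e x

theorem perm_mul_autPerm (g : G) : T.perm * autPerm S g = autPerm S (T.e g) * T.perm :=
  Equiv.ext fun x => T.dual_mulLeft g x

theorem perm_mul_perm : T.perm * T.perm = autPerm S S.s₂ := Equiv.ext fun x => T.dual_dual x

theorem perm_pow_odd (k : ℕ) : T.perm ^ (2 * k + 1) = autPerm S (S.s₂ ^ k) * T.perm := by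
  rw [pow_succ, pow_mul, pow_two, perm_mul_perm, map_pow]

theorem autPerm_le_iff (g : G) (x y : S.Face) : autPerm S g x ≤ autPerm S g y ↔ x ≤ y :=
  (S.aut g).le_iff_le

theorem isDuality_perm : S.polytope.IsDuality T.perm := by
  intro x y
  constructor
  · intro h
    have h2 : T.dual (T.dual y) ≤ T.dual (T.dual x) := T.dual_antitone h
    rw [dual_dual, dual_dual] at h2
    exact (autPerm_le_iff S.s₂ y x).1 h2
  · exact fun h => T.dual_antitone h

theorem isDuality_mul {δ : Equiv.Perm S.Face} (h : S.polytope.IsDuality δ) (g k : G) :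
    S.polytope.IsDuality (autPerm S g * δ * autPerm S k) := fun _ _ =>
  (autPerm_le_iff g _ _).trans ((h _ _).trans (autPerm_le_iff k _ _))

theorem isDuality_perm_pow (k : ℕ) : S.polytope.IsDuality (T.perm ^ (2 * k + 1)) := by
  have := isDuality_mul T.isDuality_perm (S.s₂ ^ k) 1
  rwa [map_one, mul_one, ← perm_pow_odd] at this

theorem isDuality_iff (hS : S.Irreflexible) {δ : Equiv.Perm S.Face} :
    S.polytope.IsDuality δ ↔ ∃ g, δ = T.perm * autPerm S g := by
  constructor
  · intro h
    let γ : S.Face ≃o S.Face :=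
      { toEquiv := T.perm⁻¹ * δ
        map_rel_iff' := by
          intro x y
          have := T.isDuality_perm ((T.perm⁻¹ * δ) y) ((T.perm⁻¹ * δ) x)
          rw [← Equiv.Perm.mul_apply, ← Equiv.Perm.mul_apply, mul_inv_cancel_left] at this
          exact this.symm.trans (h y x) }
    obtain ⟨g, hg⟩ := Irreflexible.exists_eq_aut S hS γ
    refine ⟨g, ?_⟩
    have : T.perm⁻¹ * δ = autPerm S g := congrArg RelIso.toEquiv hg
    rw [← this, mul_inv_cancel_left]
  · rintro ⟨g, rfl⟩
    have := isDuality_mul T.isDuality_perm 1 g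
    rwa [map_one, one_mul] at this

theorem setOf_isDuality (hS : S.Irreflexible) :
    {δ | S.polytope.IsDuality δ} = Set.range fun g => T.perm * autPerm S g := by
  ext δ
  exact (T.isDuality_iff hS).trans (exists_congr fun _ => eq_comm)

theorem ncard_isDuality (T : S.Twist) (hS : S.Irreflexible) :
    {δ | S.polytope.IsDuality δ}.ncard = Nat.card G := by
  rw [T.setOf_isDuality hS]
  refine (Nat.card_coe_set_eq _).symm.trans (Nat.card_range_of_injective ?_)
  intro g h e
  exact autPerm_injective (mul_left_cancel e)

/-- The duality interchanges the two orbits of flags. -/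
theorem exists_image_flag (g : G) (b : Bool) :
    ∃ h, T.perm '' (S.flag g b : Set S.Face) = (S.flag h (!b) : Set S.Face) := by
  have key : ∃ h, ∀ i : Fin 6, T.dual (S.fl g b i.rev) = S.fl h (!b) i := by
    cases b
    · refine ⟨T.e g * S.s₁⁻¹, fun i => ?_⟩
      rw [fl_false, dual_face]
      obtain rfl | rfl | rfl | rfl | rfl | rfl :
        i = 0 ∨ i = 1 ∨ i = 2 ∨ i = 3 ∨ i = 4 ∨ i = 5 := by omega
      · exact S.face_zero _ _
      · rw [Bool.not_false, fl_true_one, mul_assoc, u, inv_mul_cancel_left,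
          S.face_mul _ S.s₂_mem_K₁, shift_of_ne (by decide), mul_one]
        rfl
      · rw [S.fl_of_ne _ _ (by decide), ← S.face_mul (T.e g * S.s₁⁻¹) S.u_mem_K₂, mul_assoc, u,
          inv_mul_cancel_left]
        rfl
      · rw [S.fl_of_ne _ _ (by decide), S.face_mul _ (inv_mem S.s₁_mem_K₃),
          shift_of_ne (by decide), mul_one]
        rfl
      · rw [S.fl_of_ne _ _ (by decide), S.face_mul _ (inv_mem S.s₁_mem_K₄),
          shift_of_ne (by decide), mul_one]
        rfl
      · exact S.face_five _ _
    · refine ⟨T.e g * S.w, fun i => ?_⟩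
      rw [Bool.not_true, fl_false]
      obtain rfl | rfl | rfl | rfl | rfl | rfl :
        i = 0 ∨ i = 1 ∨ i = 2 ∨ i = 3 ∨ i = 4 ∨ i = 5 := by omega
      · exact S.face_zero _ _
      · rw [S.fl_of_ne _ _ (by decide), dual_face, S.face_mul _ S.w_mem_K₁,
          shift_of_ne (by decide), mul_one]
        rfl
      · rw [S.fl_of_ne _ _ (by decide), dual_face, w, ← mul_assoc, S.face_mul _ S.s₃_mem_K₂]
        rfl
      · rw [S.fl_of_ne _ _ (by decide), dual_face, S.face_mul _ S.w_mem_K₃,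
          shift_of_ne (by decide), mul_one]
        rfl
      · change T.dual (S.fl g true 1) = _
        rw [fl_true_one, dual_face, map_mul, map_u, shift_of_ne (by decide), mul_one]
        rfl
      · exact S.face_five _ _
  obtain ⟨h, hh⟩ := key
  refine ⟨h, ?_⟩
  rw [coe_flag, coe_flag, ← Set.range_comp]
  ext x
  constructor
  · rintro ⟨i, rfl⟩
    exact ⟨i.rev, by rw [← hh, Fin.rev_rev]; rfl⟩
  · rintro ⟨i, rfl⟩
    exact ⟨i.rev, hh i⟩

theorem not_keepsOrbit (T : S.Twist) (hS : S.Irreflexible) {δ : Equiv.Perm S.Face}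
    (hδ : S.polytope.IsDuality δ) (Φ : Flag S.Face) : ¬ S.polytope.KeepsOrbit δ Φ := by
  rintro ⟨Ψ, hΨ, hδΨ⟩
  obtain ⟨g, rfl⟩ := (T.isDuality_iff hS).1 hδ
  obtain ⟨h, b, rfl⟩ := S.exists_eq_flag Φ
  obtain ⟨k, hk⟩ := T.exists_image_flag (g * h) b
  have e : (T.perm * autPerm S g) '' (S.flag h b : Set S.Face) = (S.flag k (!b) : Set S.Face) := by
    rw [← hk, Equiv.Perm.coe_mul, Set.image_comp]
    congr 1
    exact (Flag.coe_smul (S.aut g) (S.flag h b)).symm.trans (by rw [aut_smul_flag])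
  have hkΨ : S.flag k (!b) = Ψ := Flag.ext (e.symm.trans hδΨ)
  rw [← hkΨ] at hΨ
  have := (S.flag_mem_orbit_iff hS).1 hΨ
  cases b <;> simp at this

theorem isImproperlySelfDual (T : S.Twist) (hS : S.Irreflexible) :
    S.polytope.IsImproperlySelfDual :=
  ⟨⟨T.perm, T.isDuality_perm⟩, fun ⟨_, hδ, h⟩ =>
    T.not_keepsOrbit hS hδ (S.flag 1 false) (h (S.flag 1 false))⟩

/-! ### Orders of the dualities -/

theorem perm_pow_two_mul (k : ℕ) : T.perm ^ (2 * k) = autPerm S (S.s₂ ^ k) := by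
  rw [pow_mul, pow_two, perm_mul_perm, map_pow]

theorem orderOf_perm : orderOf T.perm = 2 * q := by
  have hs : ∀ k : ℕ, autPerm S (S.s₂ ^ k) = 1 ↔ q ∣ k := by
    intro k
    have h := orderOf_dvd_iff_pow_eq_one (x := S.s₂) (n := k)
    rw [S.order₂] at h
    rw [map_eq_one_iff _ autPerm_injective, h]
  refine Nat.dvd_antisymm ?_ ?_
  · rw [orderOf_dvd_iff_pow_eq_one, perm_pow_two_mul, hs]
  · have h1 := pow_orderOf_eq_one T.perm
    rcases Nat.even_or_odd' (orderOf T.perm) with ⟨k, hk | hk⟩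
    · rw [hk, perm_pow_two_mul, hs] at h1
      rw [hk]
      exact Nat.mul_dvd_mul_left 2 h1
    · -- an odd power reverses the order, so that it is not the identity
      rw [hk] at h1
      have h2 := (T.isDuality_perm_pow k (S.face 5 1) (S.face 0 1)).2 (S.face_zero_le _)
      rw [h1] at h2
      have h3 : (5 : Fin 6) ≤ 0 := h2.1
      exact absurd h3 (by decide)

/-- The conjugates of the odd powers of the duality. -/
noncomputable def conjugate (p : (G ⧸ Subgroup.zpowers S.s₂) × Fin q) : Equiv.Perm S.Face :=
  autPerm S p.1.out * T.perm ^ (2 * (p.2 : ℕ) + 1) * (autPerm S p.1.out)⁻¹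

theorem isDuality_conjugate (p : (G ⧸ Subgroup.zpowers S.s₂) × Fin q) :
    S.polytope.IsDuality (T.conjugate p) := by
  rw [conjugate, ← map_inv]
  exact isDuality_mul (T.isDuality_perm_pow _) _ _

theorem orderOf_conjugate (p : (G ⧸ Subgroup.zpowers S.s₂) × Fin q) :
    orderOf (T.conjugate p) = 2 * q / (2 * q).gcd (2 * (p.2 : ℕ) + 1) := by
  have : T.conjugate p = MulAut.conj (autPerm S p.1.out) (T.perm ^ (2 * (p.2 : ℕ) + 1)) := rfl
  rw [this, MulEquiv.orderOf_eq, orderOf_pow' _ (by omega), orderOf_perm]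

/-- Suppose that the duality of order four among the powers of `T.perm` interchanges only one pair
of a vertex and an incident facet. Then an element that conjugates one odd power of `T.perm` to
another fixes this pair. -/
theorem mem_zpowers_of_conj {r : ℕ} (hq : q = 2 * (2 * r + 1))
    (huniq : ∀ y, y⁻¹ * S.s₂ ^ r * T.e y ∈ Subgroup.zpowers S.s₂ → y ∈ Subgroup.zpowers S.s₂)
    {y : G} {k l : ℕ}
    (h : autPerm S y * T.perm ^ (2 * l + 1) = T.perm ^ (2 * k + 1) * autPerm S y) :
    y ∈ Subgroup.zpowers S.s₂ := by
  apply huniq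
  have hsemi : SemiconjBy (autPerm S y) (T.perm ^ (2 * l + 1)) (T.perm ^ (2 * k + 1)) := h
  -- `(2 * k + 1) ^ 2` is congruent to `1` modulo four
  have h1 := hsemi.pow_right ((2 * k + 1) * (2 * r + 1))
  have hone : T.perm ^ (2 * q) = 1 := by rw [← T.orderOf_perm, pow_orderOf_eq_one]
  have e1 : T.perm ^ ((2 * k + 1) * ((2 * k + 1) * (2 * r + 1))) = T.perm ^ (2 * r + 1) := by
    have : (2 * k + 1) * ((2 * k + 1) * (2 * r + 1)) =
        2 * q * (k * (k + 1)) + (2 * r + 1) := by rw [hq]; ring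
    rw [this, pow_add, pow_mul, hone, one_pow, one_mul]
  obtain ⟨j, hj⟩ : ∃ j, (2 * l + 1) * ((2 * k + 1) * (2 * r + 1)) = 2 * j + 1 :=
    ⟨2 * l * k * (2 * r + 1) + l * (2 * r + 1) + k * (2 * r + 1) + r, by ring⟩
  rw [← pow_mul, ← pow_mul, e1, hj, perm_pow_odd, perm_pow_odd] at h1
  have h2 : autPerm S (y * S.s₂ ^ j) * T.perm = autPerm S (S.s₂ ^ r * T.e y) * T.perm := by
    rw [map_mul, map_mul, mul_assoc, mul_assoc, ← perm_mul_autPerm, ← mul_assoc (autPerm S (_ ^ r))]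
    exact h1
  have h3 := autPerm_injective (mul_right_cancel h2)
  rw [mul_assoc, ← h3, inv_mul_cancel_left]
  exact pow_mem (Subgroup.mem_zpowers _) _

theorem conjugate_injective {r : ℕ} (hq : q = 2 * (2 * r + 1))
    (huniq : ∀ y, y⁻¹ * S.s₂ ^ r * T.e y ∈ Subgroup.zpowers S.s₂ → y ∈ Subgroup.zpowers S.s₂) :
    Function.Injective T.conjugate := by
  rintro ⟨c, k⟩ ⟨d, l⟩ h
  have h' : autPerm S c.out * T.perm ^ (2 * (k : ℕ) + 1) * (autPerm S c.out)⁻¹ =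
    autPerm S d.out * T.perm ^ (2 * (l : ℕ) + 1) * (autPerm S d.out)⁻¹ := h
  have hcd : c = d := by
    rw [← QuotientGroup.out_eq' c, ← QuotientGroup.out_eq' d, QuotientGroup.eq]
    apply T.mem_zpowers_of_conj hq huniq (k := k) (l := l)
    rw [map_mul, map_inv, mul_assoc, inv_mul_eq_iff_eq_mul]
    rw [eq_mul_inv_iff_mul_eq] at h'
    rw [← h']
    group
  subst hcd
  have hkl := mul_left_cancel (mul_right_cancel h')
  have := pow_injOn_Iio_orderOf (x := T.perm) (by
    rw [orderOf_perm, Set.mem_Iio]; omega) (by rw [orderOf_perm, Set.mem_Iio]; omega) hkl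
  simp only [Prod.mk.injEq, true_and]
  exact Fin.ext (by omega)

theorem range_conjugate [Finite G] (hS : S.Irreflexible) {r : ℕ} (hq : q = 2 * (2 * r + 1))
    (huniq : ∀ y, y⁻¹ * S.s₂ ^ r * T.e y ∈ Subgroup.zpowers S.s₂ → y ∈ Subgroup.zpowers S.s₂) :
    Set.range T.conjugate = {δ | S.polytope.IsDuality δ} := by
  refine Set.eq_of_subset_of_ncard_le ?_ ?_ (Set.toFinite _)
  · rintro _ ⟨p, rfl⟩
    exact T.isDuality_conjugate p
  · rw [T.ncard_isDuality hS]
    refine le_of_eq ?_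
    rw [← Nat.card_coe_set_eq, Nat.card_range_of_injective (T.conjugate_injective hq huniq),
      Nat.card_prod, Nat.card_fin, mul_comm, ← Subgroup.card_mul_index (Subgroup.zpowers S.s₂),
      Nat.card_zpowers, S.order₂]
    rfl

/-- The number of dualities of each order: every duality is conjugate, in just one way modulo the
powers of `s₂`, to an odd power of a duality of order `2 * q`. -/
theorem numDualities_eq [Finite G] (hS : S.Irreflexible) {r : ℕ} (hq : q = 2 * (2 * r + 1))
    (huniq : ∀ y, y⁻¹ * S.s₂ ^ r * T.e y ∈ Subgroup.zpowers S.s₂ → y ∈ Subgroup.zpowers S.s₂)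
    (m : ℕ) : S.polytope.numDualities m = (Subgroup.zpowers S.s₂).index *
      ((Finset.range q).filter fun k => 2 * q / (2 * q).gcd (2 * k + 1) = m).card := by
  have e : {δ : Equiv.Perm S.polytope.Face | S.polytope.IsDuality δ ∧ orderOf δ = m} =
      T.conjugate '' (Set.univ ×ˢ {k : Fin q | 2 * q / (2 * q).gcd (2 * (k : ℕ) + 1) = m}) := by
    ext δ
    constructor
    · rintro ⟨h1, h2⟩
      have h3 : δ ∈ Set.range T.conjugate := by rw [T.range_conjugate hS hq huniq]; exact h1
      obtain ⟨p, rfl⟩ := h3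
      refine ⟨p, ⟨trivial, ?_⟩, rfl⟩
      exact (T.orderOf_conjugate p).symm.trans h2
    · rintro ⟨p, ⟨-, hp⟩, rfl⟩
      exact ⟨T.isDuality_conjugate p, (T.orderOf_conjugate p).trans hp⟩
  rw [AbstractPolytope.numDualities, e,
    (T.conjugate_injective hq huniq).injOn.ncard_image, Set.ncard_prod, Set.ncard_univ]
  congr 1
  have e2 : (fun k : Fin q => (k : ℕ)) ''
      {k : Fin q | 2 * q / (2 * q).gcd (2 * (k : ℕ) + 1) = m} =
      ((Finset.range q).filter fun k => 2 * q / (2 * q).gcd (2 * k + 1) = m : Finset ℕ) := by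
    ext k
    simp only [Set.mem_image, Finset.coe_filter, Finset.mem_range]
    constructor
    · rintro ⟨k, hk, rfl⟩; exact ⟨k.2, hk⟩
    · rintro ⟨h1, h2⟩; exact ⟨⟨k, h1⟩, h2, rfl⟩
  rw [← Set.ncard_coe_finset, ← e2, Fin.val_injective.injOn.ncard_image]

end Twist

end RotationSystem

/-! ### Words and permutation tables -/

/-- The letters of words in three generators: `2 * i` stands for the generator with number `i`, and
`2 * i + 1` for its inverse. -/
def letter {M : Type*} [Group M] (g : Fin 3 → M) : ℕ → M
  | 0 => g 0
  | 1 => (g 0)⁻¹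
  | 2 => g 1
  | 3 => (g 1)⁻¹
  | 4 => g 2
  | 5 => (g 2)⁻¹
  | _ => 1

/-- The value of a word. -/
def word {M : Type*} [Group M] (g : Fin 3 → M) (w : List ℕ) : M := (w.map (letter g)).prod

section Words

variable {M N : Type*} [Group M] [Group N] (g : Fin 3 → M)

theorem word_nil : word g [] = 1 := rfl

theorem word_cons (l : ℕ) (w : List ℕ) : word g (l :: w) = letter g l * word g w := by
  simp [word]

theorem word_append (v w : List ℕ) : word g (v ++ w) = word g v * word g w := by
  simp [word]

theorem word_replicate (k l : ℕ) : word g (List.replicate k l) = letter g l ^ k := by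
  simp [word]

theorem map_letter (f : M →* N) (l : ℕ) : f (letter g l) = letter (fun i => f (g i)) l := by
  rcases l with _ | _ | _ | _ | _ | _ | l <;> simp [letter]

theorem map_word (f : M →* N) (w : List ℕ) : f (word g w) = word (fun i => f (g i)) w := by
  induction w with
  | nil => simp [word_nil]
  | cons l w ih => rw [word_cons, word_cons, map_mul, map_letter, ih]

theorem xor_one_lt_eight {l : ℕ} (h : l < 8) : l ^^^ 1 < 8 := by interval_cases l <;> decide

theorem xor_one_lt_six {l : ℕ} (h : l < 6) : l ^^^ 1 < 6 := by interval_cases l <;> decide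

theorem letter_xor_one {l : ℕ} (h : l < 8) : letter g (l ^^^ 1) = (letter g l)⁻¹ := by
  interval_cases l <;> simp [letter]

/-- The word of the inverse. -/
def invWord (w : List ℕ) : List ℕ := (w.map (· ^^^ 1)).reverse

theorem word_invWord {w : List ℕ} (hw : ∀ l ∈ w, l < 6) : word g (invWord w) = (word g w)⁻¹ := by
  induction w with
  | nil => simp [invWord, word_nil]
  | cons l w ih =>
    have h1 : invWord (l :: w) = invWord w ++ [l ^^^ 1] := by simp [invWord]
    rw [h1, word_append, ih fun k hk => hw k (List.mem_cons_of_mem _ hk), word_cons, word_cons,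
      word_nil, mul_one, mul_inv_rev,
      letter_xor_one g ((hw l (List.mem_cons_self ..)).trans (by decide))]

/-- The images of the generators under the endomorphism of a `RotationSystem.Twist`. -/
def twistGen : Fin 3 → M := ![g 1 * g 2 * (g 1)⁻¹, g 1, g 0]

/-- The effect of `twistGen` on letters. -/
def twistLetter : ℕ → List ℕ
  | 0 => [2, 4, 3]
  | 1 => [2, 5, 3]
  | 2 => [2]
  | 3 => [3]
  | 4 => [0]
  | 5 => [1]
  | _ => []

/-- The effect of `twistGen` on words. -/
def twistWord (w : List ℕ) : List ℕ := w.flatMap twistLetter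

theorem word_twistLetter (l : ℕ) : word g (twistLetter l) = letter (twistGen g) l := by
  rcases l with _ | _ | _ | _ | _ | _ | l <;>
    simp [letter, twistLetter, twistGen, word, mul_assoc]

theorem word_twistWord (w : List ℕ) : word g (twistWord w) = word (twistGen g) w := by
  induction w with
  | nil => rfl
  | cons l w ih =>
    have : twistWord (l :: w) = twistLetter l ++ twistWord w := by simp [twistWord]
    rw [this, word_append, word_twistLetter, ih, word_cons]

theorem twistLetter_lt (l k : ℕ) (h : k ∈ twistLetter l) : k < 6 := by
  rcases l with _ | _ | _ | _ | _ | _ | l <;> simp [twistLetter] at h <;> omega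

theorem twistWord_lt (w : List ℕ) : ∀ l ∈ twistWord w, l < 6 := by
  intro l hl
  obtain ⟨k, -, hk⟩ := List.mem_flatMap.1 hl
  exact twistLetter_lt k l hk

/-- The distinguished generators that belong to the flag differing from the base flag in the
vertex. -/
def reflectGen : Fin 3 → M := ![(g 0)⁻¹, g 0 * (g 1)⁻¹ * (g 0)⁻¹, g 2]

/-- The effect of `reflectGen` on letters. -/
def reflectLetter : ℕ → List ℕ
  | 0 => [1]
  | 1 => [0]
  | 2 => [0, 3, 1]
  | 3 => [0, 2, 1]
  | 4 => [4]
  | 5 => [5]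
  | _ => []

/-- The effect of `reflectGen` on words. -/
def reflectWord (w : List ℕ) : List ℕ := w.flatMap reflectLetter

theorem word_reflectWord (w : List ℕ) : word g (reflectWord w) = word (reflectGen g) w := by
  have hl : ∀ l, word g (reflectLetter l) = letter (reflectGen g) l := by
    intro l
    rcases l with _ | _ | _ | _ | _ | _ | l <;>
      simp [letter, reflectLetter, reflectGen, word, mul_assoc]
  induction w with
  | nil => rfl
  | cons l w ih =>
    have : reflectWord (l :: w) = reflectLetter l ++ reflectWord w := by simp [reflectWord]
    rw [this, word_append, hl, ih, word_cons]

theorem reflectWord_lt (w : List ℕ) : ∀ l ∈ reflectWord w, l < 6 := by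
  intro l hl
  obtain ⟨k, -, hk⟩ := List.mem_flatMap.1 hl
  rcases k with _ | _ | _ | _ | _ | _ | k <;> simp [reflectLetter] at hk <;> omega

end Words

/-- The action of a word on a point, given the action `p` of the letters. -/
def act (p : ℕ → ℕ → ℕ) (w : List ℕ) (v : ℕ) : ℕ := w.foldr p v

/-- A table of permutations of `{0, …, n - 1}`, one for each letter. -/
structure PermTable (n : ℕ) where
  /-- The image of a point under a letter. -/
  p : ℕ → ℕ → ℕ
  lt : ∀ v < n, ∀ l < 6, p l v < n
  inv : ∀ v < n, ∀ l < 6, p (l ^^^ 1) (p l v) = v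

namespace PermTable

variable {n : ℕ} (P : PermTable n)

/-- The permutation of a generator. -/
def perm (i : Fin 3) : Equiv.Perm (Fin n) where
  toFun v := ⟨P.p (2 * i) v, P.lt v v.2 _ (by omega)⟩
  invFun v := ⟨P.p (2 * i + 1) v, P.lt v v.2 _ (by omega)⟩
  left_inv v := Fin.ext (by
    have := P.inv v v.2 (2 * i) (by omega)
    have e : (2 * (i : ℕ)) ^^^ 1 = 2 * i + 1 := by
      obtain rfl | rfl | rfl : i = 0 ∨ i = 1 ∨ i = 2 := by omega
      all_goals rfl
    rwa [e] at this)
  right_inv v := Fin.ext (by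
    have := P.inv v v.2 (2 * i + 1) (by omega)
    have e : (2 * (i : ℕ) + 1) ^^^ 1 = 2 * i := by
      obtain rfl | rfl | rfl : i = 0 ∨ i = 1 ∨ i = 2 := by omega
      all_goals rfl
    rwa [e] at this)

theorem letter_perm {l : ℕ} (hl : l < 6) (v : Fin n) : (letter P.perm l v : ℕ) = P.p l v := by
  interval_cases l <;> rfl

theorem word_perm {w : List ℕ} (hw : ∀ l ∈ w, l < 6) (v : Fin n) :
    (word P.perm w v : ℕ) = act P.p w v := by
  induction w with
  | nil => rfl
  | cons l w ih =>
    rw [word_cons, Equiv.Perm.mul_apply, letter_perm P (hw l (List.mem_cons_self ..)),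
      ih fun k hk => hw k (List.mem_cons_of_mem _ hk)]
    rfl

theorem word_perm_eq_one {w : List ℕ} (hw : ∀ l ∈ w, l < 6) (h : ∀ v < n, act P.p w v = v) :
    word P.perm w = 1 :=
  Equiv.ext fun v => Fin.ext ((P.word_perm hw v).trans (h v v.2))

end PermTable

/-! ### Coset enumeration -/

namespace CosetEnumeration

/-- Follow the word `w` from the point `c`, the last letter acting first. An edge, the letter `l` at
the point `d`, has the code `8 * d + l`; edges known to be correct are marked in `mask`. At most one
edge may be unknown: the result is the end point and the successor of the code of the unknown edge,
or zero if there is none. -/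
def walk (p : ℕ → ℕ → ℕ) (mask : ℕ) : List ℕ → ℕ → Option (ℕ × ℕ)
  | [], c => some (c, 0)
  | l :: w, c =>
    match walk p mask w c with
    | none => none
    | some (d, u) =>
      if mask.testBit (8 * d + l) then some (p l d, u)
      else if u = 0 then some (p l d, 8 * d + l + 1) else none

/-- Mark an edge and the reverse edge. -/
def addEdge (p : ℕ → ℕ → ℕ) (mask e : ℕ) : ℕ :=
  mask ||| 1 <<< e ||| 1 <<< (8 * p (e % 8) (e / 8) + (e % 8 ^^^ 1))

/-- If a relator, followed from a point, returns to this point with a single unknown edge, this edge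
is correct. The relator and the point are coded in `s`. -/
def deduce (p : ℕ → ℕ → ℕ) (W : List (List ℕ)) (mask s : ℕ) : ℕ :=
  match walk p mask (W.getD (s % 16) []) (s / 16) with
  | some (d, u + 1) => if d = s / 16 then addEdge p mask u else mask
  | _ => mask

/-- A succession of deductions. The case distinction makes the kernel evaluate the mask after each of
them; a mask that is zero would stay so, but this does not occur. -/
def run (p : ℕ → ℕ → ℕ) (W : List (List ℕ)) : List ℕ → ℕ → ℕ
  | [], mask => mask
  | s :: ss, mask =>
    match mask with
    | 0 => 0
    | m + 1 => run p W ss (deduce p W (m + 1) s)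

/-- The first of the given letters that takes the point `v` to a smaller one, or zero. -/
def parent (p : ℕ → ℕ → ℕ) (v : ℕ) : List ℕ → ℕ
  | [] => 0
  | l :: ls => if p l v < v then l else parent p v ls

/-- Mark the edges from the points `1, …, n - 1` to their parents. -/
def tree (p : ℕ → ℕ → ℕ) (ls : List ℕ) : ℕ → ℕ → ℕ
  | 0, mask => mask
  | n + 1, mask => tree p ls n (if n = 0 then mask else addEdge p mask (8 * n + parent p n ls))

/-- The edges known at the end: one starts with loops at the point `0` and with the tree. -/
def final (p : ℕ → ℕ → ℕ) (W : List (List ℕ)) (ls loops : List ℕ) (n : ℕ) (steps : List ℕ) : ℕ :=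
  run p W steps (tree p ls n (loops.foldl (addEdge p) 0))

section Soundness

variable {G X : Type*} [Group G] [MulAction G X] (g : Fin 3 → G) (p : ℕ → ℕ → ℕ) (ρ : ℕ → X)
  (n k : ℕ)

/-- All marked edges are correct, when `ρ` interprets the points in a set with group action. -/
def Sound (mask : ℕ) : Prop :=
  ∀ c < n, ∀ l < k, mask.testBit (8 * c + l) = true → letter g l • ρ c = ρ (p l c)

variable {g p ρ n k}

theorem walk_spec {mask : ℕ} (h : Sound g p ρ n k mask) (hlt : ∀ v < n, ∀ l < k, p l v < n)
    (hk8 : k ≤ 8) {w : List ℕ} (hw : ∀ l ∈ w, l < k) {c d u : ℕ} (hc : c < n)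
    (e : walk p mask w c = some (d, u)) :
    d < n ∧ (u = 0 → word g w • ρ c = ρ d) ∧ ∀ f, u = f + 1 → f / 8 < n ∧ f % 8 < k ∧
      ∃ A B : G, word g w = A * letter g (f % 8) * B ∧ B • ρ c = ρ (f / 8) ∧
        A • ρ (p (f % 8) (f / 8)) = ρ d := by
  induction w generalizing d u with
  | nil =>
    simp only [walk, Option.some.injEq, Prod.mk.injEq] at e
    obtain ⟨rfl, rfl⟩ := e
    exact ⟨hc, fun _ => by simp [word_nil], fun f hf => absurd hf (by omega)⟩
  | cons l w ih =>
    have hl := hw l (List.mem_cons_self ..)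
    have ih' := @ih fun k hk => hw k (List.mem_cons_of_mem _ hk)
    rw [walk] at e
    split at e
    · exact absurd e (by simp)
    · next d' u' he =>
      obtain ⟨hd', h0, h1⟩ := ih' he
      split_ifs at e with hb hu
      · simp only [Option.some.injEq, Prod.mk.injEq] at e
        obtain ⟨rfl, rfl⟩ := e
        have hedge := h d' hd' l hl hb
        refine ⟨hlt d' hd' l hl, fun hu => ?_, fun f hf => ?_⟩
        · rw [word_cons, mul_smul, h0 hu, hedge]
        · obtain ⟨f1, f2, A, B, hAB, hB, hA⟩ := h1 f hf
          refine ⟨f1, f2, letter g l * A, B, ?_, hB, ?_⟩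
          · rw [word_cons, hAB]; simp [mul_assoc]
          · rw [mul_smul, hA, hedge]
      · simp only [Option.some.injEq, Prod.mk.injEq] at e
        obtain ⟨rfl, rfl⟩ := e
        refine ⟨hlt d' hd' l hl, fun hu => absurd hu (by omega), fun f hf => ?_⟩
        obtain rfl : f = 8 * d' + l := by omega
        have e1 : (8 * d' + l) / 8 = d' := by omega
        have e2 : (8 * d' + l) % 8 = l := by omega
        rw [e1, e2]
        exact ⟨hd', hl, 1, word g w, by rw [word_cons, one_mul], h0 hu, one_smul _ _⟩

theorem Sound.addEdge {mask : ℕ} (h : Sound g p ρ n k mask) (hk8 : k ≤ 8)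
    (hinv : ∀ v < n, ∀ l < k, p (l ^^^ 1) (p l v) = v) {f : ℕ} (h1 : f / 8 < n) (h2 : f % 8 < k)
    (hf : letter g (f % 8) • ρ (f / 8) = ρ (p (f % 8) (f / 8))) :
    Sound g p ρ n k (addEdge p mask f) := by
  intro c hc l hl hb
  have hx := xor_one_lt_eight (h2.trans_le hk8)
  rw [CosetEnumeration.addEdge, Nat.testBit_or, Nat.testBit_or, Bool.or_eq_true,
    Bool.or_eq_true] at hb
  have one : ∀ a b : ℕ, (1 <<< a).testBit b = true → a = b := by
    intro a b hab
    rw [Nat.one_shiftLeft, Nat.testBit_two_pow] at hab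
    simpa using hab
  rcases hb with (hb | hb) | hb
  · exact h c hc l hl hb
  · have := one _ _ hb
    obtain rfl : c = f / 8 := by omega
    obtain rfl : l = f % 8 := by omega
    exact hf
  · have := one _ _ hb
    obtain rfl : c = p (f % 8) (f / 8) := by omega
    obtain rfl : l = f % 8 ^^^ 1 := by omega
    rw [hinv _ h1 _ h2, letter_xor_one g (h2.trans_le hk8), ← hf, inv_smul_smul]

theorem Sound.deduce {W : List (List ℕ)} {mask : ℕ} (h : Sound g p ρ n k mask)
    (hlt : ∀ v < n, ∀ l < k, p l v < n) (hk8 : k ≤ 8)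
    (hinv : ∀ v < n, ∀ l < k, p (l ^^^ 1) (p l v) = v)
    (hW : ∀ w ∈ W, (∀ l ∈ w, l < k) ∧ word g w = 1) {s : ℕ} (hs : s / 16 < n) :
    Sound g p ρ n k (deduce p W mask s) := by
  rw [CosetEnumeration.deduce]
  have hw : (∀ l ∈ W.getD (s % 16) [], l < k) ∧ word g (W.getD (s % 16) []) = 1 := by
    rw [List.getD_eq_getElem?_getD]
    rcases hget : W[s % 16]? with _ | w
    · exact ⟨by simp, rfl⟩
    · exact hW w (List.mem_of_getElem? hget)
  split
  · next d u he =>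
    split_ifs with hd
    · obtain ⟨-, -, hu⟩ := walk_spec h hlt hk8 hw.1 hs he
      obtain ⟨f1, f2, A, B, hAB, hB, hA⟩ := hu u rfl
      refine h.addEdge hk8 hinv f1 f2 ?_
      rw [hw.2] at hAB
      have : letter g (u % 8) = A⁻¹ * B⁻¹ := by
        rw [eq_inv_mul_iff_mul_eq, eq_inv_iff_mul_eq_one]; exact hAB.symm
      rw [this, mul_smul, ← hB, inv_smul_smul, inv_smul_eq_iff, hA, hd]
    · exact h
  · exact h

theorem Sound.run {W : List (List ℕ)} (hlt : ∀ v < n, ∀ l < k, p l v < n) (hk8 : k ≤ 8)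
    (hinv : ∀ v < n, ∀ l < k, p (l ^^^ 1) (p l v) = v)
    (hW : ∀ w ∈ W, (∀ l ∈ w, l < k) ∧ word g w = 1) {steps : List ℕ}
    (hs : ∀ s ∈ steps, s / 16 < n) {mask : ℕ} (h : Sound g p ρ n k mask) :
    Sound g p ρ n k (run p W steps mask) := by
  induction steps generalizing mask with
  | nil => exact h
  | cons s ss ih =>
    rcases mask with _ | mask
    · exact h
    · exact ih (fun t ht => hs t (List.mem_cons_of_mem _ ht))
        (h.deduce hlt hk8 hinv hW (hs s (List.mem_cons_self ..)))

/-- The interpretation of the points that makes the tree edges correct by definition. -/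
noncomputable def interpret (g : Fin 3 → G) (p : ℕ → ℕ → ℕ) (ls : List ℕ) (x : X) (v : ℕ) : X :=
  if _h : p (parent p v ls) v < v then
    (letter g (parent p v ls))⁻¹ • interpret g p ls x (p (parent p v ls) v)
  else x
termination_by v

theorem interpret_zero (ls : List ℕ) (x : X) : interpret g p ls x 0 = x := by
  rw [interpret, dif_neg (by omega)]

theorem letter_smul_interpret {ls : List ℕ} {x : X} {v : ℕ} (h : p (parent p v ls) v < v) :
    letter g (parent p v ls) • interpret g p ls x v =
      interpret g p ls x (p (parent p v ls) v) := by
  rw [interpret, dif_pos h, smul_inv_smul]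

theorem Sound.tree {ls : List ℕ} {x : X} (hk8 : k ≤ 8)
    (hinv : ∀ v < n, ∀ l < k, p (l ^^^ 1) (p l v) = v)
    (hpar : ∀ v < n, v ≠ 0 → parent p v ls < k ∧ p (parent p v ls) v < v) {j : ℕ} (hj : j ≤ n)
    {mask : ℕ} (h : Sound g p (interpret g p ls x) n k mask) :
    Sound g p (interpret g p ls x) n k (tree p ls j mask) := by
  induction j generalizing mask with
  | zero => exact h
  | succ j ih =>
    rw [CosetEnumeration.tree]
    refine ih (by omega) ?_
    split_ifs with hj0
    · exact h
    · obtain ⟨h1, h2⟩ := hpar j (by omega) hj0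
      have e1 : (8 * j + parent p j ls) / 8 = j := by omega
      have e2 : (8 * j + parent p j ls) % 8 = parent p j ls := by omega
      refine h.addEdge hk8 hinv (by omega) (by omega) ?_
      rw [e1, e2]
      exact letter_smul_interpret h2

/-- Soundness of coset enumeration: the points are the images of `x` under the group that is
generated by the letters below `k`. -/
theorem exists_interpretation {W : List (List ℕ)} {ls loops steps : List ℕ} (hn : 0 < n) {x : X}
    (hk8 : k ≤ 8) (hlt : ∀ v < n, ∀ l < k, p l v < n)
    (hinv : ∀ v < n, ∀ l < k, p (l ^^^ 1) (p l v) = v)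
    (hW : ∀ w ∈ W, (∀ l ∈ w, l < k) ∧ word g w = 1) (hs : ∀ s ∈ steps, s / 16 < n)
    (hpar : ∀ v < n, v ≠ 0 → parent p v ls < k ∧ p (parent p v ls) v < v)
    (hloops : ∀ l ∈ loops, l < k ∧ p l 0 = 0) (hx : ∀ l ∈ loops, letter g l • x = x)
    (hall : ∀ c < n, ∀ l < k, (final p W ls loops n steps).testBit (8 * c + l) = true) :
    ∃ ρ : ℕ → X, ρ 0 = x ∧ ∀ c < n, ∀ l < k, letter g l • ρ c = ρ (p l c) := by
  refine ⟨interpret g p ls x, interpret_zero ls x, ?_⟩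
  have h0 : ∀ (loops : List ℕ) (mask : ℕ), (∀ l ∈ loops, l < k ∧ p l 0 = 0) →
      (∀ l ∈ loops, letter g l • x = x) → Sound g p (interpret g p ls x) n k mask →
      Sound g p (interpret g p ls x) n k (loops.foldl (addEdge p) mask) := by
    intro loops
    induction loops with
    | nil => exact fun _ _ _ h => h
    | cons l loops ih =>
      intro mask h1 h2 h
      refine ih _ (fun l hl => h1 l (List.mem_cons_of_mem _ hl))
        (fun l hl => h2 l (List.mem_cons_of_mem _ hl)) ?_
      obtain ⟨hl, hl0⟩ := h1 l (List.mem_cons_self ..)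
      have e1 : l / 8 = 0 := by omega
      have e2 : l % 8 = l := by omega
      refine h.addEdge hk8 hinv (by omega) (by omega) ?_
      rw [e1, e2, hl0, interpret_zero]
      exact h2 l (List.mem_cons_self ..)
  have hsound : Sound g p (interpret g p ls x) n k (final p W ls loops n steps) :=
    Sound.run hlt hk8 hinv hW hs (Sound.tree hk8 hinv hpar le_rfl
      (h0 loops 0 hloops hx (fun c _ l _ h => absurd h (by simp))))
  exact fun c hc l hl => hsound c hc l hl (hall c hc l hl)

/-- In the situation of `exists_interpretation`, the points exhaust the orbit. -/
theorem exists_eq_of_mem_closure {ρ : ℕ → X} (hn : 0 < n) (hlt : ∀ v < n, ∀ l < k, p l v < n)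
    (hρ : ∀ c < n, ∀ l < k, letter g l • ρ c = ρ (p l c)) {s : Set G}
    (hs : ∀ y ∈ s, ∃ l, l < k ∧ (l ^^^ 1) < k ∧ l < 8 ∧ letter g l = y) {y : G}
    (hy : y ∈ Subgroup.closure s) : ∃ v < n, y • ρ 0 = ρ v := by
  induction hy using Subgroup.closure_induction_left with
  | one => exact ⟨0, hn, one_smul _ _⟩
  | mul_left y hy z _ ih =>
    obtain ⟨v, hv, e⟩ := ih
    obtain ⟨l, hl, -, -, rfl⟩ := hs y hy
    exact ⟨p l v, hlt v hv l hl, by rw [mul_smul, e, hρ v hv l hl]⟩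
  | inv_mul_cancel y hy z _ ih =>
    obtain ⟨v, hv, e⟩ := ih
    obtain ⟨l, -, hl, hl8, rfl⟩ := hs y hy
    exact ⟨p (l ^^^ 1) v, hlt v hv _ hl, by
      rw [mul_smul, e, ← letter_xor_one g hl8, hρ v hv _ hl]⟩

end Soundness

end CosetEnumeration

/-! ### Counting with orbits -/

/-- A subgroup that meets at most `m` cosets of `C` has at most `m * |C|` elements. -/
theorem finite_and_card_le_of_cosets {G : Type*} [Group G] {A C : Subgroup G} [Finite C] {m : ℕ}
    {ρ : ℕ → G ⧸ C} (h : ∀ x ∈ A, ∃ v < m, (x : G ⧸ C) = ρ v) :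
    Finite A ∧ Nat.card A ≤ m * Nat.card C := by
  have hex : ∀ x : A, ∃ v : Fin m, ((x : G) : G ⧸ C) = ρ v := fun x => by
    obtain ⟨v, hv, e⟩ := h x x.2
    exact ⟨⟨v, hv⟩, e⟩
  choose v hv using hex
  have hmem : ∀ x : A, (ρ (v x)).out⁻¹ * (x : G) ∈ C := fun x => by
    rw [← QuotientGroup.eq, QuotientGroup.out_eq', hv]
  have hinj : Function.Injective
      (fun x : A => (v x, (⟨_, hmem x⟩ : C))) := by
    intro x y hxy
    simp only [Prod.mk.injEq, Subtype.mk.injEq] at hxy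
    obtain ⟨h1, h2⟩ := hxy
    rw [h1] at h2
    exact Subtype.ext (mul_left_cancel h2)
  refine ⟨Finite.of_injective _ hinj, (Nat.card_le_card_of_injective _ hinj).trans ?_⟩
  rw [Nat.card_prod, Nat.card_fin]

/-- If a point has at least `m` images under `A`, and `A` has at most `m * |C|` elements, where `C`
fixes the point, then equality holds, and `C` is the stabilizer. -/
theorem card_eq_and_mem_of_orbit {G : Type*} [Group G] {A C : Subgroup G} [Finite A] {n m : ℕ}
    (α : G →* Equiv.Perm (Fin n)) {x : Fin n} (hm : 0 < m) (hCA : C ≤ A)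
    (hC : ∀ c ∈ C, α c x = x) (h : ∀ v < m, ∃ a ∈ A, (α a x : ℕ) = v)
    (hA : Nat.card A ≤ m * Nat.card C) :
    Nat.card A = m * Nat.card C ∧ ∀ a ∈ A, α a x = x → a ∈ C := by
  have hex : ∀ v : Fin m, ∃ a ∈ A, (α a x : ℕ) = v := fun v => h v v.2
  choose a ha hav using hex
  have key : ∀ D : Subgroup G, D ≤ A → (∀ d ∈ D, α d x = x) →
      m * Nat.card D ≤ Nat.card A := by
    intro D hDA hD
    have hinj : Function.Injective
        (fun p : Fin m × D => (⟨a p.1 * p.2, mul_mem (ha _) (hDA p.2.2)⟩ : A)) := by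
      rintro ⟨v, c⟩ ⟨w, d⟩ hvw
      simp only [Subtype.mk.injEq] at hvw
      have e := congrArg (fun y => (α y x : ℕ)) hvw
      simp only [map_mul, Equiv.Perm.mul_apply, hD c c.2, hD d d.2, hav] at e
      obtain rfl := Fin.ext e
      exact Prod.ext rfl (Subtype.ext (mul_left_cancel hvw))
    have := Nat.card_le_card_of_injective _ hinj
    rwa [Nat.card_prod, Nat.card_fin] at this
  refine ⟨le_antisymm hA (key C hCA hC), fun b hb hbx => ?_⟩
  let D : Subgroup G := A ⊓ (MulAction.stabilizer (Equiv.Perm (Fin n)) x).comap α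
  have hDx : ∀ d ∈ D, α d x = x := fun d hd => hd.2
  have hCD : C ≤ D := fun c hc => ⟨hCA hc, hC c hc⟩
  have : Finite D := Finite.of_injective _ (Subgroup.inclusion_injective (inf_le_left : D ≤ A))
  have hcard : Nat.card D ≤ Nat.card C :=
    Nat.le_of_mul_le_mul_left ((key D inf_le_left hDx).trans hA) hm
  rw [Subgroup.eq_of_le_of_card_ge hCD hcard]
  exact ⟨hb, hbx⟩

/-! ### Groups given by generators, relators and a coset table -/

/-- The relators that are given by words. -/
def relatorSet (W : List (List ℕ)) : Set (FreeGroup (Fin 3)) :=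
  {x | ∃ w ∈ W, word FreeGroup.of w = x}

/-- The table of the action of the generators `σ₁, σ₂` on the cosets of `⟨σ₂⟩` in `⟨σ₁, σ₂⟩`, from
the table of the action of `σ₃, σ₂`: the letter `σ₁` acts as the letter `σ₃` does. -/
def innerTable (p : ℕ → ℕ → ℕ) (l v : ℕ) : ℕ := if l < 2 then p (l + 4) v else p l v

/-- A table for the action of a group, given by the relators `W` in the generators `σ₁, σ₂, σ₃`, on
the `n` cosets of `⟨σ₁, σ₂⟩`, together with everything that has to be computed from it. The first `m`
points are the orbit of the coset `0` under `⟨σ₂, σ₃⟩`, and the order of `σ₂` is `2 * (2 * r + 1)`.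
The loops at the point `0` that the enumerations start from are those of the letters in the subgroup
whose cosets are enumerated. -/
structure CosetCertificate (W : List (List ℕ)) (n m r : ℕ) extends PermTable n where
  letter_lt : ∀ w ∈ W, ∀ l ∈ w, l < 6
  cube₁_mem : [0, 0, 0] ∈ W
  pow₂_mem : List.replicate (2 * (2 * r + 1)) 2 ∈ W
  cube₃_mem : [4, 4, 4] ∈ W
  sq₁₂_mem : [0, 2, 0, 2] ∈ W
  sq₂₃_mem : [2, 4, 2, 4] ∈ W
  sq₁₂₃_mem : [0, 2, 4, 0, 2, 4] ∈ W
  r_pos : 0 < r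
  m_pos : 0 < m
  m_le : m ≤ n
  act_relator : ∀ w ∈ W, ∀ v < n, act p w v = v
  /-- The relators also hold after the twist by the duality. -/
  act_twist : ∀ w ∈ W, ∀ v < n, act p (twistWord w) v = v
  fix_zero : ∀ l < 4, p l 0 = 0
  move_zero : p 4 0 ≠ 0
  orbit_lt : ∀ v < m, ∀ l < 6, 2 ≤ l → p l v < m
  order : ∀ k < 2 * (2 * r + 1), k ≠ 0 → ∃ v < n, act p (List.replicate k 2) v ≠ v
  /-- Some relator fails for the mirror images of the generators. -/
  irreflexible : ∃ w ∈ W, ∃ v < n, act p (reflectWord w) v ≠ v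
  parent : ∀ v < n, v ≠ 0 → CosetEnumeration.parent p v [0, 1, 2, 3, 4, 5] < 6 ∧
    p (CosetEnumeration.parent p v [0, 1, 2, 3, 4, 5]) v < v
  innerParent : ∀ v < m, v ≠ 0 → CosetEnumeration.parent (innerTable p) v [0, 1, 2, 3] < 4 ∧
    innerTable p (CosetEnumeration.parent (innerTable p) v [0, 1, 2, 3]) v < v
  /-- The deductions that enumerate the cosets of `⟨σ₁, σ₂⟩` in the group. -/
  steps : List ℕ
  steps_lt : ∀ s ∈ steps, s / 16 < n
  complete : ∀ c < n, ∀ l < 6,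
    (CosetEnumeration.final p W [0, 1, 2, 3, 4, 5] [0, 1, 2, 3] n steps).testBit (8 * c + l) = true
  /-- The deductions that enumerate the cosets of `⟨σ₂⟩` in `⟨σ₁, σ₂⟩`. -/
  innerSteps : List ℕ
  innerSteps_lt : ∀ s ∈ innerSteps, s / 16 < m
  innerComplete : ∀ c < m, ∀ l < 4,
    (CosetEnumeration.final (innerTable p) (W.filter fun w => w.all (· < 4)) [0, 1, 2, 3] [2, 3] m
      innerSteps).testBit (8 * c + l) = true
  /-- For each nonzero fixed point of `σ₂ ^ (2 * r + 1)`, a word that takes the point `0` to it. -/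
  fixedWords : List (List ℕ)
  fixedWords_lt : ∀ w ∈ fixedWords, ∀ l ∈ w, l < 6
  /-- Only the base facet is incident with its image under the duality of order four among the powers
  of the distinguished duality. The square of this duality is `σ₂ ^ (2 * r + 1)`, so that only the
  fixed points of this element are considered; the facets incident with the base vertex are the
  points below `m`. -/
  fixed : ∀ v < n, v ≠ 0 → act p (List.replicate (2 * r + 1) 2) v = v → ∃ w ∈ fixedWords,
    act p w 0 = v ∧ m ≤ act p (invWord (twistWord w) ++ List.replicate r 3 ++ w) 0

namespace CosetCertificate

open CosetEnumeration

variable {W : List (List ℕ)} {n m r : ℕ} (C : CosetCertificate W n m r)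

/-- The generators of the group. -/
abbrev gen (W : List (List ℕ)) (i : Fin 3) : PresentedGroup (relatorSet W) := PresentedGroup.of i

theorem word_gen {w : List ℕ} (hw : w ∈ W) : word (gen W) w = 1 := by
  have h := map_word FreeGroup.of (PresentedGroup.mk (relatorSet W)) w
  exact h.symm.trans (PresentedGroup.one_of_mem ⟨w, hw, rfl⟩)

/-- The homomorphism that is determined by elements satisfying the relations. -/
def lift {M : Type*} [Group M] (g : Fin 3 → M) (h : ∀ w ∈ W, word g w = 1) :
    PresentedGroup (relatorSet W) →* M :=
  PresentedGroup.toGroup (f := g) (by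
    rintro _ ⟨w, hw, rfl⟩
    rw [map_word]
    simpa using h w hw)

theorem lift_gen {M : Type*} [Group M] (g : Fin 3 → M) (h : ∀ w ∈ W, word g w = 1) (i : Fin 3) :
    lift g h (gen W i) = g i := PresentedGroup.toGroup.of _

theorem lift_word {M : Type*} [Group M] (g : Fin 3 → M) (h : ∀ w ∈ W, word g w = 1)
    (w : List ℕ) : lift g h (word (gen W) w) = word g w := by
  rw [map_word]
  exact congrArg (fun f => word f w) (funext (lift_gen g h))

/-- The action of the group on the cosets of `⟨σ₁, σ₂⟩`. -/
def α : PresentedGroup (relatorSet W) →* Equiv.Perm (Fin n) :=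
  lift C.perm fun w hw => C.word_perm_eq_one (C.letter_lt w hw) (C.act_relator w hw)

/-- The action of the group on the cosets of `⟨σ₁, σ₂⟩`, twisted by the duality. -/
def β : PresentedGroup (relatorSet W) →* Equiv.Perm (Fin n) :=
  lift (twistGen C.perm) fun w hw => by
    rw [← word_twistWord]
    exact C.word_perm_eq_one (twistWord_lt w) (C.act_twist w hw)

theorem α_word {w : List ℕ} (hw : ∀ l ∈ w, l < 6) (v : Fin n) :
    (C.α (word (gen W) w) v : ℕ) = act C.p w v := by
  rw [α, lift_word, C.word_perm hw]

theorem α_gen (i : Fin 3) : C.α (gen W i) = C.perm i := lift_gen _ _ i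

theorem α_letter {l : ℕ} (hl : l < 6) (v : Fin n) : (C.α (letter (gen W) l) v : ℕ) = C.p l v := by
  rw [map_letter, ← C.letter_perm hl v]
  exact congrArg (fun f : Fin 3 → Equiv.Perm (Fin n) => (letter f l v : ℕ)) (funext C.α_gen)

theorem β_gen (i : Fin 3) : C.β (gen W i) = twistGen C.perm i := lift_gen _ _ i

theorem n_pos (C : CosetCertificate W n m r) : 0 < n := C.m_pos.trans_le C.m_le

/-- The base point: the coset `⟨σ₁, σ₂⟩`. -/
def zero : Fin n := ⟨0, C.n_pos⟩

theorem zero_val : (C.zero : ℕ) = 0 := rfl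

theorem perm_zero_zero : C.perm 0 C.zero = C.zero := Fin.ext (C.fix_zero 0 (by omega))

theorem perm_one_zero : C.perm 1 C.zero = C.zero := Fin.ext (C.fix_zero 2 (by omega))

theorem perm_two_zero_ne : C.perm 2 C.zero ≠ C.zero := fun h => C.move_zero (congrArg Fin.val h)

variable (W) in
/-- The stabilizer of the base facet. -/
abbrev facet : Subgroup (PresentedGroup (relatorSet W)) := Subgroup.closure {gen W 0, gen W 1}

variable (W) in
/-- The stabilizer of the base vertex. -/
abbrev vertex : Subgroup (PresentedGroup (relatorSet W)) := Subgroup.closure {gen W 1, gen W 2}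

variable (W) in
/-- The subgroup generated by `σ₂`. -/
abbrev cyc : Subgroup (PresentedGroup (relatorSet W)) := Subgroup.zpowers (gen W 1)

theorem cyc_le_facet : cyc W ≤ facet W :=
  Subgroup.zpowers_le.2 (Subgroup.subset_closure (by simp))

theorem α_facet {x : PresentedGroup (relatorSet W)} (hx : x ∈ facet W) :
    C.α x C.zero = C.zero := by
  suffices h : facet W ≤ (MulAction.stabilizer (Equiv.Perm (Fin n)) C.zero).comap C.α from h hx
  refine (Subgroup.closure_le _).2 ?_
  rintro x (rfl | rfl)
  · exact (congrArg (· C.zero) (C.α_gen 0)).trans C.perm_zero_zero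
  · exact (congrArg (· C.zero) (C.α_gen 1)).trans C.perm_one_zero

theorem β_vertex {x : PresentedGroup (relatorSet W)} (hx : x ∈ vertex W) :
    C.β x C.zero = C.zero := by
  suffices h : vertex W ≤ (MulAction.stabilizer (Equiv.Perm (Fin n)) C.zero).comap C.β from h hx
  refine (Subgroup.closure_le _).2 ?_
  rintro x (rfl | rfl)
  · exact (congrArg (· C.zero) (C.β_gen 1)).trans C.perm_one_zero
  · exact (congrArg (· C.zero) (C.β_gen 2)).trans C.perm_zero_zero

theorem β_cyc {x : PresentedGroup (relatorSet W)} (hx : x ∈ cyc W) : C.β x C.zero = C.zero :=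
  C.β_vertex (Subgroup.zpowers_le.2 (Subgroup.subset_closure (by simp)) hx)

theorem α_vertex_lt {x : PresentedGroup (relatorSet W)} (hx : x ∈ vertex W) :
    (C.α x C.zero : ℕ) < m := by
  have key : ∀ (l : ℕ) (v : Fin n), l < 6 → 2 ≤ l → (v : ℕ) < m →
      (C.α (letter (gen W) l) v : ℕ) < m := fun l v hl hl2 hv => by
    rw [C.α_letter hl]
    exact C.orbit_lt v hv l hl hl2
  induction hx using Subgroup.closure_induction_left with
  | one =>
    rw [map_one]
    exact C.m_pos
  | mul_left x hx y _ ih =>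
    rw [map_mul]
    rcases hx with rfl | rfl
    · exact key 2 _ (by omega) (by omega) ih
    · exact key 4 _ (by omega) (by omega) ih
  | inv_mul_cancel x hx y _ ih =>
    rw [map_mul]
    rcases hx with rfl | rfl
    · exact key 3 _ (by omega) (by omega) ih
    · exact key 5 _ (by omega) (by omega) ih

theorem gen_one_pow (C : CosetCertificate W n m r) : gen W 1 ^ (2 * (2 * r + 1)) = 1 := by
  have := word_gen C.pow₂_mem
  rwa [word_replicate] at this

theorem α_gen_one_pow_ne {k : ℕ} (hk : k < 2 * (2 * r + 1)) (hk0 : k ≠ 0) :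
    C.α (gen W 1 ^ k) ≠ 1 := by
  obtain ⟨v, hv, h⟩ := C.order k hk hk0
  intro e
  have hlt : ∀ l ∈ List.replicate k 2, l < 6 := by
    intro l hl
    rw [List.eq_of_mem_replicate hl]
    omega
  have := C.α_word hlt ⟨v, hv⟩
  rw [word_replicate] at this
  rw [show letter (gen W) 2 = gen W 1 from rfl, e] at this
  exact h this.symm

theorem orderOf_gen_one (C : CosetCertificate W n m r) : orderOf (gen W 1) = 2 * (2 * r + 1) :=
  (orderOf_eq_iff (by omega)).2 ⟨C.gen_one_pow, fun k hk hk0 h =>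
    C.α_gen_one_pow_ne hk hk0.ne' (by rw [h, map_one])⟩

theorem card_cyc (C : CosetCertificate W n m r) : Nat.card (cyc W) = 2 * (2 * r + 1) := by
  rw [Nat.card_zpowers, C.orderOf_gen_one]

theorem finite_cyc (C : CosetCertificate W n m r) : Finite (cyc W) :=
  Nat.finite_of_card_ne_zero (by rw [C.card_cyc]; omega)

theorem innerTable_lt : ∀ v < m, ∀ l < 4, innerTable C.p l v < m := by
  intro v hv l hl
  unfold innerTable
  split_ifs
  · exact C.orbit_lt v hv _ (by omega) (by omega)
  · exact C.orbit_lt v hv _ (by omega) (by omega)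

theorem innerTable_inv : ∀ v < m, ∀ l < 4, innerTable C.p (l ^^^ 1) (innerTable C.p l v) = v := by
  intro v hv l hl
  have h := C.inv v (hv.trans_le C.m_le)
  interval_cases l
  exacts [h 4 (by omega), h 5 (by omega), h 2 (by omega), h 3 (by omega)]

/-- The inner enumeration bounds the order of `⟨σ₁, σ₂⟩` from above. -/
theorem card_facet_le (C : CosetCertificate W n m r) : Finite (facet W) ∧ Nat.card (facet W) ≤ m * Nat.card (cyc W) := by
  have := C.finite_cyc
  have hcyc : gen W 1 • ((1 : PresentedGroup (relatorSet W)) : _ ⧸ cyc W) =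
      ((1 : PresentedGroup (relatorSet W)) : _ ⧸ cyc W) := by
    rw [MulAction.Quotient.smul_mk, smul_eq_mul, mul_one, eq_comm, QuotientGroup.eq]
    simp
  obtain ⟨ρ, h0, hρ⟩ := exists_interpretation (g := gen W) (p := innerTable C.p) (n := m) (k := 4)
    (W := W.filter fun w => w.all (· < 4)) (ls := [0, 1, 2, 3]) (loops := [2, 3])
    (steps := C.innerSteps) (x := ((1 : PresentedGroup (relatorSet W)) : _ ⧸ cyc W))
    C.m_pos (by omega) C.innerTable_lt C.innerTable_inv
    (by
      intro w hw
      rw [List.mem_filter] at hw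
      exact ⟨fun l hl => by simpa using List.all_eq_true.1 hw.2 l hl, word_gen hw.1⟩)
    C.innerSteps_lt C.innerParent
    (by
      intro l hl
      simp only [List.mem_cons, List.not_mem_nil, or_false] at hl
      rcases hl with rfl | rfl
      exacts [⟨by omega, C.fix_zero 2 (by omega)⟩, ⟨by omega, C.fix_zero 3 (by omega)⟩])
    (by
      intro l hl
      simp only [List.mem_cons, List.not_mem_nil, or_false] at hl
      rcases hl with rfl | rfl
      exacts [hcyc, inv_smul_eq_iff.2 hcyc.symm])
    C.innerComplete
  refine finite_and_card_le_of_cosets (ρ := ρ) fun x hx => ?_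
  obtain ⟨v, hv, e⟩ := exists_eq_of_mem_closure C.m_pos C.innerTable_lt hρ (s := {gen W 0, gen W 1})
    (by
      rintro y (rfl | rfl)
      exacts [⟨0, by decide, by decide, by decide, rfl⟩, ⟨2, by decide, by decide, by decide, rfl⟩])
    hx
  refine ⟨v, hv, ?_⟩
  rw [← e, h0, MulAction.Quotient.smul_mk, smul_eq_mul, mul_one]

theorem closure_gen (W : List (List ℕ)) : Subgroup.closure {gen W 0, gen W 1, gen W 2} = ⊤ := by
  refine eq_top_iff.2 fun x _ => PresentedGroup.generated_by _ _ (fun j => ?_) x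
  refine Subgroup.subset_closure ?_
  obtain rfl | rfl | rfl : j = 0 ∨ j = 1 ∨ j = 2 := by omega
  all_goals simp [gen]

/-- The outer enumeration bounds the order of the group from above. -/
theorem card_le (C : CosetCertificate W n m r) : Finite (PresentedGroup (relatorSet W)) ∧
    Nat.card (PresentedGroup (relatorSet W)) ≤ n * Nat.card (facet W) := by
  have := C.card_facet_le.1
  have hfix : ∀ x ∈ facet W, x • ((1 : PresentedGroup (relatorSet W)) : _ ⧸ facet W) =
      ((1 : PresentedGroup (relatorSet W)) : _ ⧸ facet W) := by
    intro x hx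
    rw [MulAction.Quotient.smul_mk, smul_eq_mul, mul_one, eq_comm, QuotientGroup.eq]
    simpa using hx
  have h0 : gen W 0 ∈ facet W := Subgroup.subset_closure (by simp)
  have h1 : gen W 1 ∈ facet W := Subgroup.subset_closure (by simp)
  obtain ⟨ρ, h0, hρ⟩ := exists_interpretation (g := gen W) (p := C.p) (n := n) (k := 6)
    (W := W) (ls := [0, 1, 2, 3, 4, 5]) (loops := [0, 1, 2, 3])
    (steps := C.steps) (x := ((1 : PresentedGroup (relatorSet W)) : _ ⧸ facet W))
    C.n_pos (by omega) C.lt C.inv (fun w hw => ⟨C.letter_lt w hw, word_gen hw⟩)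
    C.steps_lt C.parent
    (by
      intro l hl
      simp only [List.mem_cons, List.not_mem_nil, or_false] at hl
      exact ⟨by omega, C.fix_zero l (by omega)⟩)
    (by
      intro l hl
      simp only [List.mem_cons, List.not_mem_nil, or_false] at hl
      rcases hl with rfl | rfl | rfl | rfl
      exacts [hfix _ h0, hfix _ (inv_mem h0), hfix _ h1, hfix _ (inv_mem h1)])
    C.complete
  have key := finite_and_card_le_of_cosets (A := ⊤) (C := facet W) (m := n) (ρ := ρ) fun x hx => by
    rw [← closure_gen W] at hx
    obtain ⟨v, hv, e⟩ := exists_eq_of_mem_closure C.n_pos C.lt hρ (s := {gen W 0, gen W 1, gen W 2})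
      (by
        rintro y (rfl | rfl | rfl)
        exacts [⟨0, by decide, by decide, by decide, rfl⟩,
          ⟨2, by decide, by decide, by decide, rfl⟩, ⟨4, by decide, by decide, by decide, rfl⟩])
      hx
    refine ⟨v, hv, ?_⟩
    rw [← e, h0, MulAction.Quotient.smul_mk, smul_eq_mul, mul_one]
  rw [Subgroup.card_top] at key
  have := key.1
  exact ⟨Finite.of_equiv _ (Subgroup.topEquiv (G := PresentedGroup (relatorSet W))).toEquiv, key.2⟩

theorem finite (C : CosetCertificate W n m r) : Finite (PresentedGroup (relatorSet W)) := C.card_le.1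

theorem exists_α_eq {v : ℕ} (hv : v < n) : ∃ a, (C.α a C.zero : ℕ) = v := by
  induction v using Nat.strong_induction_on with
  | _ v ih =>
    by_cases h0 : v = 0
    · exact ⟨1, by rw [map_one, h0]; rfl⟩
    obtain ⟨hl, hlt⟩ := C.parent v hv h0
    set l := CosetEnumeration.parent C.p v [0, 1, 2, 3, 4, 5]
    obtain ⟨a, ha⟩ := ih _ hlt (hlt.trans hv)
    refine ⟨letter (gen W) (l ^^^ 1) * a, ?_⟩
    rw [map_mul, Equiv.Perm.mul_apply, C.α_letter (xor_one_lt_six hl), ha, C.inv v hv l hl]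

theorem exists_β_eq {v : ℕ} (hv : v < m) : ∃ a ∈ facet W, (C.β a C.zero : ℕ) = v := by
  induction v using Nat.strong_induction_on with
  | _ v ih =>
    by_cases h0 : v = 0
    · exact ⟨1, one_mem _, by rw [map_one, h0]; rfl⟩
    obtain ⟨hl, hlt⟩ := C.innerParent v hv h0
    set l := CosetEnumeration.parent (innerTable C.p) v [0, 1, 2, 3]
    obtain ⟨a, ha, hav⟩ := ih _ hlt (hlt.trans hv)
    -- elements of the facet group that act in the twisted action as the letters of the inner table
    have key : ∀ l < 4, ∃ b ∈ facet W, ∀ x : Fin n, (C.β b x : ℕ) = innerTable C.p l x := by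
      have h0 : gen W 0 ∈ facet W := Subgroup.subset_closure (by simp)
      have h1 : gen W 1 ∈ facet W := Subgroup.subset_closure (by simp)
      have e0 : C.β ((gen W 1)⁻¹ * gen W 0 * gen W 1) = C.perm 2 := by
        simp only [map_mul, map_inv, β_gen, twistGen, Matrix.cons_val_zero, Matrix.cons_val_one]
        group
      have e1 : C.β (gen W 1) = C.perm 1 := C.β_gen 1
      intro l hl
      interval_cases l
      · exact ⟨_, mul_mem (mul_mem (inv_mem h1) h0) h1, fun x => by rw [e0]; rfl⟩
      · exact ⟨_, inv_mem (mul_mem (mul_mem (inv_mem h1) h0) h1), fun x => by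
          rw [map_inv, e0]; rfl⟩
      · exact ⟨_, h1, fun x => by rw [e1]; rfl⟩
      · exact ⟨_, inv_mem h1, fun x => by rw [map_inv, e1]; rfl⟩
    obtain ⟨b, hb, hbx⟩ := key (l ^^^ 1) (by
      clear_value l
      interval_cases l <;> decide)
    refine ⟨b * a, mul_mem hb ha, ?_⟩
    rw [map_mul, Equiv.Perm.mul_apply, hbx, hav, C.innerTable_inv v hv l hl]

/-- As the group is transitive on the points, the upper bound for its order is attained, and
`⟨σ₁, σ₂⟩` is the full stabilizer of the base point. -/
theorem card_eq : Nat.card (PresentedGroup (relatorSet W)) = n * Nat.card (facet W) ∧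
    ∀ x, C.α x C.zero = C.zero → x ∈ facet W := by
  have := C.finite
  have h := card_eq_and_mem_of_orbit (A := ⊤) (C := facet W) C.α C.n_pos le_top
    (fun c hc => C.α_facet hc) (fun v hv => by
      obtain ⟨a, ha⟩ := C.exists_α_eq hv
      exact ⟨a, trivial, ha⟩)
    (by rw [Subgroup.card_top]; exact C.card_le.2)
  rw [Subgroup.card_top] at h
  exact ⟨h.1, fun x hx => h.2 x trivial hx⟩

/-- Under the twisted action, `⟨σ₁, σ₂⟩` takes the base point to the first `m` points, so that the
upper bound for its order is attained; this also gives the intersection property. -/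
theorem card_facet_eq : Nat.card (facet W) = m * Nat.card (cyc W) ∧
    ∀ x ∈ facet W, C.β x C.zero = C.zero → x ∈ cyc W := by
  have := C.card_facet_le.1
  exact card_eq_and_mem_of_orbit C.β C.m_pos cyc_le_facet
    (fun c hc => C.β_cyc hc) (fun v hv => C.exists_β_eq hv) C.card_facet_le.2

/-- The action on the cosets and the twisted action are jointly faithful. -/
theorem eq_one_of_α_of_β {x : PresentedGroup (relatorSet W)} (hα : C.α x = 1) (hβ : C.β x = 1) :
    x = 1 := by
  have hx : x ∈ cyc W := C.card_facet_eq.2 x (C.card_eq.2 x (by rw [hα]; rfl)) (by rw [hβ]; rfl)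
  have := C.finite
  obtain ⟨k, rfl⟩ := (mem_powers_iff_mem_zpowers.2 hx : x ∈ Submonoid.powers (gen W 1))
  simp only at hα ⊢
  rw [← pow_mod_orderOf, C.orderOf_gen_one] at hα ⊢
  by_contra hne
  have hk : k % (2 * (2 * r + 1)) < 2 * (2 * r + 1) := Nat.mod_lt _ (by omega)
  exact C.α_gen_one_pow_ne hk (fun h => hne (by rw [h, pow_zero])) hα

/-- The rotation system of the polytope. -/
def rotationSystem : RotationSystem (PresentedGroup (relatorSet W)) (2 * (2 * r + 1)) where
  s₁ := gen W 0
  s₂ := gen W 1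
  s₃ := gen W 2
  cube₁ := by
    have := word_gen C.cube₁_mem
    simpa [word, letter, pow_succ, mul_assoc] using this
  cube₃ := by
    have := word_gen C.cube₃_mem
    simpa [word, letter, pow_succ, mul_assoc] using this
  sq₁₂ := by
    have := word_gen C.sq₁₂_mem
    simpa [word, letter, mul_assoc] using this
  sq₂₃ := by
    have := word_gen C.sq₂₃_mem
    simpa [word, letter, mul_assoc] using this
  sq₁₂₃ := by
    have := word_gen C.sq₁₂₃_mem
    simpa [word, letter, mul_assoc] using this
  order₂ := C.orderOf_gen_one
  three_lt := by have := C.r_pos; omega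
  closure_eq_top := closure_gen W
  inter x hx hx' := C.card_facet_eq.2 x hx' (C.β_vertex hx)
  not_mem₁ h := by
    have e := C.β_vertex h
    rw [C.β_gen 0] at e
    have h1 : (C.perm 1)⁻¹ C.zero = C.zero := by
      rw [Equiv.Perm.inv_eq_iff_eq, C.perm_one_zero]
    simp only [twistGen, Matrix.cons_val_zero, Equiv.Perm.mul_apply, h1] at e
    exact C.perm_two_zero_ne ((C.perm 1).injective (e.trans C.perm_one_zero.symm))
  not_mem₃ h := by
    have e := C.α_facet h
    rw [C.α_gen 2] at e
    exact C.perm_two_zero_ne e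

theorem twistGen_twistGen {M : Type*} [Group M] (g : Fin 3 → M) :
    twistGen (twistGen g) = fun i => MulAut.conj (g 1) (g i) := by
  funext i
  obtain rfl | rfl | rfl : i = 0 ∨ i = 1 ∨ i = 2 := by omega
  all_goals simp [twistGen]

theorem word_twistGen (C : CosetCertificate W n m r) {w : List ℕ} (hw : w ∈ W) : word (twistGen (gen W)) w = 1 := by
  rw [← word_twistWord]
  refine C.eq_one_of_α_of_β ?_ ?_
  · rw [α, lift_word]
    exact C.word_perm_eq_one (twistWord_lt w) (C.act_twist w hw)
  · rw [β, lift_word, word_twistWord, twistGen_twistGen]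
    have h := map_word C.perm (MulAut.conj (C.perm 1)).toMonoidHom w
    exact h.symm.trans (by
      rw [C.word_perm_eq_one (C.letter_lt w hw) (C.act_relator w hw), map_one])

/-- The relators are invariant under the twist by the duality. -/
def twist : C.rotationSystem.Twist where
  e := lift (twistGen (gen W)) fun _ hw => C.word_twistGen hw
  map₁ := lift_gen _ _ 0
  map₂ := lift_gen _ _ 1
  map₃ := lift_gen _ _ 2

theorem rotationSystem_irreflexible : C.rotationSystem.Irreflexible := by
  obtain ⟨w, hw, v, hv, h⟩ := C.irreflexible
  refine ⟨word FreeGroup.of w, ?_, fun e => h ?_⟩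
  · rw [map_word]
    refine Eq.trans ?_ (word_gen hw)
    congr 1
    funext i
    obtain rfl | rfl | rfl : i = 0 ∨ i = 1 ∨ i = 2 := by omega
    all_goals simp [rotationSystem]
  · rw [map_word] at e
    have e' : word (gen W) (reflectWord w) = 1 := by
      rw [word_reflectWord]
      refine Eq.trans ?_ e
      congr 1
      funext i
      obtain rfl | rfl | rfl : i = 0 ∨ i = 1 ∨ i = 2 := by omega
      all_goals simp [rotationSystem, reflectGen]
    rw [← C.α_word (reflectWord_lt w) ⟨v, hv⟩, e', map_one]
    rfl

theorem card_vertex (C : CosetCertificate W n m r) : Nat.card (vertex W) = Nat.card (facet W) := by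
  have hinj : Function.Injective C.twist.e := by
    intro x y hxy
    have := congrArg C.twist.e hxy
    rwa [C.twist.map_map, C.twist.map_map, mul_left_inj, mul_right_inj] at this
  have hmap : (vertex W).map C.twist.e = facet W := by
    rw [MonoidHom.map_closure, Set.image_pair, Set.pair_comm]
    congr 2
  rw [← hmap]
  exact Nat.card_congr ((vertex W).equivMapOfInjective _ hinj).toEquiv

theorem twist_facet_le {x : PresentedGroup (relatorSet W)} (hx : x ∈ facet W) :
    C.twist.e x ∈ vertex W := by
  have h1 : gen W 1 ∈ vertex W := Subgroup.subset_closure (by simp)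
  have h2 : gen W 2 ∈ vertex W := Subgroup.subset_closure (by simp)
  suffices h : facet W ≤ (vertex W).comap C.twist.e from h hx
  refine (Subgroup.closure_le _).2 ?_
  rintro x (rfl | rfl)
  · have e : C.twist.e (gen W 0) = gen W 1 * gen W 2 * (gen W 1)⁻¹ := C.twist.map₁
    change C.twist.e (gen W 0) ∈ vertex W
    rw [e]
    exact mul_mem (mul_mem h1 h2) (inv_mem h1)
  · have e : C.twist.e (gen W 1) = gen W 1 := C.twist.map₂
    change C.twist.e (gen W 1) ∈ vertex W
    rw [e]
    exact h1

/-- Only the base pair of a vertex and an incident facet is interchanged by the duality of order four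
among the powers of the distinguished duality. -/
theorem mem_cyc_of_conj_mem (y : PresentedGroup (relatorSet W))
    (hy : y⁻¹ * gen W 1 ^ r * C.twist.e y ∈ cyc W) : y ∈ cyc W := by
  have hmap₁ : C.twist.e (gen W 1) = gen W 1 := C.twist.map₂
  obtain ⟨j, hj⟩ := hy
  simp only at hj
  have hey : C.twist.e y = (gen W 1 ^ r)⁻¹ * y * gen W 1 ^ j := by rw [hj]; group
  -- the second power of the twist is conjugation with `σ₂`
  have hcomm : gen W 1 ^ (2 * r + 1) * y = y * gen W 1 ^ (2 * j + 1) := by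
    have h1 := C.twist.map_map y
    rw [hey, map_mul, map_mul, map_inv, map_pow, map_zpow, hmap₁, hey] at h1
    have h2 : (gen W 1 ^ r)⁻¹ * ((gen W 1 ^ r)⁻¹ * y * gen W 1 ^ j) * gen W 1 ^ j =
      gen W 1 * y * (gen W 1)⁻¹ := h1
    calc gen W 1 ^ (2 * r + 1) * y
        = gen W 1 ^ r * gen W 1 ^ r * (gen W 1 * y * (gen W 1)⁻¹) * gen W 1 := by
          rw [show 2 * r + 1 = r + r + 1 by omega, pow_add, pow_add]; group
      _ = y * gen W 1 ^ (2 * j + 1) := by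
          rw [← h2, show 2 * j + 1 = j + j + 1 by omega, zpow_add, zpow_add]; group
  have hcycz : ∀ k : ℤ, C.α (gen W 1 ^ k) C.zero = C.zero := fun k =>
    C.α_facet (cyc_le_facet ⟨k, rfl⟩)
  have hfix : act C.p (List.replicate (2 * r + 1) 2) (C.α y C.zero) = C.α y C.zero := by
    rw [← C.α_word fun l hl => by rw [List.eq_of_mem_replicate hl]; omega, word_replicate]
    change ((C.α (gen W 1 ^ (2 * r + 1))) (C.α y C.zero) : ℕ) = _
    rw [← Equiv.Perm.mul_apply, ← map_mul, hcomm, map_mul, Equiv.Perm.mul_apply, hcycz]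
  by_cases h0 : (C.α y C.zero : ℕ) = 0
  · have hyf : y ∈ facet W := C.card_eq.2 y (Fin.ext h0)
    have h1 : C.twist.e y ∈ cyc W := by
      refine C.rotationSystem.inter _ (twist_facet_le C hyf) ?_
      rw [hey]
      exact mul_mem (mul_mem (inv_mem (cyc_le_facet (Subgroup.npow_mem_zpowers _ _))) hyf)
        (cyc_le_facet ⟨j, rfl⟩)
    have h2 : y = gen W 1 ^ r * C.twist.e y * (gen W 1 ^ j)⁻¹ := by rw [hey]; group
    rw [h2]
    exact mul_mem (mul_mem (Subgroup.npow_mem_zpowers _ _) h1) (inv_mem ⟨j, rfl⟩)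
  · exfalso
    obtain ⟨w, hw, hw0, hwm⟩ := C.fixed _ (C.α y C.zero).2 h0 hfix
    have hwlt := C.fixedWords_lt w hw
    set x := word (gen W) w with hx
    have hxy : x⁻¹ * y ∈ facet W := by
      refine C.card_eq.2 _ ?_
      rw [map_mul, map_inv, Equiv.Perm.mul_apply, Equiv.Perm.inv_eq_iff_eq]
      exact Fin.ext (hw0.symm.trans (C.α_word hwlt C.zero).symm)
    have hex : word (gen W) (twistWord w) = C.twist.e x := by
      rw [word_twistWord]
      exact (lift_word _ (fun _ hw => C.word_twistGen hw) _).symm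
    have hval : word (gen W) (invWord (twistWord w) ++ List.replicate r 3 ++ w) =
        C.twist.e (x⁻¹ * y) * (gen W 1 ^ (-j) * (x⁻¹ * y)⁻¹) := by
      rw [word_append, word_append, word_invWord _ (twistWord_lt w), hex, word_replicate,
        map_mul, map_inv, hey, ← hx]
      change (C.twist.e x)⁻¹ * ((gen W 1)⁻¹) ^ r * x = _
      group
    refine absurd hwm (not_le.2 ?_)
    rw [← C.zero_val, ← C.α_word (fun l hl => ?_) C.zero, hval, map_mul, Equiv.Perm.mul_apply,
      C.α_facet (mul_mem (cyc_le_facet ⟨-j, rfl⟩) (inv_mem hxy))]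
    · exact C.α_vertex_lt (twist_facet_le C hxy)
    · rw [List.mem_append, List.mem_append] at hl
      rcases hl with (hl | hl) | hl
      · obtain ⟨k, hk, rfl⟩ := List.mem_map.1 (List.mem_reverse.1 hl)
        exact xor_one_lt_six (twistWord_lt w k hk)
      · rw [List.eq_of_mem_replicate hl]
        omega
      · exact hwlt l hl

/-- All properties of the polytope that follow from the certificate. -/
theorem exists_polytope (C : CosetCertificate W n m r) {rels : Set (FreeGroup (Fin 3))} (hrels : relatorSet W = rels) :
    ∃ P : AbstractPolytope 4,
      Finite P.Face ∧
      P.HasSchlafliType ![3, 2 * (2 * r + 1), 3] ∧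
      P.IsChiral ∧
      P.IsImproperlySelfDual ∧
      (∀ δ, P.IsDuality δ → ∀ Φ, ¬ P.KeepsOrbit δ Φ) ∧
      Nat.card P.Aut = n * (m * (2 * (2 * r + 1))) ∧
      P.HasRotationPresentation rels ∧
      (P.numFaces 0 = n ∧ 6 * P.numFaces 1 = n * (m * (2 * (2 * r + 1))) ∧
        6 * P.numFaces 2 = n * (m * (2 * (2 * r + 1))) ∧ P.numFaces 3 = n) ∧
      {δ | P.IsDuality δ}.ncard = n * (m * (2 * (2 * r + 1))) ∧
      ∀ k, P.numDualities k = n * m * ((Finset.range (2 * (2 * r + 1))).filter fun i =>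
        2 * (2 * (2 * r + 1)) / (2 * (2 * (2 * r + 1))).gcd (2 * i + 1) = k).card := by
  subst hrels
  have := C.finite
  have hS := C.rotationSystem_irreflexible
  have hf : Nat.card (facet W) = m * (2 * (2 * r + 1)) := by rw [C.card_facet_eq.1, C.card_cyc]
  have hG : Nat.card (PresentedGroup (relatorSet W)) = n * (m * (2 * (2 * r + 1))) := by
    rw [C.card_eq.1, hf]
  have hpos : 0 < m * (2 * (2 * r + 1)) := Nat.mul_pos C.m_pos (by omega)
  have hindex : ∀ H : Subgroup (PresentedGroup (relatorSet W)),
      Nat.card H * H.index = n * (m * (2 * (2 * r + 1))) := fun H => by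
    rw [H.card_mul_index, hG]
  refine ⟨C.rotationSystem.polytope, inferInstance, C.rotationSystem.hasSchlafliType,
    C.rotationSystem.isChiral hS, C.twist.isImproperlySelfDual hS,
    fun δ hδ Φ => C.twist.not_keepsOrbit hS hδ Φ, (C.rotationSystem.card_aut hS).trans hG,
    C.rotationSystem.hasRotationPresentation hS (MulEquiv.refl _) ?_, ⟨?_, ?_, ?_, ?_⟩,
    (C.twist.ncard_isDuality hS).trans hG, fun k => ?_⟩
  · intro i
    obtain rfl | rfl | rfl : i = 0 ∨ i = 1 ∨ i = 2 := by omega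
    all_goals rfl
  · rw [C.rotationSystem.numFaces_eq 1 0 (by simp)]
    have := hindex (vertex W)
    rw [C.card_vertex, hf, mul_comm n] at this
    exact Nat.eq_of_mul_eq_mul_left hpos this
  · rw [C.rotationSystem.numFaces_eq 2 1 (by simp), ← hindex (C.rotationSystem.K 2),
      C.rotationSystem.card_K₂]
  · rw [C.rotationSystem.numFaces_eq 3 2 (by simp), ← hindex (C.rotationSystem.K 3),
      C.rotationSystem.card_K₃]
  · rw [C.rotationSystem.numFaces_eq 4 3 (by simp)]
    have := hindex (facet W)
    rw [hf, mul_comm n] at this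
    exact Nat.eq_of_mul_eq_mul_left hpos this
  · rw [C.twist.numDualities_eq hS rfl C.mem_cyc_of_conj_mem]
    congr 1
    have := hindex (cyc W)
    rw [C.card_cyc, ← mul_assoc n, mul_comm (n * m)] at this
    exact Nat.eq_of_mul_eq_mul_left (by omega) this

end CosetCertificate

theorem relatorSet_nil : relatorSet [] = ∅ := by simp [relatorSet]

theorem relatorSet_cons (w : List ℕ) (W : List (List ℕ)) :
    relatorSet (w :: W) = insert (word FreeGroup.of w) (relatorSet W) := by
  ext x
  simp [relatorSet, eq_comm]

/-- The digit of index `v` of the number `t` in base 256. -/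
def byte (t v : ℕ) : ℕ := (t >>> (8 * v)) % 256

/-! ### The polytope of type `{3,6,3}` -/

/-- The relators of type `{3,6,3}`, as words. -/
def relatorWords363 : List (List ℕ) := [
  [0, 0, 0],
  List.replicate 6 2,
  [4, 4, 4],
  [0, 2, 0, 2],
  [2, 4, 2, 4],
  [0, 2, 4, 0, 2, 4],
  [1, 2, 2, 1, 2, 2, 1, 2, 2, 1, 2, 2, 0, 3, 3],
  [2, 2, 5, 2, 2, 5, 2, 2, 5, 2, 2, 4, 3, 3, 5],
  [3, 4, 0, 3, 4, 2, 0, 3, 4, 0, 3, 4, 2, 0]]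

/-- The action of the letters on the 147 cosets of `⟨σ₁, σ₂⟩`: the image of the point `v` is the digit
of index `v` in base 256. -/
def table363 : ℕ → ℕ → ℕ
  | 0, v => byte
    575565080283665575111122780235804138511134905892812370787769309216749580962875292935212562490436806676139542184453462766790036106674086933822365564750164163769123916877079326826212584819722180162369788323492666170186898791617628838481070397765402839880424391724169716412933409240099352855738139082254513023835695209994283089161843269391891581627361531136 v
  | 1, v => byte
    571556091582031435368174180450118671385381564970191035744565500533513098166232138508027721739509248689046842560413259508412043899993750789445909964286324074075239916225920528552839764048288034398337018718477012880887464241868522732914865211519445732740248776163158824151316288315329455882150532967331729933007947987655092004503108396621168313888082625536 v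
  | 2, v => byte
    539498549582025279741446022682640272482667683503498202009034231564368879065190600720292923639412011500480167433051633747530232417702995469571239630909960146152430352779127199541069130827468693226034692436507310869967156815801064871940815798843387368383183792525568003048827607263793521794492658032974669139209612523827540998244867979837194519684999021056 v
  | 3, v => byte
    583550511125226644468859653376018840655433745062638281047636486201185421616884776911083664589256884709393149905776517885775155590269839412479266235055155957485521639539684899812910613357730450120212139200600460097838114743376551473435789700643353893129622526637432887852829283617443413890830959789641343654219433940862571036894851943286414755227450278656 v
  | 4, v => byte
    543164234662123328348354164973100705299824358833767674208311868442768800537323438147841005179784425844805275772986234309797854840487146572480121367243320337756480783790548872851711785974663346488569879142914713761313396899861209950653190670689483439823848501985442347425156034216700530240692712791714441497237266099402104303167926376717769928613967168001 v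
  | 5, v => byte
    559480795983958591935785999431587683517041485690354504865310139511482727775923134347367076282525009533007859041341457958701528045065288907842785954698665741932347511939483388042723144273358095078825755577350209669205674175650595847555959777656771410520628212068773513560360701260651294721606484737789928328903069951962171762394405458796086023779608756226 v
  | _, v => v

/-- Deductions that enumerate the cosets of `⟨σ₁, σ₂⟩` in the group. -/
def steps363 : List ℕ := [
  4, 5, 16, 18, 19, 20, 23, 33, 48, 50, 51, 52, 53, 67, 69, 80, 82, 83, 84, 85, 96, 97, 99, 100,
  101, 112, 114, 115, 117, 119, 128, 129, 131, 132, 133, 144, 147, 149, 151, 160, 163, 165, 167,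
  176, 179, 181, 192, 195, 197, 208, 211, 213, 224, 226, 227, 240, 243, 245, 247, 256, 259, 261,
  272, 275, 277, 288, 291, 292, 293, 304, 306, 307, 309, 320, 323, 325, 356, 371, 388, 403, 404,
  436, 449, 467, 484, 499, 546, 568, 612, 626, 627, 644, 659, 664, 673, 676, 691, 692, 696, 724,
  740, 755, 756, 804, 819, 820, 850, 851, 882, 883, 896, 897, 900, 901, 915, 916, 928, 930, 944,
  945, 964, 978, 992, 1008, 1010, 1012, 1013, 1027, 1040, 1042, 1056, 1057, 1058, 1063, 1080,
  1104, 1109, 1123, 1124, 1125, 1136, 1155, 1173, 1176, 1184, 1189, 1204, 1216, 1218, 1221, 1232,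
  1264, 1299, 1312, 1328, 1331, 1332, 1333, 1334, 1336, 1346, 1352, 1360, 1365, 1379, 1381, 1395,
  1408, 1414, 1424, 1427, 1430, 1459, 1462, 1506, 1508, 1520, 1523, 1544, 1552, 1569, 1573, 1574,
  1584, 1600, 1602, 1603, 1605, 1616, 1619, 1621, 1652, 1665, 1670, 1714, 1716, 1717, 1760, 1762,
  1763, 1765, 1767, 1779, 1792, 1798, 1810, 1813, 1828, 1843, 1844, 1845, 1857, 1860, 1891, 1894,
  1908, 1909, 1922, 1924, 1937, 1955, 1956, 2004, 2005, 2018, 2020, 2021, 2067, 2069, 2072, 2084,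
  2085, 2103, 2116, 2117, 2146, 2149, 2180, 2194, 2231, 2272, 2278, 2280, 2291, 2305, 2307, 24,
  56, 200, 216, 262, 423, 455, 488, 551, 552, 583, 584, 616, 631, 663, 679, 727, 775, 801, 806,
  840, 871, 872, 887, 965, 980, 981, 995, 997, 999, 1031, 1047, 1089, 1094, 1096, 1142, 1207,
  1239, 1250, 1271, 1319, 1383, 1394, 1399, 1512, 1525, 1640]

/-- Deductions that enumerate the cosets of `⟨σ₂⟩` in `⟨σ₁, σ₂⟩`. -/
def innerSteps363 : List ℕ := [
  0, 2, 34, 48, 49, 66, 80, 82, 112, 114, 146, 161, 178, 192, 210, 224, 259, 272, 274, 291, 305]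

/-- The certificate for the group of type `{3,6,3}`. -/
def certificate363 : CosetCertificate relatorWords363 147 21 1 where
  p := table363
  lt := by decide +kernel
  inv := by decide +kernel
  letter_lt := by decide +kernel
  cube₁_mem := by decide +kernel
  pow₂_mem := by decide +kernel
  cube₃_mem := by decide +kernel
  sq₁₂_mem := by decide +kernel
  sq₂₃_mem := by decide +kernel
  sq₁₂₃_mem := by decide +kernel
  r_pos := by decide +kernel
  m_pos := by decide +kernel
  m_le := by decide +kernel
  act_relator := by decide +kernel
  act_twist := by decide +kernel
  fix_zero := by decide +kernel
  move_zero := by decide +kernel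
  orbit_lt := by decide +kernel
  order := by decide +kernel
  irreflexible := by decide +kernel
  parent := by decide +kernel
  innerParent := by decide +kernel
  steps := steps363
  steps_lt := by decide +kernel
  complete := by decide +kernel
  innerSteps := innerSteps363
  innerSteps_lt := by decide +kernel
  innerComplete := by decide +kernel
  fixedWords := [
    [2, 5, 1, 2, 2, 0, 4],
    [5, 2, 0, 3, 0, 4],
    [2, 5, 2, 0, 3, 0, 4],
    [5, 1, 2, 2, 0, 4],
    [4, 2, 1, 2, 2, 0, 4],
    [4, 2, 2, 0, 3, 0, 4]]
  fixedWords_lt := by decide +kernel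
  fixed := by decide +kernel

theorem relatorSet_relatorWords363 : relatorSet relatorWords363 = relators363 := by
  simp only [relatorWords363, relators363, coxeterRotationRelators, extraRelators363,
    relatorSet_cons, relatorSet_nil, Set.insert_union, Set.singleton_union]
  repeat' refine congrArg₂ insert ?_ ?_
  all_goals simp [word, letter, pow_succ, mul_assoc]

/-! ### The polytope of type `{3,18,3}` -/

/-- The relators of type `{3,18,3}`, as words. -/
def relatorWords3183 : List (List ℕ) := [
  [0, 0, 0],
  List.replicate 18 2,
  [4, 4, 4],
  [0, 2, 0, 2],
  [2, 4, 2, 4],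
  [0, 2, 4, 0, 2, 4],
  [2, 2, 2, 2, 2, 0, 3, 3, 0, 3, 0, 3, 3, 3, 3, 0],
  [3, 4, 0, 3, 5, 0, 3, 0, 3, 4, 0, 3, 5, 0, 3, 0],
  [2, 2, 1, 4, 2, 0, 3, 4, 2, 2, 1, 4, 2, 1, 2, 1]]

/-- The action of the letters on the 81 cosets of `⟨σ₁, σ₂⟩`: the image of the point `v` is the digit
of index `v` in base 256. -/
def table3183 : ℕ → ℕ → ℕ
  | 0, v => byte
    343613842205031348666356320821255076284983537828869490133767036000158016651470282732505676922588015745041266870113356323216440859283059379628664535199168217762413015491496079525232274367437740800 v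
  | 1, v => byte
    361774353919233153573744651689794975108102156170926146712583055345500239936362194099369744794341111264834695427962989133860956403169919095517634144364934240021015015748084261801245056617366553600 v
  | 2, v => byte
    361863602231206199370995516857282990883782511578999744347249214763541822017438802655865735432771021398114877332524776782049780337807370963506184330291772395968203626104175922449030462359673766400 v
  | 3, v => byte
    361863603832056449350905722434548034343915868163519384557512095208101483970937902648781506039348855034809001780232298065001743185353847919069334220711581077939513274320260306350658856448788857600 v
  | 4, v => byte
    347908526185549674450116707598764846266019119544355866881226694060679826281116108919516804496795125379050604357181165713465002624571677267655293590252057879493748111509190601463878995770932724225 v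
  | 5, v => byte
    334381397870239978117563885751678421143080549935000868000261509816574209120857876721871564982289386258410916637087525275237055746151360582227609681033378241056224473200294478774847490750112923650 v
  | _, v => v

/-- Deductions that enumerate the cosets of `⟨σ₁, σ₂⟩` in the group. -/
def steps3183 : List ℕ := [
  4, 5, 8, 16, 18, 19, 20, 48, 50, 51, 67, 69, 80, 83, 84, 85, 96, 99, 100, 101, 112, 128, 130,
  131, 133, 144, 147, 148, 149, 160, 163, 176, 179, 192, 195, 208, 211, 224, 227, 229, 240, 243,
  256, 259, 272, 288, 291, 304, 307, 320, 544, 547, 551, 576, 579, 643, 672, 675, 692, 723, 740,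
  755, 864, 1120, 1136, 1200, 136, 278, 552, 568, 626, 760, 1027, 1091, 134, 280, 470, 820, 821,
  835, 1046, 1077, 1078, 1124, 1174, 1190, 1217, 1251, 1253, 54, 152, 178, 180, 181, 182, 196,
  210, 212, 242, 245, 260, 261, 274, 275, 277, 289, 292, 293, 308, 309, 311, 325, 328, 338, 339,
  355, 372, 373, 386, 420, 421, 438, 439, 465, 468, 504, 517, 567, 596, 600, 612, 645, 647, 648,
  677, 679, 680, 696, 708, 709, 710, 724, 728, 744, 754, 759, 792, 804, 834, 882, 930, 936, 1000,
  1202, 1204, 1207, 1208, 1266, 1267, 1268, 1282]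

/-- Deductions that enumerate the cosets of `⟨σ₂⟩` in `⟨σ₁, σ₂⟩`. -/
def innerSteps3183 : List ℕ := [
  0, 2, 34, 48, 80, 96, 98, 130, 146, 160, 176, 178, 208, 210, 274, 322, 336, 368, 3, 19, 67, 194,
  211, 243, 275, 289, 307]

/-- The certificate for the group of type `{3,18,3}`. -/
def certificate3183 : CosetCertificate relatorWords3183 81 27 4 where
  p := table3183
  lt := by decide +kernel
  inv := by decide +kernel
  letter_lt := by decide +kernel
  cube₁_mem := by decide +kernel
  pow₂_mem := by decide +kernel
  cube₃_mem := by decide +kernel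
  sq₁₂_mem := by decide +kernel
  sq₂₃_mem := by decide +kernel
  sq₁₂₃_mem := by decide +kernel
  r_pos := by decide +kernel
  m_pos := by decide +kernel
  m_le := by decide +kernel
  act_relator := by decide +kernel
  act_twist := by decide +kernel
  fix_zero := by decide +kernel
  move_zero := by decide +kernel
  orbit_lt := by decide +kernel
  order := by decide +kernel
  irreflexible := by decide +kernel
  parent := by decide +kernel
  innerParent := by decide +kernel
  steps := steps3183
  steps_lt := by decide +kernel
  complete := by decide +kernel
  innerSteps := innerSteps3183
  innerSteps_lt := by decide +kernel
  innerComplete := by decide +kernel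
  fixedWords := [
    [5, 2, 0, 3, 4],
    [1, 5, 2, 2, 0, 4]]
  fixedWords_lt := by decide +kernel
  fixed := by decide +kernel

theorem relatorSet_relatorWords3183 : relatorSet relatorWords3183 = relators3183 := by
  simp only [relatorWords3183, relators3183, coxeterRotationRelators, extraRelators3183,
    relatorSet_cons, relatorSet_nil, Set.insert_union, Set.singleton_union]
  repeat' refine congrArg₂ insert ?_ ?_
  all_goals simp [word, letter, pow_succ, mul_assoc]

theorem AbstractPolytope.not_exists_isPolarity {n : ℕ} (P : AbstractPolytope n) [Finite P.Face]
    (h : P.numDualities 2 = 0) : ¬ ∃ δ, P.IsPolarity δ := by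
  rintro ⟨δ, hδ⟩
  exact Set.eq_empty_iff_forall_notMem.1 ((Set.ncard_eq_zero (Set.toFinite _)).1 h) δ hδ

theorem mainTheorem2 :
    (∃ P : AbstractPolytope 4,
      Finite P.Face ∧
      P.HasSchlafliType ![3, 6, 3] ∧
      P.IsChiral ∧
      P.IsImproperlySelfDual ∧
      (∀ δ, P.IsDuality δ → ∀ Φ, ¬ P.KeepsOrbit δ Φ) ∧
      (¬ ∃ δ, P.IsPolarity δ) ∧
      Nat.card P.Aut = 18522 ∧
      P.HasRotationPresentation relators363 ∧
      (P.numFaces 0 = 147 ∧ P.numFaces 1 = 3087 ∧ P.numFaces 2 = 3087 ∧ P.numFaces 3 = 147) ∧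
      ({δ | P.IsDuality δ}.ncard = 18522 ∧ P.numDualities 4 = 6174 ∧
        P.numDualities 12 = 12348)) ∧
    (∃ P : AbstractPolytope 4,
      Finite P.Face ∧
      P.HasSchlafliType ![3, 18, 3] ∧
      P.IsChiral ∧
      P.IsImproperlySelfDual ∧
      (∀ δ, P.IsDuality δ → ∀ Φ, ¬ P.KeepsOrbit δ Φ) ∧
      (¬ ∃ δ, P.IsPolarity δ) ∧
      Nat.card P.Aut = 39366 ∧
      P.HasRotationPresentation relators3183 ∧
      (P.numFaces 0 = 81 ∧ P.numFaces 1 = 6561 ∧ P.numFaces 2 = 6561 ∧ P.numFaces 3 = 81) ∧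
      ({δ | P.IsDuality δ}.ncard = 39366 ∧ P.numDualities 4 = 4374 ∧
        P.numDualities 12 = 8748 ∧ P.numDualities 36 = 26244)) := by
  refine ⟨?_, ?_⟩
  · obtain ⟨P, hfin, htype, hchiral, himp, horbit, hcard, hpres, ⟨h0, h1, h2, h3⟩, hdual, hnum⟩ :=
      certificate363.exists_polytope relatorSet_relatorWords363
    refine ⟨P, hfin, htype, hchiral, himp, horbit, P.not_exists_isPolarity ?_, hcard, hpres,
      ⟨h0, by omega, by omega, h3⟩, hdual, ?_, ?_⟩
    all_goals rw [hnum]; decide +kernel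
  · obtain ⟨P, hfin, htype, hchiral, himp, horbit, hcard, hpres, ⟨h0, h1, h2, h3⟩, hdual, hnum⟩ :=
      certificate3183.exists_polytope relatorSet_relatorWords3183
    refine ⟨P, hfin, htype, hchiral, himp, horbit, P.not_exists_isPolarity ?_, hcard, hpres,
      ⟨h0, by omega, by omega, h3⟩, hdual, ?_, ?_, ?_⟩
    all_goals rw [hnum]; decide +kernel
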